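/- Let $M$ be a loopless matroid of rank $r+1$ on the ground set $E=\{0,\dots,n\}$, with rank function $\mathrm{rk}$ and Tutte polynomial $$T_M(x,y)=\sum_{S\subseteq E}(x-1)^{r+1-\mathrm{rk}(S)}(y-1)^{|S|-\mathrm{rk}(S)} .$$ Let $$A^\bullet(M)=\mathbb Z[x_F : F \text{ a nonempty proper flat of } M]/(I_M+J_M)$$ be its combinatorial Chow ring, where $I_M$ is generated by the products $x_Fx_G$ with $F,G$ incomparable and $J_M$ by the linear forms $\sum_{F\ni i}x_F-\sum_{F\ni j}x_F$ $(i<j)$, graded by $\deg x_F=1$. There is exactly one isomorphism of groups $\deg_{A^\bullet(M)}\colon A^r(M)\to\mathbb Z$ that sends $x_{F_1}\cdots x_{F_r}$ to $1$ for every chain $F_1\subsetneq\dots\subsetneq F_r$ of nonempty proper flats. For $1\le k\le n$ let $\alpha_k\in A^1(M)$ be the (pullback of the) class of $\mathcal O(1)$ on the Grassmannian $\mathrm{Gr}(k,n+1)$, that is, the class $$\alpha_k=-\sum_F\bigl(\phi_k^{\min}(e_F)-k\,(e_F)_0\bigr)\,x_F,\qquad \phi_k^{\min}(x)=\min_{A\subseteq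 E,\ |A|=k}\ \sum_{i\in A}x_i,$$ of the support function of the $k$-th hypersimplex (translated to coordinate sum $0$), where $e_F=\sum_{i\in F}e_i\in\mathbb Z^{n+1}$; and put $\gamma_k=\alpha_{n+1-k}$. For nonnegative integers $c_1,\dots,c_d$ with $c_1+\dots+c_d=d$, the mixed Eulerian number $A_{c_1,\dots,c_d}$ is the normalized mixed volume ($d!$ times the mixed volume, with respect to the lattice $\mathbb Z^{d+1}\cap\{\sum x_i=0\}$) of the hypersimplices $P(1^j,0^{d+1-j})$ (the convex hull of all permutations of the vector $(1^j,0^{d+1-j})$, translated to coordinate sum $0$), the $j$-th taken with multiplicity $c_j$; for $d=0$ it is $1$. Let $a_1,\dots,a_k\ge 1$ be integers with $a_1+\dots+a_k=r$, and put $$A_{a_1,\dots,a_k}(y)=\sum_{i=0}^{r-k}A_{0^i,a_1,\dots,a_k,0^{r-k-i}}\,y^i .$$ Then $$\sum_{i=0}^{n-k}\deg_{A^\bullet(M)}\bigl(\gamma_{1+i}^{a_1}\cdots\gamma_{k+i}^{a_k}\bigr)\,y^i=T_M(1,y)\,A_{a_1,\dots,a_k}(y).$$ Equivalently, $A_{a_1,\dots,a_k}(y)\neq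 0$ and $$T_M(1,y)=\frac{1}{A_{a_1,\dots,a_k}(y)}\sum_{i=0}^{n-k}\deg_{A^\bullet(M)}\bigl(\alpha_{n-i}^{a_1}\alpha_{n-i-1}^{a_2}\cdots\alpha_{n-i-k+1}^{a_k}\bigr)\,y^i .$$ -/

import Mathlib

namespace MatroidChow

noncomputable section

open scoped Pointwise
open MeasureTheory

variable {n : ℕ}

/-! ### The Tutte polynomial -/

/-- The rank function of a matroid on `{0, …, n}`, as a natural number. -/
def rk (M : Matroid (Fin (n + 1))) (S : Set (Fin (n + 1))) : ℕ := (M.eRk S).toNat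

/-- The Tutte polynomial `T_M(x, y)`; the variable `x` is `X 0` and `y` is `X 1`.  Both exponents
are genuine (non-truncated) differences, since `rk S ≤ rk E` and `rk S ≤ |S|`. -/
def tutte (M : Matroid (Fin (n + 1))) : MvPolynomial (Fin 2) ℤ :=
  ∑ S : Finset (Fin (n + 1)),
    (MvPolynomial.X 0 - 1) ^ (rk M M.E - rk M S) * (MvPolynomial.X 1 - 1) ^ (S.card - rk M S)

/-- `T_M(1, y)`, as a polynomial in `y`. -/
def tutteOne (M : Matroid (Fin (n + 1))) : Polynomial ℤ :=
  MvPolynomial.aeval ![(1 : Polynomial ℤ), Polynomial.X] (tutte M)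

/-! ### The combinatorial Chow ring -/

/-- The nonempty proper flats of `M`. -/
abbrev ProperFlat (M : Matroid (Fin (n + 1))) : Type :=
  {F : Set (Fin (n + 1)) // M.IsFlat F ∧ F.Nonempty ∧ F ≠ Set.univ}

instance (M : Matroid (Fin (n + 1))) : Fintype (ProperFlat M) := Fintype.ofFinite _

open Classical in
/-- The linear form `∑_{F ∋ i} x_F`. -/
def starSum (M : Matroid (Fin (n + 1))) (i : Fin (n + 1)) : MvPolynomial (ProperFlat M) ℤ :=
  ∑ F : ProperFlat M, if i ∈ F.1 then MvPolynomial.X F else 0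

/-- The ideal generated by the products `x_F x_G` with `F`, `G` incomparable. -/
def idealI (M : Matroid (Fin (n + 1))) : Ideal (MvPolynomial (ProperFlat M) ℤ) :=
  Ideal.span {p | ∃ F G : ProperFlat M, ¬ F.1 ⊆ G.1 ∧ ¬ G.1 ⊆ F.1 ∧
    p = MvPolynomial.X F * MvPolynomial.X G}

/-- The ideal generated by the linear forms `∑_{F ∋ i} x_F - ∑_{G ∋ j} x_G`. -/
def idealJ (M : Matroid (Fin (n + 1))) : Ideal (MvPolynomial (ProperFlat M) ℤ) :=
  Ideal.span {p | ∃ i j : Fin (n + 1), i < j ∧ p = starSum M i - starSum M j}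

/-- The combinatorial Chow ring `A^•(M) = ℤ[x_F] / (I_M + J_M)`. -/
abbrev ChowRing (M : Matroid (Fin (n + 1))) : Type :=
  MvPolynomial (ProperFlat M) ℤ ⧸ (idealI M ⊔ idealJ M)

/-- The class `x_F` in `A^•(M)`. -/
def flatClass (M : Matroid (Fin (n + 1))) (F : ProperFlat M) : ChowRing M :=
  Ideal.Quotient.mk (idealI M ⊔ idealJ M) (MvPolynomial.X F)

/-- The graded piece `A^d(M)`: the classes of homogeneous polynomials of degree `d`. -/
def chowPiece (M : Matroid (Fin (n + 1))) (d : ℕ) : Submodule ℤ (ChowRing M) :=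
  (MvPolynomial.homogeneousSubmodule (ProperFlat M) ℤ d).map
    (Ideal.Quotient.mkₐ ℤ (idealI M ⊔ idealJ M)).toLinearMap

theorem flatClass_mem (M : Matroid (Fin (n + 1))) (F : ProperFlat M) :
    flatClass M F ∈ chowPiece M 1 :=
  ⟨MvPolynomial.X F, MvPolynomial.isHomogeneous_X ℤ F, rfl⟩

theorem prod_pow_mem (M : Matroid (Fin (n + 1))) {k : ℕ} {c : Fin k → ChowRing M}
    (hc : ∀ j, c j ∈ chowPiece M 1) (a : Fin k → ℕ) {r : ℕ} (ha : ∑ j, a j = r) :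
    ∏ j, c j ^ a j ∈ chowPiece M r := by
  choose p hp hpc using hc
  refine ⟨∏ j, p j ^ a j, ?_, ?_⟩
  · subst ha
    have h : (∏ j, p j ^ a j).IsHomogeneous (∑ j, 1 * a j) :=
      MvPolynomial.IsHomogeneous.prod _ _ _
        (fun j _ => MvPolynomial.IsHomogeneous.pow (hp j) (a j))
    simpa using h
  · have h : ∀ j, (Ideal.Quotient.mkₐ ℤ (idealI M ⊔ idealJ M)) (p j) = c j := hpc
    change (Ideal.Quotient.mkₐ ℤ (idealI M ⊔ idealJ M)) (∏ j, p j ^ a j) = _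
    simp only [map_prod, map_pow, h]

/-- The class `x_{F_1} ⋯ x_{F_r}` in `A^r(M)` of a sequence of `r` nonempty proper flats. -/
def chainClass (M : Matroid (Fin (n + 1))) {r : ℕ} (F : Fin r → ProperFlat M) : chowPiece M r :=
  ⟨∏ j, flatClass M (F j) ^ 1, prod_pow_mem M (fun j => flatClass_mem M (F j)) _ (by simp)⟩

/-- For `M` of rank `r + 1`: `φ` is an isomorphism `A^r(M) → ℤ` sending `x_{F_1} ⋯ x_{F_r}` to `1`
for every chain `F_1 ⊊ ⋯ ⊊ F_r` of nonempty proper flats. -/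
structure IsDegreeMap (M : Matroid (Fin (n + 1))) (r : ℕ) (φ : chowPiece M r →+ ℤ) : Prop where
  bijective : Function.Bijective φ
  chain : ∀ F : Fin r → ProperFlat M, StrictMono F → φ (chainClass M F) = 1

open Classical in
/-- The degree map `A^r(M) → ℤ` of a matroid of rank `r + 1`.  (That exactly one degree map exists
for loopless `M` is part of the claim of the main theorem.) -/
def degree (M : Matroid (Fin (n + 1))) (r : ℕ) : chowPiece M r →+ ℤ :=
  if h : ∃ φ : chowPiece M r →+ ℤ, IsDegreeMap M r φ then h.choose else 0

/-! ### The nef divisor classes `α_k` and `γ_k` -/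

/-- The minimum of the sums of `k` of the coordinates of `x`. -/
def phiMin {m : ℕ} (k : ℕ) (x : Fin m → ℤ) : ℤ :=
  ⨅ A : {A : Finset (Fin m) // A.card = k}, ∑ i ∈ A.1, x i

/-- The class `-∑_F f(e_F) x_F` in `A^1(M)` of a piecewise linear function `f` on the Bergman fan,
where `e_F = ∑_{i ∈ F} e_i`. -/
def divisorClass (M : Matroid (Fin (n + 1))) (f : (Fin (n + 1) → ℤ) → ℤ) : ChowRing M :=
  -∑ F : ProperFlat M, f (Set.indicator F.1 1) • flatClass M F

/-- The class `α_k`, `1 ≤ k ≤ n`, of the line bundle `O(1)` of the Grassmannian `Gr(k, n + 1)`.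
On the permutohedral variety (a generic torus orbit closure) it is given by the support function
`u ↦ min_{v ∈ P} ⟨u, v⟩` of the `k`-th hypersimplex `P`, translated to the hyperplane of coordinate
sum `0` by `-k e_0`.  Any other translation changes the function by a linear function on
`ℤ^{n+1} / ⟨(1, …, 1)⟩`, hence does not change the class. -/
def alpha (M : Matroid (Fin (n + 1))) (k : ℕ) : ChowRing M :=
  divisorClass M (fun x => phiMin k x - k * x 0)

/-- The class `γ_k = α_{n+1-k}`, `1 ≤ k ≤ n`. -/
def gamma (M : Matroid (Fin (n + 1))) (k : ℕ) : ChowRing M := alpha M (n + 1 - k)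

theorem alpha_mem (M : Matroid (Fin (n + 1))) (k : ℕ) : alpha M k ∈ chowPiece M 1 :=
  Submodule.neg_mem _ (Submodule.sum_mem _ fun F _ => Submodule.smul_mem _ _ (flatClass_mem M F))

/-- `γ_{1+i}^{a_1} ⋯ γ_{k+i}^{a_k}` as an element of `A^r(M)`, where `r = a_1 + ⋯ + a_k`. -/
def gammaMonomial (M : Matroid (Fin (n + 1))) {k r : ℕ} (a : Fin k → ℕ) (ha : ∑ j, a j = r)
    (i : ℕ) : chowPiece M r :=
  ⟨∏ j : Fin k, gamma M ((j : ℕ) + 1 + i) ^ a j, prod_pow_mem M (fun _ => alpha_mem M _) a ha⟩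

/-- `α_{n-i}^{a_1} α_{n-i-1}^{a_2} ⋯ α_{n-i-k+1}^{a_k}` as an element of `A^r(M)`, where
`r = a_1 + ⋯ + a_k`. -/
def alphaMonomial (M : Matroid (Fin (n + 1))) {k r : ℕ} (a : Fin k → ℕ) (ha : ∑ j, a j = r)
    (i : ℕ) : chowPiece M r :=
  ⟨∏ j : Fin k, alpha M (n - i - (j : ℕ)) ^ a j, prod_pow_mem M (fun _ => alpha_mem M _) a ha⟩

/-! ### Mixed Eulerian numbers -/

/-- `P(x)`: the convex hull of all permutations of the vector `x`. -/
def permutohedron {m : ℕ} (x : Fin m → ℝ) : Set (Fin m → ℝ) :=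
  convexHull ℝ (Set.range fun σ : Equiv.Perm (Fin m) => x ∘ σ)

/-- The hypersimplex `P(1^k, 0^{m-k})` in `ℝ^m`. -/
def hypersimplex (m k : ℕ) : Set (Fin m → ℝ) :=
  permutohedron fun j => if (j : ℕ) < k then 1 else 0

/-- The image of `P ⊆ ℝ^{d+1}` under deletion of the last coordinate.  On the hyperplane
`∑ x_i = 0` deletion of the last coordinate is a linear isomorphism onto `ℝ^d` which maps the lattice
`ℤ^{d+1} ∩ {∑ x_i = 0}` onto `ℤ^d`, so that lattice volume becomes Lebesgue measure. -/
def dropLast {d : ℕ} (P : Set (Fin (d + 1) → ℝ)) : Set (Fin d → ℝ) :=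
  (fun x => x ∘ Fin.castSucc) '' P

/-- The normalized mixed volume `d! MV(P_1, …, P_d)` of `d` polytopes in `ℝ^d` (indexed by a type
`ι` of `d` elements), i.e. the polarization
`∑_{S ⊆ {1, …, d}} (-1)^{d - |S|} vol(∑_{i ∈ S} P_i)` of the volume, with Minkowski sums. -/
def normalizedMixedVolume {d : ℕ} {ι : Type} [Fintype ι] (P : ι → Set (Fin d → ℝ)) : ℝ :=
  ∑ S : Finset ι, (-1) ^ (Fintype.card ι - S.card) * (volume (∑ i ∈ S, P i)).toReal

/-- The mixed Eulerian number `A_{c_1, …, c_d}`, where `c_1 + ⋯ + c_d = d`: the normalized mixed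
volume of the hypersimplices `P(1^j, 0^{d+1-j})`, `1 ≤ j ≤ d`, the `j`-th taken `c_j` times.
(Mixed volumes do not change under translations.) -/
def mixedEulerian {d : ℕ} (c : Fin d → ℕ) : ℝ :=
  normalizedMixedVolume fun p : (Σ j : Fin d, Fin (c j)) =>
    dropLast (hypersimplex (d + 1) ((p.1 : ℕ) + 1))

/-- The sequence `0^i, a_1, …, a_k, 0^{r-k-i}` of length `r`. -/
def padded (r : ℕ) {k : ℕ} (a : Fin k → ℕ) (i : ℕ) : Fin r → ℕ := fun j =>
  if h : i ≤ (j : ℕ) ∧ (j : ℕ) - i < k then a ⟨(j : ℕ) - i, h.2⟩ else 0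

/-- The polynomial `A_{a_1, …, a_k}(y) = ∑_{i=0}^{r-k} A_{0^i, a_1, …, a_k, 0^{r-k-i}} y^i`, where
`r = a_1 + ⋯ + a_k`. -/
def mixedEulerianPoly {k : ℕ} (a : Fin k → ℕ) : Polynomial ℝ :=
  ∑ i ∈ Finset.range ((∑ j, a j) - k + 1),
    Polynomial.C (mixedEulerian (padded (∑ j, a j) a i)) * Polynomial.X ^ i

end

end MatroidChow

/-!
The numbers on both sides come from linear functionals on sequences `y_k`, `k ∈ ℤ`, of elements of
a real algebra that satisfy Klyachko's relations `y_k (2 y_k - y_{k-1} - y_{k+1}) = 0`. They let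
every monomial `y_s^{a_1} ⋯ y_{s+k-1}^{a_k}` of degree `r` with all `a_j ≥ 1` be written as
`∑_m p_m y_{s-m} y_{s-m+1} ⋯ y_{s-m+r-1}`, a combination of products of `r` consecutive elements
(windows), where the coefficients `p_m` depend on `a` only and add up to `1`
(`exists_monomial_expansion`). If `y_k = 0` for `k` outside `1, …, N`, the values of a functional
on the shifts of the monomial are therefore the coefficients of the product of `p = ∑ p_m Y^m` with
the generating function of the values on windows (`functional_monomial`). This applies twice.

* In the real Chow ring of `M`, modulo the kernel of the degree pairing, the classes `γ_k` satisfy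
  Klyachko's relations, with `N = n`, and the windows have the degrees
  `deg (γ_{j+1} ⋯ γ_{j+r}) = r! [y^j] T_M(1, y)` (`pairQ_window`).
* There is a functional with `N = r` whose values on monomials of degree `r` are the mixed Eulerian
  numbers (`mixedEulerian_eq`); its value on the only window `y_1 ⋯ y_r` is `r!`.

Hence `A_a(y) = r! p`, which is nonzero because `p(1) = 1`, and the generating function of the
degrees is `r! p T_M(1, y)`.

*The Chow ring.*  For flats `A ⊂ B` a volume polynomial `V_{AB}` is defined by a recursion over the
flats `F` in between.  Its characteristic property (`volSpec`) is that `∂_F V_{AB} = V_{AF} V_{FB}`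
for `A ⊂ F ⊂ B`, and that the derivatives in the directions of the linear relations of the Chow ring
vanish.  Applying polynomials as differential operators to `V_{∅E}` hence factors through the Chow
ring and takes the value `1` on complete chains; as `A^r(M)` is generated by the class of any
complete chain, this functional is the degree (`existsUnique_isDegreeMap`, `degree_eq`).  The
class `γ_k` acts as `∑_F -max(0, |F| - k) ∂_F`.  The second difference in `k` of these operators is,
up to sign, the sum of `∂_F` over the flats with `k` elements, and `γ_k` kills `∂_F V_{∅E}` for each
of these flats; Klyachko's relations follow (`klyachkoSeq_hsClass`).
Differentiating a window once expresses its degree through those of the intervals above an atom and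
below a coatom (`windowDeg_recursion`), and the Tutte polynomials of these intervals obey
the same recursion (`sum_atoms`, `sum_coatoms`), whence `windowDeg_eq`.

*Mixed Eulerian numbers.*  A Minkowski sum of hypersimplices is a permutohedron, given by
inequalities on the partial sums of a weakly decreasing sequence `x` (`sum_hypersimplex`).
Its slices along a coordinate with value between `x_{i+1}` and `x_i` are again permutohedra, for the
sequence in which these two entries are replaced by one.  Integrating over the slices corresponds,
on powers of linear forms, to divided differences of polynomials, so that the volume is given by a
functional `eulerFun` defined by such a recursion (`volume_permBody`), and polarization turns this
into the formula for mixed volumes.  The compatibility of divided differences with Klyachko's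
relations is a direct computation (`eulerFun_rel`).
-/

namespace MatroidChow

noncomputable section

section

/-! ### Klyachko's relations -/

/-- A sequence `y` in a commutative ring satisfies Klyachko's relations if
`y_j (2 y_j - y_{j-1} - y_{j+1}) = 0` for all `j`. -/
def KlyachkoSeq {Q : Type} [CommRing Q] (y : ℤ → Q) : Prop :=
  ∀ j, y j * (2 * y j - y (j - 1) - y (j + 1)) = 0

/-- The product `y_s y_{s+1} ⋯ y_{s+l-1}` over a window of `l` consecutive indices. -/
def window {Q : Type} [CommRing Q] (y : ℤ → Q) (s : ℤ) (l : ℕ) : Q :=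
  ∏ t ∈ Finset.range l, y (s + t)

theorem window_succ_right {Q : Type} [CommRing Q] (y : ℤ → Q) (s : ℤ) (l : ℕ) :
    window y s (l + 1) = window y s l * y (s + l) := by
  simp [window, Finset.prod_range_succ]

theorem window_succ_left {Q : Type} [CommRing Q] (y : ℤ → Q) (s : ℤ) (l : ℕ) :
    window y (s - 1) (l + 1) = window y s l * y (s - 1) := by
  simp only [window, Finset.prod_range_succ']
  congr 1
  · refine Finset.prod_congr rfl fun t _ => ?_
    congr 1; push_cast; ring
  · simp

theorem dvd_window {Q : Type} [CommRing Q] (y : ℤ → Q) (s : ℤ) {l j : ℕ} (hj : j < l) :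
    y (s + j) ∣ window y s l :=
  Finset.dvd_prod_of_mem (fun t : ℕ => y (s + t)) (Finset.mem_range.2 hj)

/-- Multiplying a window by one of its own members.  By Klyachko's relations the products
`W y_{s+j}`, for `-1 ≤ j ≤ l`, form an arithmetic progression, whose ends are the two windows
extending `W`. -/
theorem window_mul_mem {Q : Type} [CommRing Q] [Algebra ℝ Q] {y : ℤ → Q} (hy : KlyachkoSeq y)
    (s : ℤ) {l j : ℕ} (hj : j < l) :
    window y s l * y (s + j) =
      (((l : ℝ) - j) / (l + 1)) • window y (s - 1) (l + 1) +
        (((j : ℝ) + 1) / (l + 1)) • window y s (l + 1) := by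
  set u : ℕ → Q := fun i => window y s l * y (s - 1 + i) with hu
  have hstep : ∀ i < l, u (i + 2) - u (i + 1) = u (i + 1) - u i := by
    intro i hi
    obtain ⟨q, hq⟩ := dvd_window y s hi
    have h := hy (s + i)
    have e1 : s - 1 + ((i + 1 : ℕ) : ℤ) = s + i := by push_cast; ring
    have e2 : s - 1 + ((i + 2 : ℕ) : ℤ) = s + i + 1 := by push_cast; ring
    have e3 : s - 1 + (i : ℤ) = s + i - 1 := by ring
    simp only [hu, e1, e2, e3, hq]
    linear_combination (-q) * h
  have hlin : ∀ i ≤ l, u (i + 1) - u i = u 1 - u 0 ∧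
      u (i + 1) = u 0 + (i + 1 : ℝ) • (u 1 - u 0) := by
    intro i
    induction i with
    | zero => intro _; simp
    | succ i ih =>
      intro hi
      obtain ⟨h1, h2⟩ := ih (by omega)
      have h3 : u (i + 1 + 1) - u (i + 1) = u 1 - u 0 := by rw [← h1]; exact hstep i (by omega)
      refine ⟨h3, ?_⟩
      rw [sub_eq_iff_eq_add.1 h3, h2]
      push_cast
      module
  have e0 : window y (s - 1) (l + 1) = u 0 := by simp [window_succ_left, hu]
  have e1 : window y s (l + 1) = u (l + 1) := by
    rw [window_succ_right]; simp only [hu]; congr 2; push_cast; ring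
  have e2 : window y s l * y (s + j) = u (j + 1) := by
    simp only [hu]; congr 2; push_cast; ring
  rw [e0, e1, e2, (hlin j hj.le).2, (hlin l le_rfl).2]
  have hl : (l : ℝ) + 1 ≠ 0 := by positivity
  match_scalars
  · field_simp
    ring
  · field_simp

open Polynomial in
/-- A window times further members of it is an affine combination of longer windows; the
coefficients of the combination depend only on the relative positions. -/
theorem exists_window_expansion (k : ℕ) (js : List ℕ) (hjs : ∀ j ∈ js, j < k) :
    ∃ p : ℝ[X], p.natDegree ≤ js.length ∧ p.eval 1 = 1 ∧
      ∀ (Q : Type) [CommRing Q] [Algebra ℝ Q] (y : ℤ → Q), KlyachkoSeq y → ∀ s : ℤ,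
        window y s k * (js.map fun j : ℕ => y (s + j)).prod =
          ∑ m ∈ Finset.range (js.length + 1), p.coeff m • window y (s - m) (k + js.length) := by
  induction js with
  | nil =>
    refine ⟨1, by simp, by simp, fun Q _ _ y _ s => by simp⟩
  | cons j js ih =>
    obtain ⟨p, hdeg, heval, hp⟩ := ih fun i hi => hjs i (List.mem_cons_of_mem _ hi)
    have hj : j < k := hjs j List.mem_cons_self
    set d := js.length with hd
    -- the contribution of the window starting at `s - m` splits between the two longer windows
    set q : ℝ[X] := ∑ m ∈ Finset.range (d + 1), p.coeff m •
      (C (((k + d : ℕ) - (j + m : ℕ) : ℝ) / ((k + d : ℕ) + 1)) * X ^ (m + 1) +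
        C ((((j + m : ℕ) : ℝ) + 1) / ((k + d : ℕ) + 1)) * X ^ m) with hq
    have hcoeff : ∀ m', q.coeff m' = ∑ m ∈ Finset.range (d + 1), p.coeff m *
        ((((k + d : ℕ) - (j + m : ℕ) : ℝ) / ((k + d : ℕ) + 1)) * (if m' = m + 1 then 1 else 0) +
        ((((j + m : ℕ) : ℝ) + 1) / ((k + d : ℕ) + 1)) * (if m' = m then 1 else 0)) := by
      intro m'
      rw [hq, finsetSum_coeff]
      refine Finset.sum_congr rfl fun m _ => ?_
      simp only [coeff_smul, coeff_add, coeff_C_mul, coeff_X_pow, smul_eq_mul]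
    refine ⟨q, ?_, ?_, ?_⟩
    · refine natDegree_sum_le_of_forall_le _ _ fun m hm => ?_
      have hm' : m < d + 1 := Finset.mem_range.1 hm
      refine (natDegree_smul_le _ _).trans (natDegree_add_le_of_degree_le ?_ ?_)
      · exact (natDegree_C_mul_X_pow_le _ _).trans (by simp; omega)
      · exact (natDegree_C_mul_X_pow_le _ _).trans (by simp; omega)
    · have h1 : p.eval 1 = ∑ m ∈ Finset.range (d + 1), p.coeff m := by
        rw [eval_eq_sum_range' (n := d + 1) (by omega)]; simp
      suffices q.eval 1 = p.eval 1 from this.trans heval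
      rw [h1, hq, eval_finsetSum]
      refine Finset.sum_congr rfl fun m _ => ?_
      have : ((k + d : ℕ) : ℝ) + 1 ≠ 0 := by positivity
      simp only [eval_smul, eval_add, eval_mul, eval_C, eval_pow, eval_X, one_pow, smul_eq_mul]
      field_simp
      ring
    · intro Q _ _ y hy s
      rw [List.map_cons, List.prod_cons, mul_left_comm, hp Q y hy s, Finset.mul_sum]
      have hL : (j :: js).length = d + 1 := by simp [hd]
      rw [hL]
      have key : ∀ m ∈ Finset.range (d + 1),
          y (s + j) * p.coeff m • window y (s - m) (k + d) =
            ∑ m' ∈ Finset.range (d + 1 + 1), (p.coeff m *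
              ((((k + d : ℕ) - (j + m : ℕ) : ℝ) / ((k + d : ℕ) + 1)) *
                (if m' = m + 1 then 1 else 0) +
              ((((j + m : ℕ) : ℝ) + 1) / ((k + d : ℕ) + 1)) * (if m' = m then 1 else 0))) •
              window y (s - m') (k + (d + 1)) := by
        intro m hm
        have hm' : m < d + 1 := Finset.mem_range.1 hm
        have hw := window_mul_mem hy (s - m) (l := k + d) (j := j + m) (by omega)
        have e1 : s - (m : ℤ) + ((j + m : ℕ) : ℤ) = s + j := by push_cast; ring
        have e2 : s - (m : ℤ) - 1 = s - ((m + 1 : ℕ) : ℤ) := by push_cast; ring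
        rw [e1, e2] at hw
        rw [mul_smul_comm, mul_comm (y _), hw]
        simp only [mul_add, add_smul, Finset.sum_add_distrib, mul_ite, mul_one, mul_zero, ite_smul,
          zero_smul, Finset.sum_ite_eq', Finset.mem_range]
        rw [if_pos (by omega), if_pos (by omega), smul_add, smul_smul, smul_smul]
        rfl
      rw [Finset.sum_congr rfl key, Finset.sum_comm]
      refine Finset.sum_congr rfl fun m' _ => ?_
      rw [hcoeff, Finset.sum_smul]

open Polynomial in
/-- A monomial with positive exponents `a_1, …, a_k` on a window is a combination of windows of
length `r = a_1 + ⋯ + a_k`, with coefficients that depend only on `a`. -/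
theorem exists_monomial_expansion {k r : ℕ} (a : Fin k → ℕ) (ha : ∀ j, 1 ≤ a j)
    (har : ∑ j, a j = r) :
    ∃ p : ℝ[X], p.natDegree ≤ r - k ∧ p.eval 1 = 1 ∧
      ∀ (Q : Type) [CommRing Q] [Algebra ℝ Q] (y : ℤ → Q), KlyachkoSeq y → ∀ s : ℤ,
        ∏ j : Fin k, y (s + (j : ℕ)) ^ a j =
          ∑ m ∈ Finset.range (r - k + 1), p.coeff m • window y (s - m) r := by
  set js : List ℕ := (List.finRange k).flatMap fun j => List.replicate (a j - 1) (j : ℕ) with hjs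
  have hlen' : js.length + k = r := by
    have h1 : js.length = ∑ j : Fin k, (a j - 1) := by
      simp only [hjs, List.length_flatMap, List.length_replicate, Fin.sum_univ_def]
    have h2 : ∑ j : Fin k, (a j - 1) + ∑ _j : Fin k, 1 = r := by
      rw [← Finset.sum_add_distrib, ← har]
      exact Finset.sum_congr rfl fun j _ => Nat.sub_add_cancel (ha j)
    rw [h1]; simpa using h2
  have hlen : js.length = r - k := by omega
  obtain ⟨p, h1, h2, h3⟩ := exists_window_expansion k js (by
    intro j hj
    simp only [hjs, List.mem_flatMap, List.mem_replicate] at hj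
    obtain ⟨i, -, -, rfl⟩ := hj
    exact i.2)
  rw [hlen] at h1 h3
  refine ⟨p, h1, h2, fun Q _ _ y hy s => ?_⟩
  have h4 := h3 Q y hy s
  rw [show k + (r - k) = r by omega] at h4
  rw [← h4]
  have h5 : (js.map fun j : ℕ => y (s + j)).prod = ∏ j : Fin k, y (s + (j : ℕ)) ^ (a j - 1) := by
    rw [Fin.prod_univ_def, hjs, List.map_flatMap, List.flatMap_def, List.prod_flatten]
    simp [Function.comp_def]
  rw [h5, window, Finset.prod_range fun t => y (s + t), ← Finset.prod_mul_distrib]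
  refine Finset.prod_congr rfl fun j _ => ?_
  rw [← pow_succ', Nat.sub_add_cancel (ha j)]

/-- A window that leaves the range `1, …, N` of the indices of nonzero members vanishes. -/
theorem window_eq_zero {Q : Type} [CommRing Q] {y : ℤ → Q} {N : ℕ}
    (hy : ∀ k : ℤ, k ≤ 0 ∨ (N : ℤ) + 1 ≤ k → y k = 0) {s : ℤ} {l : ℕ} (hl : 0 < l)
    (hs : s ≤ 0 ∨ (N : ℤ) + 1 ≤ s + l - 1) : window y s l = 0 := by
  rcases hs with hs | hs
  · have := dvd_window y s hl
    rwa [hy _ (Or.inl (by simpa using hs)), zero_dvd_iff] at this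
  · have := dvd_window y s (l := l) (j := l - 1) (by omega)
    rwa [hy _ (Or.inr (by omega)), zero_dvd_iff] at this

open Polynomial in
/-- The values of a functional on the monomials `y_{1+i}^{a_1} ⋯ y_{k+i}^{a_k}` are the
coefficients of the product of two polynomials: one that depends only on `a`, and the generating
function of the values on windows of length `r = a_1 + ⋯ + a_k`. -/
theorem functional_monomial {k r N : ℕ} (hkr : k ≤ r) (hrN : r ≤ N) {p T : ℝ[X]}
    (hp : p.natDegree ≤ r - k) (hT : T.natDegree ≤ N - r) {Q : Type} [CommRing Q] [Algebra ℝ Q]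
    {y : ℤ → Q} (hy0 : ∀ k : ℤ, k ≤ 0 ∨ (N : ℤ) + 1 ≤ k → y k = 0) (L : Q →ₗ[ℝ] ℝ) (c : ℝ)
    (hL : ∀ j : ℕ, j + r ≤ N → L (window y (1 + j) r) = c * T.coeff j) (x : Q) (i : ℕ)
    (hi : i + k ≤ N)
    (hx : x = ∑ m ∈ Finset.range (r - k + 1), p.coeff m • window y (1 + i - m) r) :
    L x = c * (p * T).coeff i := by
  have hterm : ∀ m ∈ Finset.range (r - k + 1), L (window y (1 + i - m) r) =
      if m ≤ i then c * T.coeff (i - m) else 0 := by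
    intro m hm
    have hm' : m < r - k + 1 := Finset.mem_range.1 hm
    split_ifs with hmi
    · by_cases hN : i - m + r ≤ N
      · rw [← hL _ hN]
        congr 2; omega
      · rw [coeff_eq_zero_of_natDegree_lt (by omega), mul_zero,
          window_eq_zero hy0 (by omega) (Or.inr (by omega)), map_zero]
    · rw [window_eq_zero hy0 (by omega) (Or.inl (by omega)), map_zero]
  rw [hx, map_sum, coeff_mul, Finset.Nat.sum_antidiagonal_eq_sum_range_succ_mk, Finset.mul_sum]
  have h1 : ∀ m ∈ Finset.range (r - k + 1), L (p.coeff m • window y (1 + i - m) r) =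
      if m ≤ i then c * (p.coeff m * T.coeff (i - m)) else 0 := by
    intro m hm
    rw [map_smul, hterm m hm, smul_eq_mul]
    split_ifs <;> ring
  rw [Finset.sum_congr rfl h1, ← Finset.sum_filter]
  refine Finset.sum_subset (fun m hm => ?_) fun m hm hm' => ?_
  · have := (Finset.mem_filter.1 hm).2
    exact Finset.mem_range.2 (by omega)
  · have h2 : m < i + 1 := Finset.mem_range.1 hm
    rw [coeff_eq_zero_of_natDegree_lt (p := p), zero_mul, mul_zero]
    by_contra h3
    exact hm' (Finset.mem_filter.2 ⟨Finset.mem_range.2 (by omega), by omega⟩)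

end

section

variable {n : ℕ}

/-! ### Finite closure operators and ranks -/

open Classical in
/-- The closure of a finite set of elements, as a finite set. -/
def cl (M : Matroid (Fin (n + 1))) (S : Finset (Fin (n + 1))) : Finset (Fin (n + 1)) :=
  Finset.univ.filter fun i => i ∈ M.closure (S : Set (Fin (n + 1)))

/-- The rank of a finite set of elements. -/
def frk (M : Matroid (Fin (n + 1))) (S : Finset (Fin (n + 1))) : ℕ := rk M (S : Set (Fin (n + 1)))

/-- Flats, as finite sets of elements. -/
def Flat (M : Matroid (Fin (n + 1))) (F : Finset (Fin (n + 1))) : Prop :=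
  M.IsFlat (F : Set (Fin (n + 1)))

section Rank

variable {M : Matroid (Fin (n + 1))}

theorem coe_cl (M : Matroid (Fin (n + 1))) (S : Finset (Fin (n + 1))) :
    (cl M S : Set (Fin (n + 1))) = M.closure S := by
  ext i; simp [cl]

theorem coe_frk (M : Matroid (Fin (n + 1))) (S : Finset (Fin (n + 1))) :
    (frk M S : ℕ∞) = M.eRk S :=
  ENat.natCast_toNat (M.isRkFinite_of_finite S.finite_toSet).eRk_lt_top.ne

theorem flat_cl (M : Matroid (Fin (n + 1))) (S : Finset (Fin (n + 1))) : Flat M (cl M S) := by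
  unfold Flat; rw [coe_cl]; exact M.isFlat_closure _

theorem Flat.cl_eq {F : Finset (Fin (n + 1))} (hF : Flat M F) : cl M F = F := by
  rw [← Finset.coe_inj, coe_cl]; exact Matroid.IsFlat.closure hF

theorem subset_cl (hE : M.E = Set.univ) (S : Finset (Fin (n + 1))) : S ⊆ cl M S := by
  rw [← Finset.coe_subset, coe_cl]
  exact M.subset_closure _ (by rw [hE]; exact Set.subset_univ _)

theorem cl_mono {S T : Finset (Fin (n + 1))} (h : S ⊆ T) : cl M S ⊆ cl M T := by
  rw [← Finset.coe_subset, coe_cl, coe_cl]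
  exact M.closure_subset_closure (Finset.coe_subset.2 h)

theorem Flat.cl_subset {F S : Finset (Fin (n + 1))} (hF : Flat M F) (h : S ⊆ F) : cl M S ⊆ F :=
  hF.cl_eq ▸ cl_mono h

theorem frk_mono {S T : Finset (Fin (n + 1))} (h : S ⊆ T) : frk M S ≤ frk M T := by
  have := M.eRk_mono (Finset.coe_subset.2 h)
  rw [← coe_frk, ← coe_frk] at this
  exact_mod_cast this

theorem frk_cl (M : Matroid (Fin (n + 1))) (S : Finset (Fin (n + 1))) :
    frk M (cl M S) = frk M S := by
  have := M.eRk_closure_eq (S : Set (Fin (n + 1)))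
  rw [← coe_cl, ← coe_frk, ← coe_frk] at this
  exact_mod_cast this

theorem frk_empty (M : Matroid (Fin (n + 1))) : frk M ∅ = 0 := by
  have := coe_frk M ∅
  simpa using this

theorem cl_eq_cl {S T : Finset (Fin (n + 1))} (h : S ⊆ T) (hr : frk M T ≤ frk M S) :
    cl M S = cl M T := by
  rw [← Finset.coe_inj, coe_cl, coe_cl]
  refine (M.isRkFinite_of_finite S.finite_toSet).closure_eq_closure_of_subset_of_eRk_ge_eRk
    (Finset.coe_subset.2 h) ?_
  rw [← coe_frk, ← coe_frk]; exact_mod_cast hr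

theorem frk_insert_le (M : Matroid (Fin (n + 1))) (e : Fin (n + 1)) (S : Finset (Fin (n + 1))) :
    frk M (insert e S) ≤ frk M S + 1 := by
  have := M.eRk_insert_le_add_one e (S : Set (Fin (n + 1)))
  rw [← Finset.coe_insert, ← coe_frk, ← coe_frk] at this
  exact_mod_cast this

/-- The rank increases strictly along a strict inclusion of a flat in a set. -/
theorem Flat.frk_lt {F S : Finset (Fin (n + 1))} (hE : M.E = Set.univ) (hF : Flat M F)
    (h : F ⊂ S) : frk M F < frk M S := by
  by_contra hlt
  have := cl_eq_cl h.subset (not_lt.1 hlt)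
  rw [hF.cl_eq] at this
  exact h.not_subset (this ▸ subset_cl hE S)

theorem frk_insert {e : Fin (n + 1)} {S : Finset (Fin (n + 1))} (hE : M.E = Set.univ)
    (he : e ∉ cl M S) : frk M (insert e S) = frk M S + 1 := by
  refine le_antisymm (frk_insert_le M e S) ?_
  by_contra hlt
  have := cl_eq_cl (Finset.subset_insert e S) (by omega : frk M (insert e S) ≤ frk M S)
  exact he (this ▸ subset_cl hE _ (Finset.mem_insert_self e S))

/-- A flat that covers the flat `A` is the closure of `A` and any of its further elements. -/
theorem Flat.eq_cl_insert {A G : Finset (Fin (n + 1))} (hE : M.E = Set.univ) (hA : Flat M A)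
    (hG : Flat M G) (h : A ⊆ G) (hr : frk M G = frk M A + 1) {e : Fin (n + 1)} (heG : e ∈ G)
    (heA : e ∉ A) : G = cl M (insert e A) := by
  have h1 : insert e A ⊆ G := Finset.insert_subset heG h
  rw [cl_eq_cl h1, hG.cl_eq]
  rw [frk_insert hE (by rwa [hA.cl_eq])]
  exact hr.le

theorem flat_univ (hE : M.E = Set.univ) : Flat M Finset.univ := by
  unfold Flat; rw [Finset.coe_univ, ← hE]; exact M.ground_isFlat

theorem frk_univ {r : ℕ} (hE : M.E = Set.univ) (hr : M.eRank = ((r + 1 : ℕ) : ℕ∞)) :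
    frk M Finset.univ = r + 1 := by
  have := coe_frk M Finset.univ
  rw [Finset.coe_univ, ← hE, M.eRk_ground, hr] at this
  exact_mod_cast this

theorem flat_empty (hloop : M.Loopless) : Flat M ∅ := by
  unfold Flat
  rw [Finset.coe_empty, ← hloop.loops_eq_empty]
  exact M.isFlat_closure _

theorem frk_le_add_card {S T : Finset (Fin (n + 1))} (h : S ⊆ T) :
    frk M T ≤ frk M S + (T.card - S.card) := by
  have h2 : T \ S ∪ S = T := Finset.sdiff_union_of_subset h
  have h1 := M.eRk_union_le_encard_add_eRk ((T \ S : Finset _) : Set (Fin (n + 1))) S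
  rw [← Finset.coe_union, h2, ← coe_frk, ← coe_frk, Set.encard_coe_eq_coe_finsetCard,
    Finset.card_sdiff_of_subset h] at h1
  have h3 : frk M T ≤ T.card - S.card + frk M S := by exact_mod_cast h1
  omega

end Rank

end

section

variable {n : ℕ}

open MvPolynomial

/-! ### Directional derivatives -/

/-- The derivative in the direction `w`, that is, `∑_G w(G) ∂/∂x_G`. -/
def dirD {σ : Type} (w : σ → ℝ) : Derivation ℝ (MvPolynomial σ ℝ) (MvPolynomial σ ℝ) :=
  mkDerivation ℝ fun G => C (w G)

section DirD

variable {σ : Type}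

theorem dirD_X (w : σ → ℝ) (G : σ) : dirD w (X G) = C (w G) := mkDerivation_X _ _ _

theorem dirD_C (w : σ → ℝ) (a : ℝ) : dirD w (C a) = 0 := derivation_C _ _

theorem dirD_mul (w : σ → ℝ) (p q : MvPolynomial σ ℝ) :
    dirD w (p * q) = dirD w p * q + p * dirD w q := by
  rw [Derivation.leibniz]; simp only [smul_eq_mul]; ring

theorem dirD_apply [Fintype σ] (w : σ → ℝ) (p : MvPolynomial σ ℝ) :
    dirD w p = ∑ G, C (w G) * pderiv G p := by
  classical
  have hsum : ∀ (f : σ → Derivation ℝ (MvPolynomial σ ℝ) (MvPolynomial σ ℝ))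
      (q : MvPolynomial σ ℝ), (∑ G, f G) q = ∑ G, f G q := fun f q => by
    have := congrFun (map_sum (Derivation.coeFnAddMonoidHom (R := ℝ) (A := MvPolynomial σ ℝ)
      (M := MvPolynomial σ ℝ)) f Finset.univ) q
    rw [Finset.sum_apply] at this; exact this
  have h : dirD w = ∑ G, (C (w G) : MvPolynomial σ ℝ) •
      (pderiv G : Derivation ℝ (MvPolynomial σ ℝ) (MvPolynomial σ ℝ)) := by
    refine derivation_ext fun i => ?_
    rw [dirD_X, hsum, Finset.sum_eq_single i]
    · simp
    · intro j _ hj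
      simp [pderiv_X_of_ne hj.symm]
    · simp
  rw [h, hsum]
  simp

theorem dirD_add [Fintype σ] (v w : σ → ℝ) (p : MvPolynomial σ ℝ) :
    dirD (v + w) p = dirD v p + dirD w p := by
  simp only [dirD_apply, Pi.add_apply, C_add, add_mul, Finset.sum_add_distrib]

theorem dirD_smul [Fintype σ] (a : ℝ) (w : σ → ℝ) (p : MvPolynomial σ ℝ) :
    dirD (a • w) p = C a * dirD w p := by
  simp only [dirD_apply, Pi.smul_apply, smul_eq_mul, C_mul, Finset.mul_sum, mul_assoc]

theorem dirD_sum [Fintype σ] {ι : Type} (s : Finset ι) (w : ι → σ → ℝ) (p : MvPolynomial σ ℝ) :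
    dirD (∑ i ∈ s, w i) p = ∑ i ∈ s, dirD (w i) p := by
  simp only [dirD_apply, Finset.sum_apply, map_sum, Finset.sum_mul]
  rw [Finset.sum_comm]

end DirD

/-! ### The volume polynomial of an interval of flats -/

open Classical in
/-- The flats strictly between `A` and `B`. -/
def between (M : Matroid (Fin (n + 1))) (A B : Finset (Fin (n + 1))) :
    Finset (Finset (Fin (n + 1))) :=
  Finset.univ.filter fun F => Flat M F ∧ A ⊂ F ∧ F ⊂ B

theorem mem_between {M : Matroid (Fin (n + 1))} {A B F : Finset (Fin (n + 1))} :
    F ∈ between M A B ↔ Flat M F ∧ A ⊂ F ∧ F ⊂ B := by simp [between]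

/-- The proportion of the elements of `B \ A` that lie in `F`, for `A ⊆ F ⊆ B`. -/
def frac (A B F : Finset (Fin (n + 1))) : ℝ := ((F.card : ℝ) - A.card) / ((B.card : ℝ) - A.card)

/-- The coordinate `x_F`, corrected by a combination of constants and cardinalities so that it
vanishes for `F = A` and `F = B`. -/
def nform (A B F : Finset (Fin (n + 1))) : MvPolynomial (Finset (Fin (n + 1))) ℝ :=
  X F - X A - C (frac A B F) * (X B - X A)

/-- The volume polynomial `V_{AB}` of the interval `[A, B]` of flats, that is, of the minor
`M|B/A`.  Its variables `x_G`, for `A ≤ G ≤ B`, are the values of a function on the flats in the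
interval, the end points included.  The recursion is Euler's identity for the normalised function
`nform`, combined with `∂V_{AB}/∂x_F = V_{AF} V_{FB}`. -/
def volPoly (M : Matroid (Fin (n + 1))) (A B : Finset (Fin (n + 1))) :
    MvPolynomial (Finset (Fin (n + 1))) ℝ :=
  if frk M B ≤ frk M A + 1 then 1 else
    C (((frk M B - frk M A - 1 : ℕ) : ℝ)⁻¹) * ∑ F ∈ (between M A B).attach,
      nform A B F.1 * (volPoly M A F.1 * volPoly M F.1 B)
termination_by B.card - A.card
decreasing_by
  all_goals
    have h := mem_between.1 F.2
    have h1 := Finset.card_lt_card h.2.1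
    have h2 := Finset.card_lt_card h.2.2
    omega

theorem volPoly_of_le {M : Matroid (Fin (n + 1))} {A B : Finset (Fin (n + 1))}
    (h : frk M B ≤ frk M A + 1) : volPoly M A B = 1 := by
  rw [volPoly, if_pos h]

theorem smul_volPoly {M : Matroid (Fin (n + 1))} {A B : Finset (Fin (n + 1))}
    (h : frk M A + 1 < frk M B) :
    C ((frk M B - frk M A - 1 : ℕ) : ℝ) * volPoly M A B =
      ∑ F ∈ between M A B, nform A B F * (volPoly M A F * volPoly M F B) := by
  rw [volPoly, if_neg (not_le.2 h), ← mul_assoc, ← C_mul, mul_inv_cancel₀, C_1, one_mul]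
  · exact Finset.sum_attach (between M A B) fun F =>
      nform A B F * (volPoly M A F * volPoly M F B)
  · have : frk M B - frk M A - 1 ≠ 0 := by omega
    exact_mod_cast this

open Classical in
/-- The function on sets of elements which is `1` on the sets containing `i`, and `0` otherwise. -/
def star (i : Fin (n + 1)) (G : Finset (Fin (n + 1))) : ℝ := if i ∈ G then 1 else 0

/-- The characteristic properties of the volume polynomial of an interval: it is homogeneous,
depends only on the flats of the interval, is invariant under linear functions, and its
derivatives are the volume polynomials of the links. -/
structure VolSpec (M : Matroid (Fin (n + 1))) (A B : Finset (Fin (n + 1))) : Prop where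
  hom : (volPoly M A B).IsHomogeneous (frk M B - frk M A - 1)
  supp : ∀ G, ¬ (Flat M G ∧ A ⊆ G ∧ G ⊆ B) → pderiv G (volPoly M A B) = 0
  deriv : ∀ G ∈ between M A B, pderiv G (volPoly M A B) = volPoly M A G * volPoly M G B
  const : dirD (fun _ => 1) (volPoly M A B) = 0
  star : ∀ i, dirD (star i) (volPoly M A B) = 0

theorem sum_star (G : Finset (Fin (n + 1))) : ∑ i, star i G = G.card := by
  simp [star]

theorem sum_star_of_subset {A B F : Finset (Fin (n + 1))} (hA : A ⊆ F) (hB : F ⊆ B) :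
    ∑ i ∈ B \ A, star i F = (F.card : ℝ) - A.card := by
  simp only [star, Finset.sum_ite_mem, Finset.sum_const, nsmul_eq_mul, mul_one]
  have : (B \ A) ∩ F = F \ A := by
    ext i; simp only [Finset.mem_inter, Finset.mem_sdiff]
    exact ⟨fun h => ⟨h.2, h.1.2⟩, fun h => ⟨⟨hB h.1, h.2⟩, h.1⟩⟩
  rw [this, Finset.card_sdiff_of_subset hA, Nat.cast_sub (Finset.card_le_card hA)]

section Spec

variable {M : Matroid (Fin (n + 1))} {A B : Finset (Fin (n + 1))}

theorem VolSpec.card (h : VolSpec M A B) :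
    dirD (fun G => (G.card : ℝ)) (volPoly M A B) = 0 := by
  have : (fun G : Finset (Fin (n + 1)) => (G.card : ℝ)) = ∑ i, MatroidChow.star i := by
    funext G; rw [Finset.sum_apply, sum_star]
  rw [this, dirD_sum]
  exact Finset.sum_eq_zero fun i _ => h.star i

/-- Euler's identity, in terms of the functions normalised on a possibly different interval. -/
theorem VolSpec.euler (h : VolSpec M A B) (A' B' : Finset (Fin (n + 1))) :
    ∑ H, nform A' B' H * pderiv H (volPoly M A B) =
      C ((frk M B - frk M A - 1 : ℕ) : ℝ) * volPoly M A B := by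
  have h1 := h.hom.sum_X_mul_pderiv
  have h2 := h.const
  have h3 : dirD (frac A' B') (volPoly M A B) = 0 := by
    have e : frac A' B' = ((B'.card : ℝ) - A'.card)⁻¹ • ((fun G => (G.card : ℝ)) +
        (-(A'.card : ℝ)) • fun _ => 1) := by
      funext G; simp [frac]; ring
    rw [e, dirD_smul, dirD_add, dirD_smul, h.card, h.const]; simp
  rw [dirD_apply] at h2 h3
  simp only [C_1, one_mul] at h2
  have e : ∀ H, nform A' B' H * pderiv H (volPoly M A B) = X H * pderiv H (volPoly M A B) -
      X A' * pderiv H (volPoly M A B) -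
      (X B' - X A') * (C (frac A' B' H) * pderiv H (volPoly M A B)) := by
    intro H; rw [nform]; ring
  simp only [e, Finset.sum_sub_distrib, ← Finset.mul_sum, h1, h2, h3, mul_zero, sub_zero]
  simp [nsmul_eq_mul]

/-- The derivative of a weighted sum of products `V_{AF} V_{FB}`. -/
theorem sum_mul_pderiv_prod (c : Finset (Fin (n + 1)) → MvPolynomial (Finset (Fin (n + 1))) ℝ)
    (hcA : c A = 0) (hcB : c B = 0)
    (ih1 : ∀ F ∈ between M A B, VolSpec M A F) (ih2 : ∀ F ∈ between M A B, VolSpec M F B)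
    {G : Finset (Fin (n + 1))} (hG : G ∈ between M A B) :
    ∑ F ∈ between M A B, c F * pderiv G (volPoly M A F * volPoly M F B) =
      volPoly M G B * ∑ H, c H * pderiv H (volPoly M A G) +
        volPoly M A G * ∑ H, c H * pderiv H (volPoly M G B) := by
  classical
  obtain ⟨hGf, hAG, hGB⟩ := mem_between.1 hG
  rw [Finset.mul_sum, Finset.mul_sum, ← Finset.sum_add_distrib, ← Finset.sum_subset
    (Finset.subset_univ (between M A B))]
  · refine Finset.sum_congr rfl fun F hF => ?_
    obtain ⟨hFf, hAF, hFB⟩ := mem_between.1 hF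
    rw [pderiv_mul]
    rcases eq_or_ne F G with rfl | hne
    · ring
    by_cases h1 : F ⊆ G
    · have h1' : F ⊂ G := lt_of_le_of_ne h1 hne
      rw [(ih1 F hF).supp G (fun h => h1'.not_subset h.2.2),
        (ih2 F hF).deriv G (mem_between.2 ⟨hGf, h1', hGB⟩),
        (ih1 G hG).deriv F (mem_between.2 ⟨hFf, hAF, h1'⟩),
        (ih2 G hG).supp F (fun h => h1'.not_subset h.2.1)]
      ring
    by_cases h2 : G ⊆ F
    · have h2' : G ⊂ F := lt_of_le_of_ne h2 hne.symm
      rw [(ih2 F hF).supp G (fun h => h2'.not_subset h.2.1),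
        (ih1 F hF).deriv G (mem_between.2 ⟨hGf, hAG, h2'⟩),
        (ih2 G hG).deriv F (mem_between.2 ⟨hFf, h2', hFB⟩),
        (ih1 G hG).supp F (fun h => h2'.not_subset h.2.2)]
      ring
    · rw [(ih1 F hF).supp G (fun h => h2 h.2.2), (ih2 F hF).supp G (fun h => h1 h.2.1),
        (ih1 G hG).supp F (fun h => h1 h.2.2), (ih2 G hG).supp F (fun h => h2 h.2.1)]
      ring
  · intro H _ hH
    rcases eq_or_ne H A with rfl | hA
    · simp [hcA]
    rcases eq_or_ne H B with rfl | hB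
    · simp [hcB]
    rw [(ih1 G hG).supp H fun h => hH (mem_between.2
        ⟨h.1, lt_of_le_of_ne h.2.1 hA.symm, lt_of_le_of_lt h.2.2 hGB⟩),
      (ih2 G hG).supp H fun h => hH (mem_between.2
        ⟨h.1, lt_of_lt_of_le hAG h.2.1, lt_of_le_of_ne h.2.2 hB⟩)]
    simp

theorem star_eq_zero {i : Fin (n + 1)} {G : Finset (Fin (n + 1))} (h : i ∉ G) : star i G = 0 := by
  simp [star, h]

theorem star_eq_one {i : Fin (n + 1)} {G : Finset (Fin (n + 1))} (h : i ∈ G) : star i G = 1 := by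
  simp [star, h]

theorem dirD_prod_eq_zero (w : Finset (Fin (n + 1)) → ℝ)
    {p q : MvPolynomial (Finset (Fin (n + 1))) ℝ} (hp : dirD w p = 0) (hq : dirD w q = 0) :
    dirD w (p * q) = 0 := by
  rw [dirD_mul, hp, hq]; simp

theorem isHomogeneous_volPoly_mul (hE : M.E = Set.univ) (hA : Flat M A)
    {F : Finset (Fin (n + 1))} (hF : F ∈ between M A B)
    (h1 : VolSpec M A F) (h2 : VolSpec M F B) :
    (volPoly M A F * volPoly M F B).IsHomogeneous (frk M B - frk M A - 2) := by
  obtain ⟨hFf, hAF, hFB⟩ := mem_between.1 hF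
  have := hA.frk_lt hE hAF
  have := hFf.frk_lt hE hFB
  have h := h1.hom.mul h2.hom
  convert! h using 1
  omega

/-- In an interval of rank two, exactly one flat strictly between the ends contains a given
element. -/
theorem sum_star_rank_two (hE : M.E = Set.univ) (hA : Flat M A) (hB : Flat M B) (hAB : A ⊂ B)
    (h2 : frk M A + 2 = frk M B) {k : Fin (n + 1)} (hkB : k ∈ B) (hkA : k ∉ A) :
    ∑ F ∈ between M A B, C (star k F) * (volPoly M A F * volPoly M F B) = 1 := by
  have hk : k ∉ cl M A := by rwa [hA.cl_eq]
  have hGr : frk M (cl M (insert k A)) = frk M A + 1 := by rw [frk_cl, frk_insert hE hk]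
  have hkG : k ∈ cl M (insert k A) := subset_cl hE _ (Finset.mem_insert_self _ _)
  have hAG : A ⊆ cl M (insert k A) := (Finset.subset_insert _ _).trans (subset_cl hE _)
  have hG : cl M (insert k A) ∈ between M A B := by
    refine mem_between.2 ⟨flat_cl _ _, ⟨hAG, fun h => hkA (h hkG)⟩, ?_⟩
    refine lt_of_le_of_ne (hB.cl_subset (Finset.insert_subset hkB hAB.subset)) fun h => ?_
    rw [h] at hGr; omega
  rw [Finset.sum_eq_single_of_mem _ hG]
  · rw [star_eq_one hkG, volPoly_of_le (by omega), volPoly_of_le (by omega)]; simp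
  · intro F hF hne
    obtain ⟨hFf, hAF, hFB⟩ := mem_between.1 hF
    have h3 := hA.frk_lt hE hAF
    have h4 := hFf.frk_lt hE hFB
    rw [star_eq_zero, C_0, zero_mul]
    exact fun hkF => hne (hA.eq_cl_insert hE hFf hAF.subset (by omega) hkF hkA)

/-- A homogeneous polynomial of positive degree, invariant under constants and under a function
`star i`, `i ∈ B \ A`, vanishes if its derivatives do, those for `A` and `B` excepted. -/
theorem eq_zero_of_pderiv {Y : MvPolynomial (Finset (Fin (n + 1))) ℝ} {d : ℕ}
    (hY : Y.IsHomogeneous d) (hd0 : d ≠ 0) {i : Fin (n + 1)} (hiB : i ∈ B) (hiA : i ∉ A)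
    (hc : dirD (fun _ => 1) Y = 0) (hs : dirD (star i) Y = 0)
    (hd : ∀ G, G ≠ A → G ≠ B → pderiv G Y = 0) : Y = 0 := by
  have hdB : pderiv B Y = 0 := by
    rw [dirD_apply, Finset.sum_eq_single B] at hs
    · simpa [star_eq_one hiB] using hs
    · intro G _ hGB
      rcases eq_or_ne G A with rfl | hGA
      · simp [star_eq_zero hiA]
      · simp [hd G hGA hGB]
    · simp
  have hdA : pderiv A Y = 0 := by
    rw [dirD_apply, Finset.sum_eq_single A] at hc
    · simpa using hc
    · intro G _ hGA
      rcases eq_or_ne G B with rfl | hGB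
      · simp [hdB]
      · simp [hd G hGA hGB]
    · simp
  have hall : ∀ G, pderiv G Y = 0 := by
    intro G
    rcases eq_or_ne G A with rfl | hGA
    · exact hdA
    rcases eq_or_ne G B with rfl | hGB
    · exact hdB
    · exact hd G hGA hGB
  have he := hY.sum_X_mul_pderiv
  simp only [hall, mul_zero, Finset.sum_const_zero] at he
  exact (smul_eq_zero.1 he.symm).resolve_left hd0

/-- The balancing condition: the sum of the products `V_{AF} V_{FB}` over the flats `F` containing
an element `i` of `B \ A` does not depend on `i`.  The difference of two such sums has zero
derivatives, so the claim comes down to intervals of rank two, where it says that the flats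
strictly between `A` and `B` partition `B \ A`. -/
theorem balancing (hE : M.E = Set.univ) (hA : Flat M A) (hB : Flat M B) (hAB : A ⊂ B)
    (hr : frk M A + 1 < frk M B)
    (ih1 : ∀ F ∈ between M A B, VolSpec M A F) (ih2 : ∀ F ∈ between M A B, VolSpec M F B)
    {i j : Fin (n + 1)} (hi : i ∈ B \ A) (hj : j ∈ B \ A) :
    ∑ F ∈ between M A B, C (star i F) * (volPoly M A F * volPoly M F B) =
      ∑ F ∈ between M A B, C (star j F) * (volPoly M A F * volPoly M F B) := by
  classical
  rw [Finset.mem_sdiff] at hi hj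
  rcases (Nat.succ_le_iff.2 hr).eq_or_lt with h2 | h2
  · rw [sum_star_rank_two hE hA hB hAB h2 hi.1 hi.2, sum_star_rank_two hE hA hB hAB h2 hj.1 hj.2]
  have hYeq : ∑ F ∈ between M A B, C (star i F) * (volPoly M A F * volPoly M F B) -
      ∑ F ∈ between M A B, C (star j F) * (volPoly M A F * volPoly M F B) =
      ∑ F ∈ between M A B, C (star i F - star j F) * (volPoly M A F * volPoly M F B) := by
    rw [← Finset.sum_sub_distrib]
    exact Finset.sum_congr rfl fun F _ => by rw [C_sub, sub_mul]
  rw [← sub_eq_zero, hYeq]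
  have hYw : ∀ w, (∀ F ∈ between M A B, dirD w (volPoly M A F) = 0) →
      (∀ F ∈ between M A B, dirD w (volPoly M F B) = 0) →
      dirD w (∑ F ∈ between M A B,
        C (star i F - star j F) * (volPoly M A F * volPoly M F B)) = 0 := by
    intro w hw1 hw2
    rw [map_sum]
    refine Finset.sum_eq_zero fun F hF => ?_
    rw [dirD_mul, dirD_C, dirD_prod_eq_zero w (hw1 F hF) (hw2 F hF)]; simp
  refine eq_zero_of_pderiv (d := frk M B - frk M A - 2) ?_ (by omega) hi.1 hi.2
    (hYw _ (fun F hF => (ih1 F hF).const) (fun F hF => (ih2 F hF).const))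
    (hYw _ (fun F hF => (ih1 F hF).star i) (fun F hF => (ih2 F hF).star i)) ?_
  · refine IsHomogeneous.sum _ _ _ fun F hF => ?_
    have := (isHomogeneous_C (Finset (Fin (n + 1))) (star i F - star j F)).mul
      (isHomogeneous_volPoly_mul hE hA hF (ih1 F hF) (ih2 F hF))
    rwa [zero_add] at this
  · intro G hGA hGB
    rw [map_sum]
    simp only [pderiv_C_mul]
    by_cases hG : G ∈ between M A B
    · rw [sum_mul_pderiv_prod (fun F => C (star i F - star j F)) _ _ ih1 ih2 hG]
      · have h5 := (ih1 G hG).star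
        have h6 := (ih2 G hG).star
        simp only [dirD_apply] at h5 h6
        simp only [C_sub, sub_mul, Finset.sum_sub_distrib, h5, h6, sub_zero, mul_zero, add_zero]
      · simp [star_eq_zero hi.2, star_eq_zero hj.2]
      · simp [star_eq_one hi.1, star_eq_one hj.1]
    · refine Finset.sum_eq_zero fun F hF => ?_
      obtain ⟨hFf, hAF, hFB⟩ := mem_between.1 hF
      rw [pderiv_mul, (ih1 F hF).supp G fun h => hG (mem_between.2 ⟨h.1,
          lt_of_le_of_ne h.2.1 hGA.symm, lt_of_le_of_lt h.2.2 hFB⟩),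
        (ih2 F hF).supp G fun h => hG (mem_between.2 ⟨h.1,
          lt_of_lt_of_le hAF h.2.1, lt_of_le_of_ne h.2.2 hGB⟩)]
      simp

theorem dirD_nform (w : Finset (Fin (n + 1)) → ℝ) (F : Finset (Fin (n + 1))) :
    dirD w (nform A B F) = C (w F - w A - frac A B F * (w B - w A)) := by
  simp only [nform, map_sub, dirD_mul, dirD_X, dirD_C, C_mul]; ring

theorem frac_self_left : frac A B A = 0 := by simp [frac]

theorem frac_self_right (hAB : A ⊂ B) : frac A B B = 1 := by
  have : (A.card : ℝ) < B.card := by exact_mod_cast Finset.card_lt_card hAB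
  exact div_self (by linarith)

theorem nform_left : nform A B A = 0 := by simp [nform, frac_self_left]

theorem nform_right (hAB : A ⊂ B) : nform A B B = 0 := by simp [nform, frac_self_right hAB]

theorem volSpec_of_le (hE : M.E = Set.univ) (hA : Flat M A)
    (hr : frk M B ≤ frk M A + 1) : VolSpec M A B := by
  have h1 := volPoly_of_le hr
  refine ⟨?_, ?_, ?_, ?_, ?_⟩
  · rw [h1, show frk M B - frk M A - 1 = 0 by omega]; exact isHomogeneous_one _ _
  · intro G _; rw [h1]; simp
  · intro G hG
    obtain ⟨hGf, hAG, hGB⟩ := mem_between.1 hG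
    have h3 := hA.frk_lt hE hAG
    have h4 := hGf.frk_lt hE hGB
    omega
  · rw [h1]; simp
  · intro i; rw [h1]; simp

/-- The inductive step: the defining recursion of the volume polynomial is differentiated, and the
volume polynomials of the shorter intervals have the characteristic properties. -/
theorem volSpec_step (hE : M.E = Set.univ) (hA : Flat M A) (hB : Flat M B) (hAB : A ⊂ B)
    (hr : frk M A + 1 < frk M B)
    (ih1 : ∀ F ∈ between M A B, VolSpec M A F) (ih2 : ∀ F ∈ between M A B, VolSpec M F B) :
    VolSpec M A B := by
  classical
  have hdef := smul_volPoly hr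
  set d := frk M B - frk M A - 1 with hd
  have hd0 : (d : ℝ) ≠ 0 := by
    have : d ≠ 0 := by omega
    exact_mod_cast this
  have hcancel : ∀ p q : MvPolynomial (Finset (Fin (n + 1))) ℝ, C (d : ℝ) * p = C (d : ℝ) * q →
      p = q := fun p q h => mul_left_cancel₀ (by rwa [Ne, C_eq_zero]) h
  have hdir : ∀ w, (∀ F ∈ between M A B, dirD w (volPoly M A F) = 0) →
      (∀ F ∈ between M A B, dirD w (volPoly M F B) = 0) →
      C (d : ℝ) * dirD w (volPoly M A B) = ∑ F ∈ between M A B,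
        C (w F - w A - frac A B F * (w B - w A)) * (volPoly M A F * volPoly M F B) := by
    intro w hw1 hw2
    have := congrArg (dirD w) hdef
    rw [dirD_mul, dirD_C, zero_mul, zero_add, map_sum] at this
    rw [this]
    refine Finset.sum_congr rfl fun F hF => ?_
    rw [dirD_mul, dirD_nform, dirD_prod_eq_zero w (hw1 F hF) (hw2 F hF)]; simp
  refine ⟨?_, ?_, ?_, ?_, ?_⟩
  · -- homogeneity
    have h1 : (C (d : ℝ) * volPoly M A B).IsHomogeneous d := by
      rw [hdef]
      refine IsHomogeneous.sum _ _ _ fun F hF => ?_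
      have h2 : (nform A B F).IsHomogeneous 1 := by
        refine ((isHomogeneous_X _ _).sub (isHomogeneous_X _ _)).sub ?_
        simpa using (isHomogeneous_C _ _).mul ((isHomogeneous_X _ _).sub (isHomogeneous_X _ _))
      have h3 := h2.mul (isHomogeneous_volPoly_mul hE hA hF (ih1 F hF) (ih2 F hF))
      convert! h3 using 1
      omega
    have h2 := (isHomogeneous_C (Finset (Fin (n + 1))) ((d : ℝ)⁻¹)).mul h1
    rw [← mul_assoc, ← C_mul, inv_mul_cancel₀ hd0, C_1, one_mul, zero_add] at h2
    exact h2
  · -- derivatives outside the interval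
    intro G hG
    apply hcancel
    rw [← pderiv_C_mul, hdef, map_sum, mul_zero]
    refine Finset.sum_eq_zero fun F hF => ?_
    obtain ⟨hFf, hAF, hFB⟩ := mem_between.1 hF
    have hGA : A ≠ G := fun h => hG (h ▸ ⟨hA, subset_rfl, hAB.subset⟩)
    have hGB : B ≠ G := fun h => hG (h ▸ ⟨hB, hAB.subset, subset_rfl⟩)
    have hGF : F ≠ G := fun h => hG (h ▸ ⟨hFf, hAF.subset, hFB.subset⟩)
    rw [pderiv_mul, pderiv_mul, (ih1 F hF).supp G fun h => hG ⟨h.1, h.2.1, h.2.2.trans hFB.subset⟩,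
      (ih2 F hF).supp G fun h => hG ⟨h.1, hAF.subset.trans h.2.1, h.2.2⟩]
    simp [nform, pderiv_X_of_ne hGA, pderiv_X_of_ne hGB, pderiv_X_of_ne hGF]
  · -- derivatives inside the interval, by Euler's identity for the two links
    intro G hG
    obtain ⟨hGf, hAG, hGB⟩ := mem_between.1 hG
    apply hcancel
    rw [← pderiv_C_mul, hdef, map_sum]
    have h1 : ∀ F ∈ between M A B,
        pderiv G (nform A B F * (volPoly M A F * volPoly M F B)) =
          (if F = G then volPoly M A G * volPoly M G B else 0) +
            nform A B F * pderiv G (volPoly M A F * volPoly M F B) := by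
      intro F _
      rw [pderiv_mul]
      congr 1
      rcases eq_or_ne F G with rfl | hFG
      · simp [nform, pderiv_X_of_ne hAG.ne, pderiv_X_of_ne hGB.ne']
      · simp [nform, pderiv_X_of_ne hAG.ne, pderiv_X_of_ne hGB.ne', pderiv_X_of_ne hFG, hFG]
    rw [Finset.sum_congr rfl h1, Finset.sum_add_distrib, Finset.sum_ite_eq', if_pos hG,
      sum_mul_pderiv_prod (nform A B) nform_left (nform_right hAB) ih1 ih2 hG,
      (ih1 G hG).euler, (ih2 G hG).euler]
    have h3 := hA.frk_lt hE hAG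
    have h4 := hGf.frk_lt hE hGB
    have h5 : (d : ℝ) = 1 + ((frk M G - frk M A - 1 : ℕ) : ℝ) +
        ((frk M B - frk M G - 1 : ℕ) : ℝ) := by
      have : d = 1 + (frk M G - frk M A - 1) + (frk M B - frk M G - 1) := by omega
      rw [this]; push_cast; ring
    rw [h5, C_add, C_add, C_1]
    ring
  · -- invariance under constants
    apply hcancel
    rw [hdir _ (fun F hF => (ih1 F hF).const) (fun F hF => (ih2 F hF).const), mul_zero]
    exact Finset.sum_eq_zero fun F _ => by simp
  · -- invariance under `star i`, by the balancing condition
    intro i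
    apply hcancel
    rw [hdir _ (fun F hF => (ih1 F hF).star i) (fun F hF => (ih2 F hF).star i), mul_zero]
    by_cases hiA : i ∈ A
    · refine Finset.sum_eq_zero fun F hF => ?_
      obtain ⟨hFf, hAF, hFB⟩ := mem_between.1 hF
      simp [star_eq_one hiA, star_eq_one (hAB.subset hiA), star_eq_one (hAF.subset hiA)]
    by_cases hiB : i ∈ B
    · have hi : i ∈ B \ A := Finset.mem_sdiff.2 ⟨hiB, hiA⟩
      have hN : ((B \ A).card : ℝ) = (B.card : ℝ) - A.card := by
        rw [Finset.card_sdiff_of_subset hAB.subset,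
          Nat.cast_sub (Finset.card_le_card hAB.subset)]
      have hN0 : (B.card : ℝ) - A.card ≠ 0 := by
        have : (A.card : ℝ) < B.card := by exact_mod_cast Finset.card_lt_card hAB
        linarith
      -- the proportion `frac A B F` is the average of `star k F` over `k ∈ B \ A`
      have havg : C ((B.card : ℝ) - A.card) * ∑ F ∈ between M A B,
          C (frac A B F) * (volPoly M A F * volPoly M F B) =
          ∑ k ∈ B \ A, ∑ F ∈ between M A B, C (star k F) * (volPoly M A F * volPoly M F B) := by
        rw [Finset.sum_comm, Finset.mul_sum]
        refine Finset.sum_congr rfl fun F hF => ?_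
        obtain ⟨hFf, hAF, hFB⟩ := mem_between.1 hF
        rw [← Finset.sum_mul, ← map_sum, sum_star_of_subset hAF.subset hFB.subset, ← mul_assoc,
          ← C_mul, frac, mul_div_cancel₀ _ hN0]
      rw [Finset.sum_congr rfl fun k hk => balancing hE hA hB hAB hr ih1 ih2 hk hi,
        Finset.sum_const, nsmul_eq_mul, ← C_eq_coe_nat, hN] at havg
      have h6 := mul_left_cancel₀ (by rwa [Ne, C_eq_zero]) havg
      simp only [star_eq_zero hiA, star_eq_one hiB, sub_zero, mul_one, C_sub, sub_mul,
        Finset.sum_sub_distrib, h6, sub_self]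
    · refine Finset.sum_eq_zero fun F hF => ?_
      obtain ⟨hFf, hAF, hFB⟩ := mem_between.1 hF
      simp [star_eq_zero hiA, star_eq_zero hiB, star_eq_zero fun h => hiB (hFB.subset h)]

/-- The volume polynomials of all intervals of flats have the characteristic properties. -/
theorem volSpec (hE : M.E = Set.univ) (hA : Flat M A) (hB : Flat M B) (hAB : A ⊂ B) :
    VolSpec M A B := by
  induction hN : B.card - A.card using Nat.strong_induction_on generalizing A B with
  | _ N ih =>
    rcases le_or_gt (frk M B) (frk M A + 1) with hr | hr
    · exact volSpec_of_le hE hA hr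
    · refine volSpec_step hE hA hB hAB hr (fun F hF => ?_) (fun F hF => ?_)
      all_goals
        obtain ⟨hFf, hAF, hFB⟩ := mem_between.1 hF
        have h1 := Finset.card_lt_card hAF
        have h2 := Finset.card_lt_card hFB
      · exact ih (F.card - A.card) (by omega) hA hFf hAF rfl
      · exact ih (B.card - F.card) (by omega) hFf hB hFB rfl

end Spec

end

section

variable {n : ℕ}

open MvPolynomial

/-! ### Apolarity -/

section Pair

variable {σ : Type}

/-- The value at the origin of the polynomial obtained from `V` by applying `p`, regarded as a
differential operator with constant coefficients. -/
def pair (V : MvPolynomial σ ℝ) : MvPolynomial σ ℝ →ₗ[ℝ] ℝ :=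
  (basisMonomials σ ℝ).constr ℝ fun c => (c.prod fun _ k => (k.factorial : ℝ)) * coeff c V

theorem pair_monomial (V : MvPolynomial σ ℝ) (c : σ →₀ ℕ) :
    pair V (monomial c 1) = (c.prod fun _ k => (k.factorial : ℝ)) * coeff c V := by
  have := (basisMonomials σ ℝ).constr_basis ℝ
    (fun c => (c.prod fun _ k => (k.factorial : ℝ)) * coeff c V) c
  rwa [coe_basisMonomials] at this

theorem pair_one (V : MvPolynomial σ ℝ) : pair V 1 = coeff 0 V := by
  have := pair_monomial V 0
  simpa using this

theorem pair_zero (p : MvPolynomial σ ℝ) : pair 0 p = 0 := by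
  have : pair (0 : MvPolynomial σ ℝ) = 0 := by
    refine (basisMonomials σ ℝ).ext fun c => ?_
    rw [coe_basisMonomials, pair_monomial]; simp
  rw [this]; rfl

theorem pair_add (V W : MvPolynomial σ ℝ) (p : MvPolynomial σ ℝ) :
    pair (V + W) p = pair V p + pair W p := by
  have : pair (V + W) = pair V + pair W := by
    refine (basisMonomials σ ℝ).ext fun c => ?_
    rw [coe_basisMonomials, LinearMap.add_apply, pair_monomial, pair_monomial, pair_monomial,
      coeff_add, mul_add]
  rw [this]; rfl

theorem pair_C_mul (a : ℝ) (V : MvPolynomial σ ℝ) (p : MvPolynomial σ ℝ) :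
    pair (C a * V) p = a * pair V p := by
  have : pair (C a * V) = a • pair V := by
    refine (basisMonomials σ ℝ).ext fun c => ?_
    rw [coe_basisMonomials, LinearMap.smul_apply, pair_monomial, pair_monomial, coeff_C_mul,
      smul_eq_mul]
    ring
  rw [this]; rfl

theorem pair_sum {ι : Type} (s : Finset ι) (V : ι → MvPolynomial σ ℝ) (p : MvPolynomial σ ℝ) :
    pair (∑ i ∈ s, V i) p = ∑ i ∈ s, pair (V i) p := by
  classical
  induction s using Finset.induction_on with
  | empty => simp [pair_zero]
  | insert i s hi ih => rw [Finset.sum_insert hi, Finset.sum_insert hi, pair_add, ih]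

theorem pair_X_mul (V : MvPolynomial σ ℝ) (i : σ) (p : MvPolynomial σ ℝ) :
    pair V (X i * p) = pair (pderiv i V) p := by
  classical
  have : (pair V).comp (LinearMap.mulLeft ℝ (X i)) = pair (pderiv i V) := by
    refine (basisMonomials σ ℝ).ext fun c => ?_
    rw [coe_basisMonomials, LinearMap.comp_apply, LinearMap.mulLeft_apply, pair_monomial, X,
      monomial_mul, one_mul, pair_monomial, coeff_pderiv, add_comm (Finsupp.single i 1) c]
    have hfac : ((c + Finsupp.single i 1).prod fun _ k => (k.factorial : ℝ)) =
        (c.prod fun _ k => (k.factorial : ℝ)) * (c i + 1) := by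
      rw [← Finsupp.mul_prod_erase' (c + Finsupp.single i 1) i _ (by simp),
        ← Finsupp.mul_prod_erase' c i _ (by simp), Finsupp.erase_add, Finsupp.erase_single]
      simp only [Finsupp.add_apply, Finsupp.single_eq_same, Nat.factorial_succ, add_zero]
      push_cast; ring
    rw [hfac]; ring
  rw [← this]; rfl

/-- The linear form with coefficients `w`. -/
def lin [Fintype σ] (w : σ → ℝ) : MvPolynomial σ ℝ := ∑ G, C (w G) * X G

theorem pair_lin_mul [Fintype σ] (V : MvPolynomial σ ℝ) (w : σ → ℝ) (p : MvPolynomial σ ℝ) :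
    pair V (lin w * p) = pair (dirD w V) p := by
  rw [lin, Finset.sum_mul, map_sum, dirD_apply, pair_sum]
  refine Finset.sum_congr rfl fun G _ => ?_
  rw [pair_C_mul, ← pair_X_mul, mul_assoc, ← smul_eq_C_mul, map_smul, smul_eq_mul]

/-- The largest ideal on which a linear functional vanishes. -/
def nullIdeal (L : MvPolynomial σ ℝ →ₗ[ℝ] ℝ) : Ideal (MvPolynomial σ ℝ) where
  carrier := {p | ∀ q, L (p * q) = 0}
  zero_mem' q := by simp
  add_mem' {a b} ha hb q := by rw [add_mul, map_add, ha q, hb q, add_zero]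
  smul_mem' a b hb q := by
    rw [smul_eq_mul, mul_assoc, mul_left_comm]; exact hb _

/-- The functional induced on the quotient by the largest ideal on which it vanishes. -/
def quotFunctional (L : MvPolynomial σ ℝ →ₗ[ℝ] ℝ) :
    (MvPolynomial σ ℝ ⧸ nullIdeal L) →ₗ[ℝ] ℝ :=
  (Submodule.liftQ ((nullIdeal L).restrictScalars ℝ) L fun p hp => by
    have := hp 1
    rwa [mul_one] at this).comp
    (Submodule.Quotient.restrictScalarsEquiv ℝ (nullIdeal L)).symm.toLinearMap

theorem quotFunctional_mk (L : MvPolynomial σ ℝ →ₗ[ℝ] ℝ) (p : MvPolynomial σ ℝ) :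
    quotFunctional L (Ideal.Quotient.mk (nullIdeal L) p) = L p := rfl

/-- The ideal of the differential operators that annihilate `V`. -/
abbrev ann (V : MvPolynomial σ ℝ) : Ideal (MvPolynomial σ ℝ) := nullIdeal (pair V)

theorem lin_mem_ann [Fintype σ] {V : MvPolynomial σ ℝ} {w : σ → ℝ} (h : dirD w V = 0) :
    lin w ∈ ann V := fun q => by rw [pair_lin_mul, h, pair_zero]

/-- The Artinian Gorenstein algebra with dual socle generator `V`. -/
abbrev AnnRing (V : MvPolynomial σ ℝ) : Type := MvPolynomial σ ℝ ⧸ ann V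

/-- The functional on the quotient by the annihilator of `V` induced by the pairing with `V`. -/
abbrev pairQ (V : MvPolynomial σ ℝ) : AnnRing V →ₗ[ℝ] ℝ := quotFunctional (pair V)

theorem pairQ_mk (V : MvPolynomial σ ℝ) (p : MvPolynomial σ ℝ) :
    pairQ V (Ideal.Quotient.mk (ann V) p) = pair V p := rfl

end Pair

/-! ### The degree functional on the Chow ring -/

section Chow

variable {M : Matroid (Fin (n + 1))}

open Classical in
/-- A proper flat as a finite set of elements. -/
def ProperFlat.fin (F : ProperFlat M) : Finset (Fin (n + 1)) := Finset.univ.filter (· ∈ F.1)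

theorem ProperFlat.mem_fin {F : ProperFlat M} {i : Fin (n + 1)} : i ∈ F.fin ↔ i ∈ F.1 := by
  simp [ProperFlat.fin]

theorem ProperFlat.coe_fin (F : ProperFlat M) : (F.fin : Set (Fin (n + 1))) = F.1 := by
  ext i; simp [ProperFlat.mem_fin]

theorem ProperFlat.flat (F : ProperFlat M) : Flat M F.fin := by
  unfold Flat; rw [F.coe_fin]; exact F.2.1

theorem ProperFlat.fin_subset {F G : ProperFlat M} : F.fin ⊆ G.fin ↔ F.1 ⊆ G.1 := by
  rw [← Finset.coe_subset, F.coe_fin, G.coe_fin]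

theorem ProperFlat.fin_ssubset {F G : ProperFlat M} : F.fin ⊂ G.fin ↔ F < G := by
  rw [← Finset.coe_ssubset, F.coe_fin, G.coe_fin]; rfl

theorem ProperFlat.fin_injective : Function.Injective (ProperFlat.fin (M := M)) := by
  intro F G h
  apply Subtype.ext
  rw [← F.coe_fin, ← G.coe_fin, h]

theorem ProperFlat.fin_mem_between (F : ProperFlat M) : F.fin ∈ between M ∅ Finset.univ := by
  refine mem_between.2 ⟨F.flat, ?_, ?_⟩
  · rw [Finset.empty_ssubset, ← Finset.coe_nonempty, F.coe_fin]; exact F.2.2.1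
  · rw [Finset.ssubset_univ_iff, Ne, ← Finset.coe_inj, F.coe_fin, Finset.coe_univ]; exact F.2.2.2

theorem exists_fin_eq {G : Finset (Fin (n + 1))} (h : G ∈ between M ∅ Finset.univ) :
    ∃ F : ProperFlat M, F.fin = G := by
  obtain ⟨h1, h2, h3⟩ := mem_between.1 h
  refine ⟨⟨(G : Set (Fin (n + 1))), (show M.IsFlat (G : Set (Fin (n + 1))) from h1), ?_, ?_⟩, ?_⟩
  · rw [Finset.coe_nonempty]; exact Finset.empty_ssubset.1 h2
  · rw [Finset.ssubset_univ_iff] at h3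
    rwa [Ne, ← Finset.coe_univ, Finset.coe_inj]
  · ext i; simp [ProperFlat.fin]

variable (M) in
/-- The volume polynomial of `M`. -/
def matroidVol : MvPolynomial (Finset (Fin (n + 1))) ℝ := volPoly M ∅ Finset.univ

variable (M) in
/-- The homomorphism from the polynomial ring on the proper flats which induces the homomorphism
from the Chow ring to the quotient by the annihilator of the volume polynomial. -/
def polyToAnn : MvPolynomial (ProperFlat M) ℤ →+* AnnRing (matroidVol M) :=
  eval₂Hom (Int.castRingHom _) fun F => Ideal.Quotient.mk _ (X F.fin)

theorem polyToAnn_X (F : ProperFlat M) :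
    polyToAnn M (X F) = Ideal.Quotient.mk _ (X F.fin) := eval₂Hom_X' _ _ _

theorem volSpec_matroid (hE : M.E = Set.univ) (hloop : M.Loopless) :
    VolSpec M ∅ Finset.univ :=
  volSpec hE (flat_empty hloop) (flat_univ hE)
    (Finset.empty_ssubset.2 Finset.univ_nonempty)

theorem pderiv_prod_eq_zero (hE : M.E = Set.univ) (hloop : M.Loopless) {F G : ProperFlat M}
    (h1 : ¬ F.1 ⊆ G.1) (h2 : ¬ G.1 ⊆ F.1) :
    pderiv G.fin (pderiv F.fin (matroidVol M)) = 0 := by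
  obtain ⟨hFf, hF1, hF2⟩ := mem_between.1 F.fin_mem_between
  rw [matroidVol, (volSpec_matroid hE hloop).deriv _ F.fin_mem_between, pderiv_mul,
    (volSpec hE (flat_empty hloop) F.flat hF1).supp _
      fun h => h2 (ProperFlat.fin_subset.1 h.2.2),
    (volSpec hE F.flat (flat_univ hE) hF2).supp _
      fun h => h1 (ProperFlat.fin_subset.1 h.2.1)]
  simp

/-- On the volume polynomial of a matroid, a linear function of the proper flats acts as the
linear form with the same coefficients, provided it vanishes on the improper flats. -/
theorem sum_flats_eq_lin (hE : M.E = Set.univ) (hloop : M.Loopless)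
    (w : Finset (Fin (n + 1)) → ℝ) (h0 : w ∅ = 0) (h1 : w Finset.univ = 0) :
    Ideal.Quotient.mk (ann (matroidVol M)) (∑ F : ProperFlat M, C (w F.fin) * X F.fin) =
      Ideal.Quotient.mk (ann (matroidVol M)) (lin w) := by
  classical
  have hsupp : ∀ G, G ∉ between M ∅ Finset.univ →
      Ideal.Quotient.mk (ann (matroidVol M)) (C (w G) * X G) = 0 := by
    intro G hG
    rcases eq_or_ne G ∅ with rfl | hG0
    · simp [h0]
    rcases eq_or_ne G Finset.univ with rfl | hG1
    · simp [h1]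
    rw [Ideal.Quotient.eq_zero_iff_mem]
    refine Ideal.mul_mem_left _ _ fun q => ?_
    rw [pair_X_mul, matroidVol, (volSpec_matroid hE hloop).supp G, pair_zero]
    exact fun h => hG (mem_between.2 ⟨h.1, Finset.empty_ssubset.2
      (Finset.nonempty_iff_ne_empty.2 hG0), Finset.ssubset_univ_iff.2 hG1⟩)
  rw [lin, map_sum, map_sum, ← Finset.sum_subset (Finset.subset_univ (between M ∅ Finset.univ))
    fun G _ hG => hsupp G hG]
  refine Finset.sum_bij (fun F _ => F.fin) (fun F _ => F.fin_mem_between)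
    (fun F _ G _ h => ProperFlat.fin_injective h) (fun G hG => ?_) fun F _ => rfl
  obtain ⟨F, hF⟩ := exists_fin_eq hG
  exact ⟨F, Finset.mem_univ _, hF⟩

theorem polyToAnn_starSum_sub (hE : M.E = Set.univ) (hloop : M.Loopless) (i j : Fin (n + 1)) :
    polyToAnn M (starSum M i - starSum M j) = 0 := by
  classical
  have h1 : ∀ i, polyToAnn M (starSum M i) = Ideal.Quotient.mk (ann (matroidVol M))
      (∑ F : ProperFlat M, C (star i F.fin) * X F.fin) := by
    intro i
    rw [starSum, map_sum, map_sum]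
    refine Finset.sum_congr rfl fun F _ => ?_
    by_cases h : i ∈ F.1
    · rw [if_pos h, polyToAnn_X, star_eq_one (ProperFlat.mem_fin.2 h)]; simp
    · rw [if_neg h, star_eq_zero (mt ProperFlat.mem_fin.1 h)]; simp
  have h2 := sum_flats_eq_lin hE hloop (fun G => star i G - star j G)
    (by simp [star]) (by simp [star])
  have h3 : lin (fun G => star i G - star j G) ∈ ann (matroidVol M) := by
    refine lin_mem_ann ?_
    have : (fun G => star i G - star j G) = star i + (-1 : ℝ) • star j := by
      funext G; simp [sub_eq_add_neg]
    rw [this, dirD_add, dirD_smul, matroidVol, (volSpec_matroid hE hloop).star,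
      (volSpec_matroid hE hloop).star]
    simp
  rw [map_sub, h1, h1, ← map_sub, ← Finset.sum_sub_distrib]
  rw [Ideal.Quotient.eq_zero_iff_mem.2 h3] at h2
  rw [← h2]
  congr 1
  exact Finset.sum_congr rfl fun F _ => by rw [C_sub, sub_mul]

theorem polyToAnn_eq_zero (hE : M.E = Set.univ) (hloop : M.Loopless)
    {p : MvPolynomial (ProperFlat M) ℤ} (hp : p ∈ idealI M ⊔ idealJ M) : polyToAnn M p = 0 := by
  have h : idealI M ⊔ idealJ M ≤ RingHom.ker (polyToAnn M) := by
    refine sup_le (Ideal.span_le.2 ?_) (Ideal.span_le.2 ?_)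
    · rintro _ ⟨F, G, h1, h2, rfl⟩
      rw [SetLike.mem_coe, RingHom.mem_ker, map_mul, polyToAnn_X, polyToAnn_X, ← map_mul,
        Ideal.Quotient.eq_zero_iff_mem]
      intro q
      rw [mul_assoc, pair_X_mul, pair_X_mul, pderiv_prod_eq_zero hE hloop h1 h2, pair_zero]
    · rintro _ ⟨i, j, -, rfl⟩
      exact polyToAnn_starSum_sub hE hloop i j
  exact h hp

/-- The homomorphism from the Chow ring to the quotient by the annihilator of the volume
polynomial. -/
def chowToAnn (hE : M.E = Set.univ) (hloop : M.Loopless) :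
    ChowRing M →+* AnnRing (matroidVol M) :=
  Ideal.Quotient.lift _ (polyToAnn M) fun _ hp => polyToAnn_eq_zero hE hloop hp

theorem chowToAnn_flatClass (hE : M.E = Set.univ) (hloop : M.Loopless) (F : ProperFlat M) :
    chowToAnn hE hloop (flatClass M F) = Ideal.Quotient.mk _ (X F.fin) := by
  rw [chowToAnn, flatClass, Ideal.Quotient.lift_mk, polyToAnn_X]

/-- The degree functional on the whole Chow ring. -/
def chowFunctional (hE : M.E = Set.univ) (hloop : M.Loopless) : ChowRing M →+ ℝ :=
  (pairQ (matroidVol M)).toAddMonoidHom.comp (chowToAnn hE hloop).toAddMonoidHom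

theorem chowFunctional_apply (hE : M.E = Set.univ) (hloop : M.Loopless) (x : ChowRing M) :
    chowFunctional hE hloop x = pairQ (matroidVol M) (chowToAnn hE hloop x) := rfl

end Chow

end

section

variable {n : ℕ}

open MvPolynomial

/-! ### The degree map -/

/-- A strictly increasing sequence of `r` numbers between `1` and `r` is `1, 2, …, r`. -/
theorem eq_succ_of_strictMono {r : ℕ} {f : Fin r → ℕ} (hf : StrictMono f) (h1 : ∀ j, 1 ≤ f j)
    (h2 : ∀ j, f j ≤ r) (j : Fin r) : f j = j + 1 := by
  have low : ∀ (g : Fin r → ℕ), StrictMono g → (∀ j, 1 ≤ g j) → ∀ (k : ℕ) (hk : k < r),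
      k + 1 ≤ g ⟨k, hk⟩ := by
    intro g hg hg1 k
    induction k with
    | zero => intro hk; exact hg1 _
    | succ k ih =>
      intro hk
      have := ih (by omega)
      have := hg (show (⟨k, by omega⟩ : Fin r) < ⟨k + 1, hk⟩ from Nat.lt_succ_self k)
      omega
  have low' : ∀ (g : Fin r → ℕ), StrictMono g → (∀ j, 1 ≤ g j) → ∀ i : Fin r, i + 1 ≤ g i :=
    fun g hg hg1 i => low g hg hg1 i i.2
  refine le_antisymm ?_ (low' f hf h1 j)
  have := low' (fun i => r + 1 - f i.rev) (fun a b hab => by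
      have h3 := hf (Fin.rev_lt_rev.2 hab)
      have := h2 a.rev
      show r + 1 - f a.rev < r + 1 - f b.rev
      omega) (fun i => by have := h2 i.rev; show 1 ≤ r + 1 - f i.rev; omega) j.rev
  simp only [Fin.rev_rev, Fin.val_rev] at this
  have := h2 j
  have := j.2
  omega

section Chow

variable {M : Matroid (Fin (n + 1))}

theorem ProperFlat.frk_pos (hE : M.E = Set.univ) (hloop : M.Loopless) (F : ProperFlat M) :
    1 ≤ frk M F.fin := by
  have := (flat_empty hloop).frk_lt hE (mem_between.1 F.fin_mem_between).2.1
  omega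

theorem ProperFlat.frk_le {r : ℕ} (hE : M.E = Set.univ) (hr : M.eRank = ((r + 1 : ℕ) : ℕ∞))
    (F : ProperFlat M) : frk M F.fin ≤ r := by
  have := F.flat.frk_lt hE (mem_between.1 F.fin_mem_between).2.2
  rw [frk_univ hE hr] at this
  omega

theorem ProperFlat.frk_lt_frk (hE : M.E = Set.univ) {F G : ProperFlat M} (h : F < G) :
    frk M F.fin < frk M G.fin := F.flat.frk_lt hE (ProperFlat.fin_ssubset.2 h)

theorem frk_chain {r : ℕ} (hE : M.E = Set.univ) (hloop : M.Loopless)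
    (hr : M.eRank = ((r + 1 : ℕ) : ℕ∞)) {F : Fin r → ProperFlat M} (hF : StrictMono F)
    (j : Fin r) : frk M (F j).fin = j + 1 :=
  eq_succ_of_strictMono (f := fun j => frk M (F j).fin)
    (fun _ _ h => ProperFlat.frk_lt_frk hE (hF h)) (fun j => (F j).frk_pos hE hloop)
    (fun j => (F j).frk_le hE hr) j

/-- A product of derivatives along a maximal chain of flats takes the volume polynomial to `1`. -/
theorem pair_volPoly_chain (hE : M.E = Set.univ) (d : ℕ) {A B : Finset (Fin (n + 1))}
    (hA : Flat M A) (hB : Flat M B) (hAB : A ⊂ B) (hd : frk M B = frk M A + d + 1)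
    (G : Fin d → Finset (Fin (n + 1))) (hG : StrictMono G) (hmem : ∀ j, G j ∈ between M A B)
    (hrk : ∀ j, frk M (G j) = frk M A + j + 1) :
    pair (volPoly M A B) (∏ j, X (G j)) = 1 := by
  induction d generalizing A with
  | zero => simp [volPoly_of_le (show frk M B ≤ frk M A + 1 by omega), pair_one]
  | succ d ih =>
    obtain ⟨hf, h1, h2⟩ := mem_between.1 (hmem 0)
    have h0 := hrk 0
    rw [Fin.prod_univ_succ, pair_X_mul, (volSpec hE hA hB hAB).deriv _ (hmem 0),
      volPoly_of_le (A := A) (by rw [h0]; simp), one_mul]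
    refine ih hf h2 (by rw [h0, hd]; simp; omega) (fun j => G j.succ)
      (fun _ _ h => hG (Fin.succ_lt_succ_iff.2 h)) (fun j => ?_) (fun j => ?_)
    · exact mem_between.2 ⟨(mem_between.1 (hmem _)).1, hG (Fin.succ_pos j),
        (mem_between.1 (hmem _)).2.2⟩
    · have := hrk j.succ
      rw [this, h0]; simp; omega

theorem chowFunctional_chain {r : ℕ} (hE : M.E = Set.univ) (hloop : M.Loopless)
    (hr : M.eRank = ((r + 1 : ℕ) : ℕ∞)) {F : Fin r → ProperFlat M} (hF : StrictMono F) :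
    chowFunctional hE hloop (chainClass M F : ChowRing M) = 1 := by
  have h1 : chowToAnn hE hloop (chainClass M F : ChowRing M) =
      Ideal.Quotient.mk _ (∏ j, X (F j).fin) := by
    simp only [chainClass, pow_one, map_prod, chowToAnn_flatClass]
  rw [chowFunctional_apply, h1, pairQ_mk]
  refine pair_volPoly_chain hE r (flat_empty hloop) (flat_univ hE)
    (Finset.empty_ssubset.2 Finset.univ_nonempty) (by rw [frk_univ hE hr, frk_empty]; omega) _
    (fun _ _ h => ProperFlat.fin_ssubset.2 (hF h)) (fun j => (F j).fin_mem_between) fun j => ?_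
  rw [frk_chain hE hloop hr hF, frk_empty]; omega

/-! ### The top degree of the Chow ring -/

theorem flatClass_mul_eq_zero {F G : ProperFlat M} (h1 : ¬ F.1 ⊆ G.1) (h2 : ¬ G.1 ⊆ F.1) :
    flatClass M F * flatClass M G = 0 := by
  rw [flatClass, flatClass, ← map_mul, Ideal.Quotient.eq_zero_iff_mem]
  exact Ideal.mem_sup_left (Ideal.subset_span ⟨F, G, h1, h2, rfl⟩)

open Classical in
variable (M) in
/-- The class `∑_{F ∋ i} x_F`, which does not depend on `i`. -/
def starClass (i : Fin (n + 1)) : ChowRing M :=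
  ∑ F : ProperFlat M, if i ∈ F.1 then flatClass M F else 0

theorem starClass_eq (i j : Fin (n + 1)) : starClass M i = starClass M j := by
  have h : ∀ i, Ideal.Quotient.mk (idealI M ⊔ idealJ M) (starSum M i) = starClass M i := by
    intro i
    rw [starSum, starClass, map_sum]
    refine Finset.sum_congr rfl fun F _ => ?_
    split_ifs
    · rfl
    · exact map_zero _
  have key : ∀ i j, i < j → starClass M i = starClass M j := by
    intro i j hij
    rw [← h, ← h, Ideal.Quotient.eq]
    exact Ideal.mem_sup_right (Ideal.subset_span ⟨i, j, hij, rfl⟩)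
  rcases lt_trichotomy i j with h1 | h1 | h1
  · exact key i j h1
  · rw [h1]
  · exact (key j i h1).symm

variable (M) in
/-- The class `∑_{F ∋ 0} x_F`. -/
def topClass : ChowRing M := starClass M 0

theorem topClass_mul (i : Fin (n + 1)) (x : ChowRing M) (S : ProperFlat M → Prop)
    (h : ∀ F : ProperFlat M, i ∈ F.1 → ¬ S F → flatClass M F * x = 0) :
    open Classical in
    topClass M * x = ∑ F : ProperFlat M, if i ∈ F.1 ∧ S F then flatClass M F * x else 0 := by
  classical
  rw [topClass, starClass_eq 0 i, starClass, Finset.sum_mul]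
  refine Finset.sum_congr rfl fun F _ => ?_
  by_cases h1 : i ∈ F.1
  · by_cases h2 : S F
    · simp [h1, h2]
    · simp [h1, h2, h F h1 h2]
  · simp [h1]

/-- For `i ∉ G` the flats that contain `i` and are comparable to `G` contain `G` strictly, so that
each factor `∑_{F ∋ i} x_F` raises the rank. -/
theorem topClass_pow_mul_eq_zero {r : ℕ} (hE : M.E = Set.univ)
    (hr : M.eRank = ((r + 1 : ℕ) : ℕ∞)) (s : ℕ) (G : ProperFlat M) (h : r < s + frk M G.fin) :
    topClass M ^ s * flatClass M G = 0 := by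
  induction s generalizing G with
  | zero =>
    have := G.frk_le hE hr
    omega
  | succ s ih =>
    obtain ⟨i, -, hi⟩ := Finset.exists_of_ssubset (mem_between.1 G.fin_mem_between).2.2
    rw [ProperFlat.mem_fin] at hi
    rw [pow_succ, mul_assoc, topClass_mul i _ (fun F => G < F), Finset.mul_sum]
    · refine Finset.sum_eq_zero fun F _ => ?_
      split_ifs with hF
      · have := ProperFlat.frk_lt_frk hE hF.2
        rw [← mul_assoc, ih F (by omega), zero_mul]
      · exact mul_zero _
    · intro F hiF hGF
      refine flatClass_mul_eq_zero (fun h' => hi (h' hiF)) fun h' => hGF ?_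
      exact lt_of_le_of_ne h' fun e => hi (e ▸ hiF)

/-- A product along the first `k` members of a maximal chain, completed by a power of
`∑_{F ∋ i} x_F`. -/
theorem prod_mul_topClass_pow {r : ℕ} (hE : M.E = Set.univ) (hloop : M.Loopless)
    (hr : M.eRank = ((r + 1 : ℕ) : ℕ∞)) {F : Fin r → ProperFlat M} (hF : StrictMono F)
    (k : ℕ) (hk : k ≤ r) :
    (∏ j : Fin k, flatClass M (F ⟨j, j.2.trans_le hk⟩)) * topClass M ^ (r - k) =
      topClass M ^ r := by
  classical
  induction k with
  | zero => simp
  | succ k ih =>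
    rw [← ih (by omega), Fin.prod_univ_castSucc]
    set P := ∏ j : Fin k, flatClass M (F ⟨j, j.2.trans_le (by omega)⟩) with hP
    -- the preceding member of the chain, or the empty flat
    obtain ⟨G, hGf, hGk, hGH, hGP⟩ : ∃ G : Finset (Fin (n + 1)), Flat M G ∧ frk M G = k ∧
        G ⊂ (F ⟨k, hk⟩).fin ∧ ∀ F' : ProperFlat M, ¬ F'.fin ⊆ G → ¬ G ⊆ F'.fin →
          flatClass M F' * P = 0 := by
      rcases Nat.eq_zero_or_pos k with rfl | hk0
      · exact ⟨∅, flat_empty hloop, frk_empty M,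
          (mem_between.1 (F ⟨0, hk⟩).fin_mem_between).2.1, fun F' _ h => absurd (by simp) h⟩
      · obtain ⟨l, rfl⟩ : ∃ l, k = l + 1 := ⟨k - 1, by omega⟩
        have hl : l < r := by omega
        have hd : flatClass M (F ⟨l, hl⟩) ∣ P := by
          rw [hP, Fin.prod_univ_castSucc]
          exact dvd_mul_left _ _
        obtain ⟨q, hq⟩ := hd
        have hlt : (⟨l, hl⟩ : Fin r) < ⟨l + 1, hk⟩ := Nat.lt_succ_self l
        refine ⟨(F ⟨l, hl⟩).fin, (F ⟨l, hl⟩).flat, frk_chain hE hloop hr hF ⟨l, hl⟩,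
          ProperFlat.fin_ssubset.2 (hF hlt), fun F' h1 h2 => ?_⟩
        rw [hq, ← mul_assoc, flatClass_mul_eq_zero (mt ProperFlat.fin_subset.2 h1)
          (mt ProperFlat.fin_subset.2 h2), zero_mul]
    obtain ⟨i, hiH, hiG⟩ := Finset.exists_of_ssubset hGH
    have e : r - k = (r - (k + 1)) + 1 := by omega
    rw [e, pow_succ, show P * (topClass M ^ (r - (k + 1)) * topClass M) =
      topClass M ^ (r - (k + 1)) * (topClass M * P) by ring,
      topClass_mul i P (fun F' => G ⊂ F'.fin) (fun F' hi hGF => hGP F'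
        (fun h => hiG (h (ProperFlat.mem_fin.2 hi)))
        (fun h => hGF (lt_of_le_of_ne h fun e => hiG (e ▸ ProperFlat.mem_fin.2 hi)))),
      Finset.mul_sum, Finset.sum_eq_single (F ⟨k, hk⟩)]
    · rw [if_pos ⟨ProperFlat.mem_fin.1 hiH, hGH⟩]
      change P * flatClass M (F ⟨k, hk⟩) * topClass M ^ (r - (k + 1)) = _
      ring
    · intro F' _ hne
      split_ifs with hF'
      · have h1 := hGf.frk_lt hE hF'.2
        rcases (show k + 1 ≤ frk M F'.fin by omega).eq_or_lt with h2 | h2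
        · refine absurd (ProperFlat.fin_injective ?_) hne
          rw [hGf.eq_cl_insert hE F'.flat hF'.2.subset (by omega) (ProperFlat.mem_fin.2 hF'.1) hiG,
            hGf.eq_cl_insert hE (F ⟨k, hk⟩).flat hGH.subset
              (by rw [frk_chain hE hloop hr hF, hGk]) hiH hiG]
        · rw [← mul_assoc, topClass_pow_mul_eq_zero hE hr _ _ (by omega), zero_mul]
      · exact mul_zero _
    · simp

/-- The class of any maximal chain is the `r`-th power of `∑_{F ∋ 0} x_F`. -/
theorem chainClass_eq {r : ℕ} (hE : M.E = Set.univ) (hloop : M.Loopless)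
    (hr : M.eRank = ((r + 1 : ℕ) : ℕ∞)) {F : Fin r → ProperFlat M} (hF : StrictMono F) :
    (chainClass M F : ChowRing M) = topClass M ^ r := by
  have := prod_mul_topClass_pow hE hloop hr hF r le_rfl
  simpa [chainClass] using this

/-- The members of a chain of `r` proper flats can be listed in increasing order. -/
theorem exists_strictMono_of_chain {r : ℕ} (hE : M.E = Set.univ) (hloop : M.Loopless)
    (hr : M.eRank = ((r + 1 : ℕ) : ℕ∞)) (S : Finset (ProperFlat M)) (hS : S.card = r)
    (hchain : ∀ F ∈ S, ∀ G ∈ S, F.1 ⊆ G.1 ∨ G.1 ⊆ F.1) :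
    ∃ F : Fin r → ProperFlat M, StrictMono F ∧ ∀ f : ProperFlat M → ChowRing M,
      ∏ G ∈ S, f G = ∏ j, f (F j) := by
  classical
  have hlt : ∀ F ∈ S, ∀ G ∈ S, frk M F.fin < frk M G.fin → F < G := by
    intro F hF G hG h
    rcases hchain F hF G hG with h1 | h1
    · exact lt_of_le_of_ne h1 fun e => by rw [e] at h; exact lt_irrefl _ h
    · have := frk_mono (M := M) (ProperFlat.fin_subset.2 h1); omega
  have hinj : Set.InjOn (fun F : ProperFlat M => frk M F.fin) S := by
    intro F hF G hG h
    by_contra hne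
    rcases hchain F hF G hG with h1 | h1
    · have := ProperFlat.frk_lt_frk hE (lt_of_le_of_ne (show F ≤ G from h1) hne)
      simp only at h; omega
    · have := ProperFlat.frk_lt_frk hE (lt_of_le_of_ne (show G ≤ F from h1) (Ne.symm hne))
      simp only at h; omega
  have himg : S.image (fun F => frk M F.fin) = Finset.Icc 1 r := by
    refine Finset.eq_of_subset_of_card_le (fun k hk => ?_) ?_
    · obtain ⟨F, -, rfl⟩ := Finset.mem_image.1 hk
      exact Finset.mem_Icc.2 ⟨F.frk_pos hE hloop, F.frk_le hE hr⟩
    · rw [Finset.card_image_of_injOn hinj, hS]; simp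
  have hex : ∀ j : Fin r, ∃ F ∈ S, frk M F.fin = j + 1 := by
    intro j
    have : (j : ℕ) + 1 ∈ S.image (fun F => frk M F.fin) := by
      rw [himg]; exact Finset.mem_Icc.2 ⟨by omega, j.2⟩
    simpa using this
  choose F hFS hF using hex
  have hmono : StrictMono F := fun i j hij =>
    hlt _ (hFS i) _ (hFS j) (by rw [hF, hF]; have : (i : ℕ) < j := hij; omega)
  refine ⟨F, hmono, fun f => ?_⟩
  have : S = Finset.univ.image F := by
    symm
    refine Finset.eq_of_subset_of_card_le (fun G hG => ?_) ?_
    · obtain ⟨j, -, rfl⟩ := Finset.mem_image.1 hG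
      exact hFS j
    · rw [Finset.card_image_of_injective _ hmono.injective, hS]; simp
  rw [this, Finset.prod_image fun i _ j _ h => hmono.injective h]

variable (M) in
/-- The class of a monomial. -/
def monoClass (c : ProperFlat M →₀ ℕ) : ChowRing M :=
  Ideal.Quotient.mk (idealI M ⊔ idealJ M) (monomial c 1)

theorem monoClass_add_single (c : ProperFlat M →₀ ℕ) (G : ProperFlat M) :
    monoClass M (c + Finsupp.single G 1) = flatClass M G * monoClass M c := by
  rw [monoClass, monoClass, flatClass, ← map_mul, X, monomial_mul, one_mul, add_comm]

theorem monoClass_eq_prod (c : ProperFlat M →₀ ℕ) :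
    monoClass M c = ∏ F ∈ c.support, flatClass M F ^ c F := by
  rw [monoClass, monomial_eq, C_1, one_mul, Finsupp.prod, map_prod]
  simp only [map_pow, flatClass]

/-- Multiplying a monomial by one of its variables `x_F` amounts to multiplying it by a
combination of variables which do not occur in it.  The combination is the difference of two
forms `∑_{G ∋ i} x_G`, with `i` separating `F` from the smaller flats of the monomial and `j`
separating `F` from the larger ones. -/
theorem flatClass_mul_monoClass {c : ProperFlat M →₀ ℕ}
    (hchain : ∀ F ∈ c.support, ∀ G ∈ c.support, F.1 ⊆ G.1 ∨ G.1 ⊆ F.1)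
    {F : ProperFlat M} (hF : F ∈ c.support) :
    ∃ w : ProperFlat M → ℤ, (∀ G ∈ c.support, w G = 0) ∧
      flatClass M F * monoClass M c = ∑ G, w G • (flatClass M G * monoClass M c) := by
  classical
  obtain ⟨i, hiF, hi⟩ : ∃ i ∈ F.1, ∀ G ∈ c.support, G < F → i ∉ G.1 := by
    by_cases hne : (c.support.filter fun G => G < F).Nonempty
    · obtain ⟨P, hP, hmax⟩ := Finset.exists_max_image _ (fun G => frk M G.fin) hne
      obtain ⟨hPc, hPF⟩ := Finset.mem_filter.1 hP
      obtain ⟨i, hiF, hiP⟩ := Finset.exists_of_ssubset (ProperFlat.fin_ssubset.2 hPF)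
      refine ⟨i, ProperFlat.mem_fin.1 hiF, fun G hG hGF hiG => ?_⟩
      have h1 := hmax G (Finset.mem_filter.2 ⟨hG, hGF⟩)
      rcases hchain G hG P hPc with h2 | h2
      · exact hiP (ProperFlat.mem_fin.2 (h2 hiG))
      · have h3 := cl_eq_cl (ProperFlat.fin_subset.2 h2) h1
        rw [P.flat.cl_eq, G.flat.cl_eq] at h3
        exact hiP (h3 ▸ ProperFlat.mem_fin.2 hiG)
    · obtain ⟨i, hi⟩ := F.2.2.1
      exact ⟨i, hi, fun G hG hGF => absurd ⟨G, Finset.mem_filter.2 ⟨hG, hGF⟩⟩ hne⟩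
  obtain ⟨j, hjF, hj⟩ : ∃ j, j ∉ F.1 ∧ ∀ G ∈ c.support, F < G → j ∈ G.1 := by
    by_cases hne : (c.support.filter fun G => F < G).Nonempty
    · obtain ⟨P, hP, hmin⟩ := Finset.exists_min_image _ (fun G => frk M G.fin) hne
      obtain ⟨hPc, hPF⟩ := Finset.mem_filter.1 hP
      obtain ⟨j, hjP, hjF⟩ := Finset.exists_of_ssubset (ProperFlat.fin_ssubset.2 hPF)
      refine ⟨j, mt ProperFlat.mem_fin.2 hjF, fun G hG hGF => ?_⟩
      have h1 := hmin G (Finset.mem_filter.2 ⟨hG, hGF⟩)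
      rcases hchain G hG P hPc with h2 | h2
      · have h3 := cl_eq_cl (ProperFlat.fin_subset.2 h2) h1
        rw [P.flat.cl_eq, G.flat.cl_eq] at h3
        exact ProperFlat.mem_fin.1 (h3 ▸ hjP)
      · exact h2 (ProperFlat.mem_fin.1 hjP)
    · obtain ⟨j, -, hj⟩ := Finset.exists_of_ssubset (mem_between.1 F.fin_mem_between).2.2
      exact ⟨j, mt ProperFlat.mem_fin.2 hj,
        fun G hG hGF => absurd ⟨G, Finset.mem_filter.2 ⟨hG, hGF⟩⟩ hne⟩
  refine ⟨fun G => if G = F then 0 else (if j ∈ G.1 then 1 else 0) - (if i ∈ G.1 then 1 else 0),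
    fun G hG => ?_, ?_⟩
  · rcases eq_or_ne G F with rfl | hne
    · simp
    rcases hchain G hG F hF with h | h
    · have hlt : G < F := lt_of_le_of_ne h hne
      have := hi G hG hlt
      have h2 : j ∉ G.1 := fun h3 => hjF (h h3)
      simp [this, h2]
    · have hlt : F < G := lt_of_le_of_ne h hne.symm
      have := hj G hG hlt
      have h2 : i ∈ G.1 := h hiF
      simp [this, h2]
  · have h1 : (starClass M i - starClass M j) * monoClass M c = 0 := by
      rw [starClass_eq i j, sub_self, zero_mul]
    rw [starClass, starClass, ← Finset.sum_sub_distrib, Finset.sum_mul,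
      ← Finset.add_sum_erase _ _ (Finset.mem_univ F), if_pos hiF, if_neg hjF, sub_zero] at h1
    rw [eq_neg_of_add_eq_zero_left h1, ← Finset.add_sum_erase Finset.univ _ (Finset.mem_univ F),
      ← Finset.sum_neg_distrib]
    simp only [if_true, zero_smul, zero_add]
    refine Finset.sum_congr rfl fun G hG => ?_
    rw [if_neg (Finset.ne_of_mem_erase hG)]
    split_ifs <;> simp

/-- Monomials with incomparable factors vanish, squarefree monomials on chains are maximal chains,
and in any other monomial a repeated factor can be traded for new variables. -/
theorem monoClass_mem {r : ℕ} (hE : M.E = Set.univ) (hloop : M.Loopless)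
    (hr : M.eRank = ((r + 1 : ℕ) : ℕ∞)) (c : ProperFlat M →₀ ℕ) (hc : c.degree = r) :
    monoClass M c ∈ Submodule.span ℤ {topClass M ^ r} := by
  classical
  -- The support of the monomial grows when a repeated factor is traded.
  induction hN : r - c.support.card using Nat.strong_induction_on generalizing c with
  | _ N ih =>
    by_cases hchain : ∀ F ∈ c.support, ∀ G ∈ c.support, F.1 ⊆ G.1 ∨ G.1 ⊆ F.1
    swap
    · push Not at hchain
      obtain ⟨F, hF, G, hG, h1, h2⟩ := hchain
      have hne : F ≠ G := fun e => h1 (e ▸ subset_rfl)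
      have h3 : flatClass M F * flatClass M G ∣ monoClass M c := by
        rw [monoClass_eq_prod, ← Finset.mul_prod_erase _ _ hF]
        refine mul_dvd_mul (dvd_pow_self _ (Finsupp.mem_support_iff.1 hF)) ?_
        exact (dvd_pow_self _ (Finsupp.mem_support_iff.1 hG)).trans
          (Finset.dvd_prod_of_mem (fun F => flatClass M F ^ c F)
            (Finset.mem_erase.2 ⟨hne.symm, hG⟩))
      rw [flatClass_mul_eq_zero h1 h2, zero_dvd_iff] at h3
      rw [h3]; exact Submodule.zero_mem _
    by_cases hone : ∀ F ∈ c.support, c F = 1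
    · have hcard : c.support.card = r := by
        rw [← hc, Finsupp.degree, Finset.card_eq_sum_ones]
        exact Finset.sum_congr rfl fun F hF => (hone F hF).symm
      obtain ⟨F, hF, hprod⟩ := exists_strictMono_of_chain hE hloop hr _ hcard hchain
      have h1 : monoClass M c = topClass M ^ r := by
        rw [← chainClass_eq hE hloop hr hF, monoClass_eq_prod,
          Finset.prod_congr rfl fun F hF => by rw [hone F hF], hprod]
        rfl
      rw [h1]; exact Submodule.mem_span_singleton_self _
    · push Not at hone
      obtain ⟨F, hF, hF1⟩ := hone
      have hF0 := Finsupp.mem_support_iff.1 hF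
      set c' := c - Finsupp.single F 1 with hc'
      have hle : Finsupp.single F 1 ≤ c := by
        rw [Finsupp.single_le_iff]; omega
      have hcc : c = c' + Finsupp.single F 1 := (tsub_add_cancel_of_le hle).symm
      have hsupp : c'.support = c.support := by
        ext G
        rw [Finsupp.mem_support_iff, Finsupp.mem_support_iff, hc', Finsupp.tsub_apply]
        rcases eq_or_ne G F with rfl | hne
        · simp; omega
        · simp [hne.symm]
      have hdeg : c'.degree + 1 = r := by
        rw [← hc, hcc, map_add, Finsupp.degree_single]
      obtain ⟨w, hw0, hw⟩ := flatClass_mul_monoClass (c := c') (by rwa [hsupp])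
        (F := F) (by rwa [hsupp])
      have hlt : c.support.card < r := by
        rw [← hc, Finsupp.degree, Finset.card_eq_sum_ones]
        refine Finset.sum_lt_sum (fun G hG => ?_) ⟨F, hF, by omega⟩
        exact Nat.one_le_iff_ne_zero.2 (Finsupp.mem_support_iff.1 hG)
      rw [hcc, monoClass_add_single, hw]
      refine Submodule.sum_mem _ fun G _ => ?_
      by_cases hG : G ∈ c'.support
      · rw [hw0 G hG, zero_smul]; exact Submodule.zero_mem _
      · refine Submodule.smul_mem _ _ ?_
        rw [← monoClass_add_single]
        have hs : (c' + Finsupp.single G 1).support = insert G c'.support := by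
          ext H
          rw [Finset.mem_insert, Finsupp.mem_support_iff, Finsupp.mem_support_iff,
            Finsupp.add_apply]
          rcases eq_or_ne H G with rfl | hne
          · simp
          · simp [hne]
        refine ih (r - (c' + Finsupp.single G 1).support.card) ?_ _ ?_ rfl
        · rw [hs, Finset.card_insert_of_notMem hG, hsupp]; omega
        · rw [map_add, Finsupp.degree_single, hdeg]

theorem chowPiece_le_span {r : ℕ} (hE : M.E = Set.univ) (hloop : M.Loopless)
    (hr : M.eRank = ((r + 1 : ℕ) : ℕ∞)) {x : ChowRing M} (hx : x ∈ chowPiece M r) :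
    x ∈ Submodule.span ℤ {topClass M ^ r} := by
  obtain ⟨p, hp, rfl⟩ := hx
  have hp' : p.IsHomogeneous r := hp
  rw [p.as_sum, map_sum]
  refine Submodule.sum_mem _ fun c hc => ?_
  have h1 : monomial c (coeff c p) = coeff c p • monomial c (1 : ℤ) := by
    rw [smul_monomial, smul_eq_mul, mul_one]
  rw [h1, map_smul]
  refine Submodule.smul_mem _ _ (monoClass_mem hE hloop hr c ?_)
  rw [Finsupp.degree_eq_weight_one]
  exact hp' (mem_support_iff.1 hc)

theorem exists_chain {r : ℕ} (hE : M.E = Set.univ) (hloop : M.Loopless)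
    (hr : M.eRank = ((r + 1 : ℕ) : ℕ∞)) : ∃ F : Fin r → ProperFlat M, StrictMono F := by
  have hstep : ∀ G : Finset (Fin (n + 1)), ∃ G', Flat M G → frk M G ≤ r →
      Flat M G' ∧ G ⊂ G' ∧ frk M G' = frk M G + 1 := by
    intro G
    by_cases hG : Flat M G ∧ frk M G ≤ r
    · have hne : G ⊂ Finset.univ := by
        rw [Finset.ssubset_univ_iff]
        intro h
        have h1 := frk_univ hE hr
        rw [← h] at h1
        omega
      obtain ⟨i, -, hi⟩ := Finset.exists_of_ssubset hne
      refine ⟨cl M (insert i G), fun _ _ => ⟨flat_cl _ _, ?_, ?_⟩⟩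
      · have := subset_cl hE (insert i G)
        exact lt_of_lt_of_le (Finset.ssubset_insert hi) this
      · rw [frk_cl, frk_insert hE (by rwa [hG.1.cl_eq])]
    · exact ⟨G, fun h1 h2 => absurd ⟨h1, h2⟩ hG⟩
  choose next hnext using hstep
  set G : ℕ → Finset (Fin (n + 1)) := fun k => next^[k] ∅ with hGdef
  have hG : ∀ k ≤ r + 1, Flat M (G k) ∧ frk M (G k) = k := by
    intro k
    induction k with
    | zero => exact fun _ => ⟨flat_empty hloop, frk_empty M⟩
    | succ k ih =>
      intro hk
      obtain ⟨h1, h2⟩ := ih (by omega)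
      obtain ⟨h3, -, h5⟩ := hnext (G k) h1 (by omega)
      have e : G (k + 1) = next (G k) := Function.iterate_succ_apply' next k ∅
      rw [e]
      exact ⟨h3, by rw [h5, h2]⟩
  have hlt : ∀ k ≤ r, G k ⊂ G (k + 1) := by
    intro k hk
    obtain ⟨h1, h2⟩ := hG k (by omega)
    have e : G (k + 1) = next (G k) := Function.iterate_succ_apply' next k ∅
    rw [e]
    exact (hnext (G k) h1 (by omega)).2.1
  have hmem : ∀ j : Fin r, G (j + 1) ∈ between M ∅ Finset.univ := by
    intro j
    obtain ⟨h1, h2⟩ := hG (j + 1) (by omega)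
    refine mem_between.2 ⟨h1, lt_of_le_of_lt (Finset.empty_subset _) (hlt j (by omega)),
      lt_of_lt_of_le (hlt (j + 1) (by omega)) (Finset.subset_univ _)⟩
  choose F hF using fun j => exists_fin_eq (hmem j)
  refine ⟨F, ?_⟩
  cases r with
  | zero => exact fun i => i.elim0
  | succ r =>
    refine Fin.strictMono_iff_lt_succ.2 fun i => ?_
    rw [← ProperFlat.fin_ssubset, hF, hF]
    simpa using hlt (i + 1) (by omega)

/-- There is exactly one degree map: the top degree part of the Chow ring is generated by the class
of any maximal chain, and this class has infinite order because the degree functional takes it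
to `1`. -/
theorem existsUnique_isDegreeMap {r : ℕ} (hE : M.E = Set.univ) (hloop : M.Loopless)
    (hr : M.eRank = ((r + 1 : ℕ) : ℕ∞)) : ∃! φ : chowPiece M r →+ ℤ, IsDegreeMap M r φ := by
  obtain ⟨F, hF⟩ := exists_chain hE hloop hr
  have hone := chowFunctional_chain hE hloop hr hF
  have hgen : ∀ x : chowPiece M r, ∃ z : ℤ, z • chainClass M F = x := by
    intro x
    obtain ⟨z, hz⟩ := Submodule.mem_span_singleton.1 (chowPiece_le_span hE hloop hr x.2)
    refine ⟨z, Subtype.ext ?_⟩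
    rw [Submodule.coe_smul, chainClass_eq hE hloop hr hF, hz]
  have hbij : Function.Bijective fun z : ℤ => z • chainClass M F := by
    refine ⟨fun y z hyz => ?_, hgen⟩
    have h1 := congrArg (fun x : chowPiece M r => chowFunctional hE hloop (x : ChowRing M)) hyz
    simp only [Submodule.coe_smul, map_zsmul, hone] at h1
    simpa using h1
  set e : ℤ ≃+ chowPiece M r := AddEquiv.ofBijective
    ((zmultiplesHom (chowPiece M r)) (chainClass M F)) hbij with he
  have he1 : ∀ F' : Fin r → ProperFlat M, StrictMono F' → e 1 = chainClass M F' := by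
    intro F' hF'
    have h1 : e 1 = (1 : ℤ) • chainClass M F := rfl
    apply Subtype.ext
    rw [h1, one_smul, chainClass_eq hE hloop hr hF', chainClass_eq hE hloop hr hF]
  refine ⟨e.symm.toAddMonoidHom, ⟨e.symm.bijective, fun F' hF' => ?_⟩, fun φ hφ => ?_⟩
  · rw [← he1 F' hF']; exact e.symm_apply_apply 1
  · ext x
    obtain ⟨z, rfl⟩ := hgen x
    have h2 : e.symm (chainClass M F) = 1 := by rw [← he1 F hF]; exact e.symm_apply_apply 1
    rw [map_zsmul, map_zsmul, hφ.chain F hF]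
    exact congrArg (z • ·) h2.symm

/-- The degree map is the restriction of the degree functional. -/
theorem degree_eq {r : ℕ} (hE : M.E = Set.univ) (hloop : M.Loopless)
    (hr : M.eRank = ((r + 1 : ℕ) : ℕ∞)) (x : chowPiece M r) :
    ((degree M r x : ℤ) : ℝ) = chowFunctional hE hloop (x : ChowRing M) := by
  have hex : ∃ φ : chowPiece M r →+ ℤ, IsDegreeMap M r φ :=
    (existsUnique_isDegreeMap hE hloop hr).exists
  have hdeg : IsDegreeMap M r (degree M r) := by
    rw [degree, dif_pos hex]; exact hex.choose_spec
  obtain ⟨F, hF⟩ := exists_chain hE hloop hr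
  obtain ⟨z, hz⟩ := Submodule.mem_span_singleton.1 (chowPiece_le_span hE hloop hr x.2)
  have hx : x = z • chainClass M F := by
    apply Subtype.ext
    rw [Submodule.coe_smul, chainClass_eq hE hloop hr hF, hz]
  rw [hx, map_zsmul, hdeg.chain F hF, Submodule.coe_smul, map_zsmul,
    chowFunctional_chain hE hloop hr hF]
  simp

end Chow

end

section

variable {n : ℕ}

open MvPolynomial

/-! ### The hypersimplex classes as directional derivatives -/

/-- The coefficient `-max(0, |G| - k)` of `x_G` in the class `γ_k`, up to translation of the
hypersimplex.  The index ranges over `ℤ`, so that Klyachko's relations hold without exceptions. -/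
def hsFun (k : ℤ) (G : Finset (Fin (n + 1))) : ℝ := -((max 0 ((G.card : ℤ) - k) : ℤ) : ℝ)

theorem hsFun_of_le {k : ℤ} {G : Finset (Fin (n + 1))} (h : (G.card : ℤ) ≤ k) : hsFun k G = 0 := by
  rw [hsFun, max_eq_left (by omega)]; simp

theorem hsFun_of_ge {k : ℤ} {G : Finset (Fin (n + 1))} (h : k ≤ G.card) :
    hsFun k G = k - G.card := by
  rw [hsFun, max_eq_right (by omega)]; push_cast; ring

theorem hsFun_second_difference (k : ℤ) (G : Finset (Fin (n + 1))) :
    2 * hsFun k G - hsFun (k - 1) G - hsFun (k + 1) G = if (G.card : ℤ) = k then 1 else 0 := by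
  rcases lt_trichotomy (G.card : ℤ) k with h | h | h
  · rw [hsFun_of_le (by omega), hsFun_of_le (by omega), hsFun_of_le (by omega), if_neg (by omega)]
    simp
  · rw [hsFun_of_le (by omega), hsFun_of_ge (by omega), hsFun_of_le (by omega), if_pos h]
    rw [← h]; push_cast; ring
  · rw [hsFun_of_ge (by omega), hsFun_of_ge (by omega), hsFun_of_ge (by omega), if_neg (by omega)]
    push_cast; ring

section Spec

variable {M : Matroid (Fin (n + 1))} {A B : Finset (Fin (n + 1))}

theorem VolSpec.dirD_congr (h : VolSpec M A B) {v w : Finset (Fin (n + 1)) → ℝ}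
    (hvw : ∀ G, A ⊆ G → G ⊆ B → v G = w G) :
    dirD v (volPoly M A B) = dirD w (volPoly M A B) := by
  rw [dirD_apply, dirD_apply]
  refine Finset.sum_congr rfl fun G _ => ?_
  by_cases hG : Flat M G ∧ A ⊆ G ∧ G ⊆ B
  · rw [hvw G hG.2.1 hG.2.2]
  · rw [h.supp G hG, mul_zero, mul_zero]

/-- Affine functions of the cardinality act trivially. -/
theorem VolSpec.dirD_affine (h : VolSpec M A B) (a b : ℝ) :
    dirD (fun G => a * (G.card : ℝ) + b) (volPoly M A B) = 0 := by
  have e : (fun G : Finset (Fin (n + 1)) => a * (G.card : ℝ) + b) =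
      (a • fun G : Finset (Fin (n + 1)) => (G.card : ℝ)) + b • fun _ => (1 : ℝ) := by
    funext G; simp
  rw [e, dirD_add, dirD_smul, dirD_smul, h.card, h.const]; simp

theorem VolSpec.dirD_hsFun_of_le (h : VolSpec M A B) {k : ℤ} (hk : k ≤ A.card) :
    dirD (hsFun k) (volPoly M A B) = 0 := by
  rw [h.dirD_congr (w := fun G => (-1) * (G.card : ℝ) + k), h.dirD_affine]
  intro G hG _
  have := Finset.card_le_card hG
  rw [hsFun_of_ge (by omega)]; ring

theorem VolSpec.dirD_hsFun_of_ge (h : VolSpec M A B) {k : ℤ} (hk : (B.card : ℤ) ≤ k) :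
    dirD (hsFun k) (volPoly M A B) = 0 := by
  rw [h.dirD_congr (w := fun G => 0 * (G.card : ℝ) + 0), h.dirD_affine]
  intro G _ hG
  have := Finset.card_le_card hG
  rw [hsFun_of_le (by omega)]; ring

theorem VolSpec.dirD_eq_sum (h : VolSpec M A B) {w : Finset (Fin (n + 1)) → ℝ} (hA : w A = 0)
    (hB : w B = 0) :
    dirD w (volPoly M A B) = ∑ G ∈ between M A B, C (w G) * (volPoly M A G * volPoly M G B) := by
  rw [dirD_apply, ← Finset.sum_subset (Finset.subset_univ (between M A B))]
  · exact Finset.sum_congr rfl fun G hG => by rw [h.deriv G hG]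
  · intro G _ hG
    rcases eq_or_ne G A with rfl | hGA
    · simp [hA]
    rcases eq_or_ne G B with rfl | hGB
    · simp [hB]
    rw [h.supp G, mul_zero]
    exact fun h => hG (mem_between.2 ⟨h.1, lt_of_le_of_ne h.2.1 hGA.symm,
      lt_of_le_of_ne h.2.2 hGB⟩)

theorem volSpec_left (hE : M.E = Set.univ) (hA : Flat M A) {G : Finset (Fin (n + 1))}
    (hG : G ∈ between M A B) : VolSpec M A G :=
  volSpec hE hA (mem_between.1 hG).1 (mem_between.1 hG).2.1

theorem volSpec_right (hE : M.E = Set.univ) (hB : Flat M B) {G : Finset (Fin (n + 1))}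
    (hG : G ∈ between M A B) : VolSpec M G B :=
  volSpec hE (mem_between.1 hG).1 hB (mem_between.1 hG).2.2

/-- The class of the `k`-th hypersimplex is zero on the link of a flat with `k` elements, because
`hsFun k` is affine in the cardinality both below and above cardinality `k`. -/
theorem dirD_hsFun_prod (hE : M.E = Set.univ) (hA : Flat M A) (hB : Flat M B)
    {G : Finset (Fin (n + 1))} (hG : G ∈ between M A B) :
    dirD (hsFun G.card) (volPoly M A G * volPoly M G B) = 0 :=
  dirD_prod_eq_zero _ ((volSpec_left hE hA hG).dirD_hsFun_of_ge le_rfl)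
    ((volSpec_right hE hB hG).dirD_hsFun_of_le le_rfl)

/-! ### Klyachko's relations in the Chow ring -/

variable (M) in
/-- The class `γ_k` in the quotient by the annihilator of the volume polynomial, for any `k ∈ ℤ`. -/
def hsClass (k : ℤ) : AnnRing (matroidVol M) := Ideal.Quotient.mk _ (lin (hsFun k))

theorem lin_add {σ : Type} [Fintype σ] (v w : σ → ℝ) : lin (v + w) = lin v + lin w := by
  simp [lin, add_mul, Finset.sum_add_distrib]

theorem lin_smul {σ : Type} [Fintype σ] (a : ℝ) (v : σ → ℝ) : lin (a • v) = C a * lin v := by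
  simp [lin, Finset.mul_sum, mul_assoc]

theorem hsClass_eq_zero (hE : M.E = Set.univ) (hloop : M.Loopless) {k : ℤ}
    (hk : k ≤ 0 ∨ (n : ℤ) + 1 ≤ k) : hsClass M k = 0 := by
  rw [hsClass, Ideal.Quotient.eq_zero_iff_mem]
  refine lin_mem_ann ?_
  rcases hk with hk | hk
  · exact (volSpec_matroid hE hloop).dirD_hsFun_of_le (by simpa using hk)
  · exact (volSpec_matroid hE hloop).dirD_hsFun_of_ge (by simpa using hk)

/-- Klyachko's relations hold because the second difference of the classes at `j` is the sum of the
classes of the flats with `j` elements, up to sign, and each of these annihilates the `j`-th class.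
-/
theorem klyachkoSeq_hsClass (hE : M.E = Set.univ) (hloop : M.Loopless) :
    KlyachkoSeq (hsClass M) := by
  intro j
  by_cases hj : j ≤ 0 ∨ (n : ℤ) + 1 ≤ j
  · rw [hsClass_eq_zero hE hloop hj, zero_mul]
  push Not at hj
  set w : Finset (Fin (n + 1)) → ℝ := fun G => if (G.card : ℤ) = j then 1 else 0 with hw
  have h1 : (2 : AnnRing (matroidVol M)) * hsClass M j - hsClass M (j - 1) - hsClass M (j + 1) =
      Ideal.Quotient.mk _ (lin w) := by
    have e : w = (2 : ℝ) • hsFun j + ((-1 : ℝ) • hsFun (j - 1) + (-1 : ℝ) • hsFun (j + 1)) := by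
      funext G
      simp only [hw, ← hsFun_second_difference, Pi.add_apply, Pi.smul_apply, smul_eq_mul]
      ring
    rw [e, lin_add, lin_add, lin_smul, lin_smul, lin_smul]
    simp only [map_add, map_mul, map_neg, map_one, hsClass,
      show (C (2 : ℝ) : MvPolynomial (Finset (Fin (n + 1))) ℝ) = 2 from rfl, map_ofNat]
    ring
  rw [h1, hsClass, ← map_mul, Ideal.Quotient.eq_zero_iff_mem]
  intro q
  have h0 : w ∅ = 0 := if_neg (by simp; omega)
  have h2 : w Finset.univ = 0 := if_neg (by simp; omega)
  rw [mul_right_comm, mul_comm, pair_lin_mul, matroidVol,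
    (volSpec_matroid hE hloop).dirD_eq_sum h0 h2, pair_lin_mul, map_sum]
  rw [Finset.sum_eq_zero, pair_zero]
  intro G hG
  rw [dirD_mul, dirD_C, zero_mul, zero_add]
  by_cases hGj : (G.card : ℤ) = j
  · rw [← hGj, dirD_hsFun_prod hE (flat_empty hloop) (flat_univ hE) hG, mul_zero]
  · simp [hw, hGj]

/-! ### The classes `γ_k` -/

/-- The minimum is attained by a set of `k` elements that meets `S` only if it contains the
complement of `S`. -/
theorem phiMin_indicator {m k : ℕ} (hk : k ≤ m) (F : Set (Fin m)) (S : Finset (Fin m))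
    (hS : (S : Set (Fin m)) = F) :
    phiMin k (Set.indicator F 1) = max 0 ((S.card : ℤ) - ((m : ℤ) - k)) := by
  classical
  have hsum : ∀ A : Finset (Fin m), ∑ i ∈ A, Set.indicator F (1 : Fin m → ℤ) i =
      ((A ∩ S).card : ℤ) := by
    intro A
    rw [← hS]
    simp [Set.indicator_apply, Finset.sum_ite_mem]
  have hle : ∀ A : Finset (Fin m), A.card = k →
      max 0 ((S.card : ℤ) - ((m : ℤ) - k)) ≤ ∑ i ∈ A, Set.indicator F (1 : Fin m → ℤ) i := by
    intro A hA
    rw [hsum]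
    have h1 := Finset.card_union_add_card_inter A S
    have h2 := Finset.card_le_univ (A ∪ S)
    rw [Fintype.card_fin] at h2
    omega
  obtain ⟨A, hA, hAS⟩ : ∃ A : Finset (Fin m), A.card = k ∧
      ((A ∩ S).card : ℤ) = max 0 ((S.card : ℤ) - ((m : ℤ) - k)) := by
    have hc : Sᶜ.card = m - S.card := by rw [Finset.card_compl, Fintype.card_fin]
    have hSm : S.card ≤ m := by simpa using Finset.card_le_univ S
    rcases le_total k (m - S.card) with h | h
    · obtain ⟨A, hA, hAk⟩ := Finset.exists_subset_card_eq (s := Sᶜ) (n := k) (by omega)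
      refine ⟨A, hAk, ?_⟩
      have : A ∩ S = ∅ := by
        rw [← Finset.disjoint_iff_inter_eq_empty]
        exact Finset.disjoint_left.2 fun i hi => Finset.mem_compl.1 (hA hi)
      rw [this, Finset.card_empty]; omega
    · obtain ⟨A, hA1, -, hAk⟩ := Finset.exists_subsuperset_card_eq (Finset.subset_univ Sᶜ)
        (n := k) (by omega) (by simpa using hk)
      refine ⟨A, hAk, ?_⟩
      have h1 := Finset.card_union_add_card_inter A S
      have h2 : A ∪ S = Finset.univ := by
        rw [Finset.eq_univ_iff_forall]
        intro i
        by_cases hi : i ∈ S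
        · exact Finset.mem_union_right _ hi
        · exact Finset.mem_union_left _ (hA1 (Finset.mem_compl.2 hi))
      rw [h2, Finset.card_univ, Fintype.card_fin] at h1
      omega
  have hne : Nonempty {A : Finset (Fin m) // A.card = k} := ⟨⟨A, hA⟩⟩
  refine le_antisymm ?_ (le_ciInf fun A => hle A.1 A.2)
  refine (ciInf_le ⟨max 0 ((S.card : ℤ) - ((m : ℤ) - k)), ?_⟩ ⟨A, hA⟩).trans ?_
  · rintro _ ⟨A', rfl⟩
    exact hle A'.1 A'.2
  · rw [hsum, hAS]

/-- The coefficients of `γ_k` extend by zero to the empty and the full set once the multiple of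
`star 0` that comes from the translation of the hypersimplex is added to `hsFun k`. -/
theorem chowToAnn_gamma (hE : M.E = Set.univ) (hloop : M.Loopless) {k : ℕ} (hk : k ≤ n + 1) :
    chowToAnn hE hloop (gamma M k) = hsClass M k := by
  classical
  set w : Finset (Fin (n + 1)) → ℝ := hsFun k + ((n + 1 - k : ℕ) : ℝ) • star 0 with hw
  have h0 : w ∅ = 0 := by
    simp only [hw, Pi.add_apply, Pi.smul_apply]
    rw [hsFun_of_le (by simp), star_eq_zero (by simp)]; simp
  have h1 : w Finset.univ = 0 := by
    simp only [hw, Pi.add_apply, Pi.smul_apply]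
    rw [hsFun_of_ge (by simpa using by exact_mod_cast hk), star_eq_one (by simp)]
    rw [Nat.cast_sub hk]; simp
  have h2 : Ideal.Quotient.mk (ann (matroidVol M)) (lin w) = hsClass M k := by
    have h3 : Ideal.Quotient.mk (ann (matroidVol M)) (lin (star 0)) = 0 :=
      Ideal.Quotient.eq_zero_iff_mem.2 (lin_mem_ann ((volSpec_matroid hE hloop).star 0))
    rw [hw, lin_add, lin_smul, map_add, map_mul, h3, mul_zero, add_zero, hsClass]
  rw [← h2, ← sum_flats_eq_lin hE hloop w h0 h1, gamma, alpha, divisorClass, map_neg, map_sum,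
    map_sum, ← Finset.sum_neg_distrib]
  refine Finset.sum_congr rfl fun F _ => ?_
  rw [map_zsmul, chowToAnn_flatClass, phiMin_indicator (by omega) F.1 F.fin F.coe_fin, map_mul]
  have h4 : (Set.indicator F.1 (1 : Fin (n + 1) → ℤ) 0 : ℤ) =
      if (0 : Fin (n + 1)) ∈ F.fin then 1 else 0 := by
    simp [Set.indicator_apply, ProperFlat.mem_fin]
  rw [h4, ← neg_smul, zsmul_eq_mul]
  congr 1
  have h5 : w F.fin = ((-(max 0 ((F.fin.card : ℤ) - (((n + 1 : ℕ) : ℤ) - (n + 1 - k : ℕ))) -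
      ((n + 1 - k : ℕ) : ℤ) * if (0 : Fin (n + 1)) ∈ F.fin then 1 else 0) : ℤ) : ℝ) := by
    have e : ((n + 1 : ℕ) : ℤ) - (n + 1 - k : ℕ) = k := by omega
    rw [e]
    simp only [hw, Pi.add_apply, Pi.smul_apply, hsFun, star, smul_eq_mul]
    split_ifs <;> push_cast <;> ring
  have h6 : ∀ z : ℤ, Ideal.Quotient.mk (ann (matroidVol M)) (C (z : ℝ)) = z := fun z => by
    rw [show (C (z : ℝ) : MvPolynomial (Finset (Fin (n + 1))) ℝ) = z from map_intCast C z,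
      map_intCast]
  rw [h5, h6]

/-- The degree of a monomial in the classes `γ_k`, through the hypersimplex classes. -/
theorem degree_gammaMonomial {r k : ℕ} (hE : M.E = Set.univ) (hloop : M.Loopless)
    (hr : M.eRank = ((r + 1 : ℕ) : ℕ∞)) (a : Fin k → ℕ) (ha : ∑ j, a j = r) (i : ℕ)
    (hi : k + i ≤ n + 1) :
    ((degree M r (gammaMonomial M a ha i) : ℤ) : ℝ) =
      pairQ (matroidVol M) (∏ j : Fin k, hsClass M ((1 + i : ℤ) + (j : ℕ)) ^ a j) := by
  rw [degree_eq hE hloop hr, chowFunctional_apply, gammaMonomial, map_prod]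
  congr 1
  refine Finset.prod_congr rfl fun j _ => ?_
  rw [map_pow, chowToAnn_gamma hE hloop (by have := j.2; omega)]
  congr 2
  push_cast; ring

/-! ### A recursion for the degrees of windows -/

variable (n) in
/-- The linear form of the `k`-th hypersimplex. -/
def hsLin (k : ℤ) : MvPolynomial (Finset (Fin (n + 1))) ℝ := lin (hsFun k)

variable (M) in
/-- The degree of a product of `l` consecutive hypersimplex classes, starting with the `s`-th, on
the interval `[A, B]`. -/
def windowDeg (A B : Finset (Fin (n + 1))) (s : ℤ) (l : ℕ) : ℝ :=
  pair (volPoly M A B) (window (hsLin n) s l)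

theorem pair_hsLin_mul (V : MvPolynomial (Finset (Fin (n + 1))) ℝ) (k : ℤ)
    (p : MvPolynomial (Finset (Fin (n + 1))) ℝ) :
    pair V (hsLin n k * p) = pair (dirD (hsFun k) V) p := pair_lin_mul _ _ _

theorem pair_mul_window (P Q : MvPolynomial (Finset (Fin (n + 1))) ℝ) (s : ℤ) (l : ℕ)
    (h : ∀ t < l, dirD (hsFun (s + t)) P = 0) :
    pair (P * Q) (window (hsLin n) s l) = coeff 0 P * pair Q (window (hsLin n) s l) := by
  induction l generalizing Q with
  | zero =>
    simp only [window, Finset.range_zero, Finset.prod_empty, pair_one]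
    exact map_mul (constantCoeff) P Q
  | succ l ih =>
    rw [window_succ_right, mul_comm (window _ _ _), pair_hsLin_mul, pair_hsLin_mul, dirD_mul,
      h l (Nat.lt_succ_self l), zero_mul, zero_add, ih _ fun t ht => h t (by omega)]

theorem coeff_zero_volPoly (hE : M.E = Set.univ) (hA : Flat M A) (hB : Flat M B) (hAB : A ⊂ B) :
    coeff 0 (volPoly M A B) = if frk M B = frk M A + 1 then 1 else 0 := by
  split_ifs with h
  · rw [volPoly_of_le h.le]; simp
  · have h1 := hA.frk_lt hE hAB
    refine (volSpec hE hA hB hAB).hom.coeff_eq_zero ?_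
    simp; omega

/-- The recursion that results from expanding the last class of a window as a combination of the
classes of flats.  A flat `G` contributes only if all other classes of the window live on one of
the two sides of `G`, the other side being of rank one. -/
theorem windowDeg_recursion (hE : M.E = Set.univ) (hA : Flat M A) (hB : Flat M B) (hAB : A ⊂ B)
    (j l : ℕ) (hl : A.card + (j + l + 1) ≤ B.card) :
    ((B.card : ℝ) - A.card) * windowDeg M A B (A.card + 1 + j) (l + 1) =
      ∑ G ∈ between M A B,
        ((if frk M G = frk M A + 1 ∧ G.card ≤ A.card + j then
          ((B.card : ℝ) - A.card - (j + l + 1)) * ((G.card : ℝ) - A.card) *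
            windowDeg M G B (A.card + 1 + j) l else 0) +
        (if frk M B = frk M G + 1 ∧ A.card + (j + l + 1) ≤ G.card then
          ((j : ℝ) + l + 1) * ((B.card : ℝ) - G.card) *
            windowDeg M A G (A.card + 1 + j) l else 0)) := by
  set N : ℝ := (B.card : ℝ) - A.card with hN
  -- `w` differs from `N • hsFun m` by an affine function of the cardinality, chosen so that `w`
  -- vanishes at both ends of the interval.
  set m : ℤ := A.card + 1 + j + l with hm
  set w : Finset (Fin (n + 1)) → ℝ :=
    N • hsFun m + fun G => (N - (j + l + 1)) * (G.card : ℝ) + (-(N - (j + l + 1)) * A.card) with hw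
  have hlow : ∀ G : Finset (Fin (n + 1)), G.card ≤ A.card + (j + l + 1) →
      w G = (N - (j + l + 1)) * ((G.card : ℝ) - A.card) := by
    intro G hG
    simp only [hw, Pi.add_apply, Pi.smul_apply]
    rw [hsFun_of_le (by omega), smul_zero]; ring
  have hhigh : ∀ G : Finset (Fin (n + 1)), A.card + (j + l + 1) ≤ G.card →
      w G = ((j : ℝ) + l + 1) * ((B.card : ℝ) - G.card) := by
    intro G hG
    simp only [hw, Pi.add_apply, Pi.smul_apply]
    rw [hsFun_of_ge (by omega), smul_eq_mul, hm, hN]; push_cast; ring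
  have hwA : w A = 0 := by rw [hlow A (by omega)]; ring
  have hwB : w B = 0 := by rw [hhigh B hl]; ring
  have hspec := volSpec hE hA hB hAB
  have h1 : C N * dirD (hsFun m) (volPoly M A B) =
      ∑ G ∈ between M A B, C (w G) * (volPoly M A G * volPoly M G B) := by
    rw [← hspec.dirD_eq_sum hwA hwB, hw, dirD_add, dirD_smul, hspec.dirD_affine, add_zero]
  rw [windowDeg, window_succ_right, mul_comm (window _ _ _), pair_hsLin_mul, ← pair_C_mul, h1,
    pair_sum]
  refine Finset.sum_congr rfl fun G hG => ?_
  rw [pair_C_mul]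
  obtain ⟨hGf, hAG, hGB⟩ := mem_between.1 hG
  -- For `|G| ≤ |A| + j` the remaining window acts on the upper link only, for
  -- `|A| + j + l + 1 ≤ |G|` on the lower link only; in between it contains the index `|G|`.
  rcases le_or_gt G.card (A.card + j) with h2 | h2
  · rw [pair_mul_window _ _ _ _ fun t ht => (volSpec_left hE hA hG).dirD_hsFun_of_ge (by omega),
      coeff_zero_volPoly hE hA hGf hAG, hlow G (by omega),
      if_neg (show ¬ (frk M B = frk M G + 1 ∧ A.card + (j + l + 1) ≤ G.card) by omega), add_zero]
    by_cases h3 : frk M G = frk M A + 1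
    · rw [if_pos h3, if_pos ⟨h3, h2⟩, windowDeg]; ring
    · rw [if_neg h3, if_neg fun h => h3 h.1]; ring
  rcases le_or_gt (A.card + (j + l + 1)) G.card with h3 | h3
  · rw [mul_comm (volPoly M A G), pair_mul_window _ _ _ _ fun t ht =>
        (volSpec_right hE hB hG).dirD_hsFun_of_le (by omega),
      coeff_zero_volPoly hE hGf hB hGB, hhigh G h3,
      if_neg (show ¬ (frk M G = frk M A + 1 ∧ G.card ≤ A.card + j) by omega), zero_add]
    by_cases h4 : frk M B = frk M G + 1
    · rw [if_pos h4, if_pos ⟨h4, h3⟩, windowDeg]; ring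
    · rw [if_neg h4, if_neg fun h => h4 h.1]; ring
  · rw [if_neg (by omega), if_neg (by omega), add_zero]
    obtain ⟨t, ht⟩ : ∃ t : ℕ, G.card = A.card + 1 + j + t := ⟨G.card - (A.card + 1 + j), by omega⟩
    obtain ⟨q, hq⟩ := dvd_window (hsLin n) (A.card + 1 + j) (l := l) (j := t) (by omega)
    have e : (A.card : ℤ) + 1 + j + t = G.card := by omega
    rw [hq, e, pair_hsLin_mul, dirD_hsFun_prod hE hA hB hG, pair_zero, mul_zero]

end Spec

end

section

variable {n : ℕ}

open Polynomial

/-! ### The Tutte polynomial on the line `x = 1` -/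

section Tutte

variable {M : Matroid (Fin (n + 1))} {A B : Finset (Fin (n + 1))}

open Classical in
/-- The spanning sets of the interval `[A, B]` of flats: the sets that contain `A` and have
closure `B`. -/
def spanningSets (M : Matroid (Fin (n + 1))) (A B : Finset (Fin (n + 1))) :
    Finset (Finset (Fin (n + 1))) :=
  Finset.univ.filter fun S => A ⊆ S ∧ cl M S = B

theorem mem_spanningSets {S : Finset (Fin (n + 1))} :
    S ∈ spanningSets M A B ↔ A ⊆ S ∧ cl M S = B := by simp [spanningSets]

/-- The value at `x = 1` of the Tutte polynomial of the minor `M|B/A`. -/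
def intervalTutte (M : Matroid (Fin (n + 1))) (A B : Finset (Fin (n + 1))) : ℝ[X] :=
  ∑ S ∈ spanningSets M A B, (X - 1) ^ (S.card - A.card - (frk M B - frk M A))

/-- The sum that defines the Tutte polynomial, with the spanning sets weighted by their numbers of
elements outside `A`. -/
def weightedTutte (M : Matroid (Fin (n + 1))) (A B : Finset (Fin (n + 1))) : ℝ[X] :=
  ∑ S ∈ spanningSets M A B,
    C ((S.card : ℝ) - A.card) * (X - 1) ^ (S.card - A.card - (frk M B - frk M A))

theorem subset_of_mem_spanningSets (hE : M.E = Set.univ) {S : Finset (Fin (n + 1))}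
    (hS : S ∈ spanningSets M A B) : S ⊆ B := (mem_spanningSets.1 hS).2 ▸ subset_cl hE S

theorem rank_le_of_mem_spanningSets {S : Finset (Fin (n + 1))} (hS : S ∈ spanningSets M A B) :
    frk M B - frk M A ≤ S.card - A.card := by
  obtain ⟨h1, h2⟩ := mem_spanningSets.1 hS
  have h3 := frk_le_add_card (M := M) h1
  rw [← frk_cl M S, h2] at h3
  omega

theorem weightedTutte_eq :
    weightedTutte M A B = C ((frk M B - frk M A : ℕ) : ℝ) * intervalTutte M A B +
      (X - 1) * derivative (intervalTutte M A B) := by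
  rw [weightedTutte, intervalTutte, derivative_sum, Finset.mul_sum, Finset.mul_sum,
    ← Finset.sum_add_distrib]
  refine Finset.sum_congr rfl fun S hS => ?_
  have h1 := rank_le_of_mem_spanningSets hS
  have h2 := Finset.card_le_card (mem_spanningSets.1 hS).1
  obtain ⟨k, hk⟩ : ∃ k, S.card - A.card - (frk M B - frk M A) = k := ⟨_, rfl⟩
  have h3 : (S.card : ℝ) - A.card = ((frk M B - frk M A : ℕ) : ℝ) + k := by
    rw [← Nat.cast_sub h2, ← Nat.cast_add]; congr 1; omega
  rw [hk, h3]
  cases k with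
  | zero => simp
  | succ k =>
    rw [derivative_pow_succ, C_add]
    simp only [derivative_sub, derivative_X, derivative_one, sub_zero, mul_one]
    push_cast
    simp only [C_add, C_1, map_natCast]
    ring

theorem sdiff_union_inter_eq {α : Type} [DecidableEq α] {S G I : Finset α} (hS : I ⊆ S) :
    (S ∪ G) \ G ∪ I ∪ S ∩ (G \ I) = S := by grind

theorem sdiff_union_union_eq {α : Type} [DecidableEq α] {S G I T : Finset α} (hS : G ⊆ S)
    (hI : I ⊆ G) (hT : T ⊆ G \ I) : S \ G ∪ I ∪ T ∪ G = S := by grind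

theorem sdiff_union_inter_sdiff_eq {α : Type} [DecidableEq α] {S G I T : Finset α}
    (hT : T ⊆ G \ I) : (S \ G ∪ I ∪ T) ∩ (G \ I) = T := by grind

/-- The sum over the spanning sets that contain the element `e`, in terms of the contraction of
`e`: each element of the closure of `A ∪ {e}`, other than `e` and those of `A`, is a loop of the
contraction and contributes a factor `X`. -/
theorem sum_spanningSets_mem (hE : M.E = Set.univ) (hA : Flat M A)
    {G : Finset (Fin (n + 1))} (hG : Flat M G) (hAG : A ⊆ G) (hGr : frk M G = frk M A + 1)
    (hGB : G ⊆ B) {e : Fin (n + 1)} (heG : e ∈ G) (heA : e ∉ A) :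
    ∑ S ∈ (spanningSets M A B).filter (fun S => e ∈ S),
      ((X : ℝ[X]) - 1) ^ (S.card - A.card - (frk M B - frk M A)) =
      X ^ (G.card - A.card - 1) * intervalTutte M G B := by
  have hGcl := hA.eq_cl_insert hE hG hAG hGr heG heA
  have hIG : insert e A ⊆ G := Finset.insert_subset heG hAG
  have hIc : (insert e A).card = A.card + 1 := Finset.card_insert_of_notMem heA
  have hDc : (G \ insert e A).card = G.card - A.card - 1 := by
    rw [Finset.card_sdiff_of_subset hIG, hIc]; omega
  have hpow : (X : ℝ[X]) ^ (G.card - A.card - 1) =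
      ∑ T ∈ (G \ insert e A).powerset, ((X : ℝ[X]) - 1) ^ T.card := by
    -- the binomial formula for `((X - 1) + 1) ^ |G \ (A ∪ {e})|`
    have := Finset.sum_pow_mul_eq_add_pow ((X : ℝ[X]) - 1) 1 (G \ insert e A)
    simp only [one_pow, mul_one, sub_add_cancel] at this
    rw [this, hDc]
  have hclB : ∀ S : Finset (Fin (n + 1)), insert e A ⊆ S → cl M S = cl M (S ∪ G) := by
    intro S hS
    refine le_antisymm (cl_mono Finset.subset_union_left) ((flat_cl M S).cl_subset ?_)
    refine Finset.union_subset (subset_cl hE S) ?_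
    rw [hGcl]; exact cl_mono hS
  rw [hpow, intervalTutte, mul_comm, Finset.sum_mul_sum, ← Finset.sum_product']
  refine Finset.sum_bij' (fun S _ => (S ∪ G, S ∩ (G \ insert e A)))
    (fun p _ => (p.1 \ G) ∪ insert e A ∪ p.2) ?_ ?_ ?_ ?_ ?_
  · intro S hS
    obtain ⟨h1, heS⟩ := Finset.mem_filter.1 hS
    obtain ⟨hAS, hSB⟩ := mem_spanningSets.1 h1
    refine Finset.mem_product.2 ⟨mem_spanningSets.2 ⟨Finset.subset_union_right, ?_⟩,
      Finset.mem_powerset.2 Finset.inter_subset_right⟩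
    rw [← hclB S (Finset.insert_subset heS hAS), hSB]
  · rintro ⟨S, T⟩ hp
    obtain ⟨h1, h2⟩ := Finset.mem_product.1 hp
    obtain ⟨hGS, hSB⟩ := mem_spanningSets.1 h1
    have hT := Finset.mem_powerset.1 h2
    simp only at hGS hSB hT ⊢
    have hsub : insert e A ⊆ S \ G ∪ insert e A ∪ T :=
      Finset.subset_union_right.trans Finset.subset_union_left
    refine Finset.mem_filter.2 ⟨mem_spanningSets.2 ⟨(Finset.subset_insert e A).trans hsub, ?_⟩,
      hsub (Finset.mem_insert_self e A)⟩
    rw [hclB _ hsub, ← hSB]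
    rw [sdiff_union_union_eq hGS hIG hT]
  · intro S hS
    obtain ⟨h1, heS⟩ := Finset.mem_filter.1 hS
    exact sdiff_union_inter_eq (Finset.insert_subset heS (mem_spanningSets.1 h1).1)
  · rintro ⟨S, T⟩ hp
    obtain ⟨h1, h2⟩ := Finset.mem_product.1 hp
    have hT := Finset.mem_powerset.1 h2
    exact Prod.ext (sdiff_union_union_eq (mem_spanningSets.1 h1).1 hIG hT)
      (sdiff_union_inter_sdiff_eq hT)
  · intro S hS
    obtain ⟨h1, heS⟩ := Finset.mem_filter.1 hS
    obtain ⟨hAS, hSB⟩ := mem_spanningSets.1 h1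
    have hIS := Finset.insert_subset heS hAS
    simp only
    rw [← pow_add]
    congr 1
    have e1 : S ∩ (G \ insert e A) = (S ∩ G) \ insert e A := by
      rw [Finset.inter_sdiff_assoc]
    have e2 := Finset.card_union_add_card_inter S G
    have e3 : (S ∩ (G \ insert e A)).card + (A.card + 1) = (S ∩ G).card := by
      rw [e1, Finset.card_sdiff_of_subset (Finset.subset_inter hIS hIG), hIc]
      have := Finset.card_le_card (Finset.subset_inter hIS hIG)
      omega
    have e4 := rank_le_of_mem_spanningSets (M := M) (A := G) (B := B) (S := S ∪ G)
      (mem_spanningSets.2 ⟨Finset.subset_union_right, by rw [← hclB S hIS, hSB]⟩)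
    have e5 := Finset.card_le_card (Finset.subset_union_right : G ⊆ S ∪ G)
    have e6 : frk M G ≤ frk M B := frk_mono hGB
    omega

/-- The flats covering `A` in the interval `[A, B]`. -/
def atoms (M : Matroid (Fin (n + 1))) (A B : Finset (Fin (n + 1))) :
    Finset (Finset (Fin (n + 1))) :=
  (between M A B).filter fun G => frk M G = frk M A + 1

/-- The flats covered by `B` in the interval `[A, B]`. -/
def coatoms (M : Matroid (Fin (n + 1))) (A B : Finset (Fin (n + 1))) :
    Finset (Finset (Fin (n + 1))) :=
  (between M A B).filter fun G => frk M B = frk M G + 1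

theorem sum_mem_eq_weightedTutte (hE : M.E = Set.univ) :
    ∑ e ∈ B \ A, ∑ S ∈ (spanningSets M A B).filter (fun S => e ∈ S),
      ((X : ℝ[X]) - 1) ^ (S.card - A.card - (frk M B - frk M A)) = weightedTutte M A B := by
  simp only [Finset.sum_filter]
  rw [Finset.sum_comm, weightedTutte]
  refine Finset.sum_congr rfl fun S hS => ?_
  have h1 := (mem_spanningSets.1 hS).1
  have h2 := subset_of_mem_spanningSets hE hS
  rw [← sum_star_of_subset h1 h2, map_sum, Finset.sum_mul]
  refine Finset.sum_congr rfl fun e _ => ?_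
  by_cases he : e ∈ S
  · rw [if_pos he, star_eq_one he]; simp
  · rw [if_neg he, star_eq_zero he]; simp

/-- The atoms contribute, for each `e ∈ B \ A`, the spanning sets containing `e`. -/
theorem sum_atoms (hE : M.E = Set.univ) (hA : Flat M A) (hB : Flat M B) (hAB : A ⊆ B)
    (hr : frk M A + 1 < frk M B) :
    ∑ G ∈ atoms M A B, C ((G.card : ℝ) - A.card) *
      (X ^ (G.card - A.card) * intervalTutte M G B) = X * weightedTutte M A B := by
  have h1 : ∀ G ∈ atoms M A B, C ((G.card : ℝ) - A.card) *
      (X ^ (G.card - A.card) * intervalTutte M G B) = ∑ e ∈ B \ A,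
        C (star e G) * (X ^ (G.card - A.card) * intervalTutte M G B) := by
    intro G hG
    obtain ⟨-, hAG, hGB⟩ := mem_between.1 (Finset.mem_filter.1 hG).1
    rw [← sum_star_of_subset hAG.subset hGB.subset, map_sum, Finset.sum_mul]
  rw [Finset.sum_congr rfl h1, Finset.sum_comm, ← sum_mem_eq_weightedTutte hE, Finset.mul_sum]
  refine Finset.sum_congr rfl fun e he => ?_
  rw [Finset.mem_sdiff] at he
  have hecl : e ∉ cl M A := by rw [hA.cl_eq]; exact he.2
  set G := cl M (insert e A) with hG
  have hGf : Flat M G := flat_cl _ _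
  have hGr : frk M G = frk M A + 1 := by rw [hG, frk_cl, frk_insert hE hecl]
  have heG : e ∈ G := subset_cl hE _ (Finset.mem_insert_self _ _)
  have hAG : A ⊆ G := (Finset.subset_insert _ _).trans (subset_cl hE _)
  have hGB : G ⊆ B := hB.cl_subset (Finset.insert_subset he.1 hAB)
  have hAG' : A ⊂ G := lt_of_le_of_ne hAG fun h => he.2 (h ▸ heG)
  have hmem : G ∈ atoms M A B := by
    refine Finset.mem_filter.2 ⟨mem_between.2 ⟨hGf, hAG', ?_⟩, hGr⟩
    exact lt_of_le_of_ne hGB fun h => by rw [h] at hGr; omega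
  rw [sum_spanningSets_mem hE hA hGf hAG hGr hGB heG he.2,
    Finset.sum_eq_single_of_mem G hmem]
  · have := Finset.card_lt_card hAG'
    obtain ⟨k, hk⟩ : ∃ k, G.card - A.card = k + 1 := ⟨G.card - A.card - 1, by omega⟩
    rw [star_eq_one heG, hk, Nat.add_sub_cancel, C_1, pow_succ]; ring
  · intro G' hG' hne
    obtain ⟨h2, h3⟩ := Finset.mem_filter.1 hG'
    obtain ⟨hf, hAG', -⟩ := mem_between.1 h2
    rw [star_eq_zero, C_0, zero_mul]
    exact fun h => hne (hA.eq_cl_insert hE hf hAG'.subset h3 h he.2)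

/-- The sum over the sets whose closure is covered by `B` and does not contain `e`, that is, over
the sets which are not spanning but become so when `e` is added. -/
theorem sum_coatoms_notMem (hE : M.E = Set.univ) (hB : Flat M B)
    (hr : frk M A + 1 < frk M B) {e : Fin (n + 1)} (heB : e ∈ B) (heA : e ∉ A) :
    ∑ G ∈ (coatoms M A B).filter (fun G => e ∉ G), intervalTutte M A G =
      ∑ S ∈ (spanningSets M A B).filter (fun S => e ∈ S),
        ((X : ℝ[X]) - 1) ^ (S.card - A.card - (frk M B - frk M A)) -
      (X - 1) * ∑ S ∈ (spanningSets M A B).filter (fun S => e ∉ S),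
        ((X : ℝ[X]) - 1) ^ (S.card - A.card - (frk M B - frk M A)) := by
  classical
  -- The sets which span after `e` is added: removing `e` identifies them with the spanning sets
  -- that contain `e`, and they either span already or have a coatom as their closure.
  set U : Finset (Finset (Fin (n + 1))) :=
    Finset.univ.filter fun S => A ⊆ S ∧ e ∉ S ∧ cl M (insert e S) = B with hU
  have hUsum : ∑ S ∈ U, ((X : ℝ[X]) - 1) ^ (S.card - A.card - (frk M B - frk M A - 1)) =
      ∑ S ∈ (spanningSets M A B).filter (fun S => e ∈ S),
        ((X : ℝ[X]) - 1) ^ (S.card - A.card - (frk M B - frk M A)) := by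
    refine Finset.sum_bij' (fun S _ => insert e S) (fun S _ => S.erase e) ?_ ?_ ?_ ?_ ?_
    · intro S hS
      obtain ⟨-, h1, h2, h3⟩ := Finset.mem_filter.1 hS
      exact Finset.mem_filter.2 ⟨mem_spanningSets.2 ⟨h1.trans (Finset.subset_insert _ _), h3⟩,
        Finset.mem_insert_self _ _⟩
    · intro S hS
      obtain ⟨h1, h2⟩ := Finset.mem_filter.1 hS
      obtain ⟨h3, h4⟩ := mem_spanningSets.1 h1
      refine Finset.mem_filter.2 ⟨Finset.mem_univ _, fun i hi => ?_, Finset.notMem_erase e S, ?_⟩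
      · exact Finset.mem_erase.2 ⟨fun h => heA (h ▸ hi), h3 hi⟩
      · rw [Finset.insert_erase h2, h4]
    · intro S hS
      obtain ⟨-, h1, h2, h3⟩ := Finset.mem_filter.1 hS
      exact Finset.erase_insert h2
    · intro S hS
      exact Finset.insert_erase (Finset.mem_filter.1 hS).2
    · intro S hS
      obtain ⟨-, h1, h2, h3⟩ := Finset.mem_filter.1 hS
      rw [Finset.card_insert_of_notMem h2]
      have := Finset.card_le_card h1
      congr 1; omega
  have hVsum : (X - 1) * ∑ S ∈ (spanningSets M A B).filter (fun S => e ∉ S),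
        ((X : ℝ[X]) - 1) ^ (S.card - A.card - (frk M B - frk M A)) =
      ∑ S ∈ U.filter (fun S => cl M S = B),
        ((X : ℝ[X]) - 1) ^ (S.card - A.card - (frk M B - frk M A - 1)) := by
    have hset : (spanningSets M A B).filter (fun S => e ∉ S) = U.filter (fun S => cl M S = B) := by
      ext S
      simp only [Finset.mem_filter, mem_spanningSets, hU, Finset.mem_univ, true_and]
      constructor
      · rintro ⟨⟨h1, h2⟩, h3⟩
        refine ⟨⟨h1, h3, le_antisymm ?_ ?_⟩, h2⟩
        · exact hB.cl_subset (Finset.insert_subset heB (h2 ▸ subset_cl hE S))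
        · rw [← h2]; exact cl_mono (Finset.subset_insert _ _)
      · rintro ⟨⟨h1, h3, -⟩, h2⟩
        exact ⟨⟨h1, h2⟩, h3⟩
    rw [hset, Finset.mul_sum]
    refine Finset.sum_congr rfl fun S hS => ?_
    have h1 : S ∈ spanningSets M A B := by
      rw [← hset] at hS; exact (Finset.mem_filter.1 hS).1
    have h2 := rank_le_of_mem_spanningSets h1
    rw [← pow_succ']
    congr 1; omega
  rw [← hUsum, hVsum, ← Finset.sum_filter_add_sum_filter_not U (fun S => cl M S = B),
    add_sub_cancel_left]
  have hmaps : ∀ S ∈ U.filter (fun S => ¬ cl M S = B),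
      cl M S ∈ (coatoms M A B).filter (fun G => e ∉ G) := by
    intro S hS
    obtain ⟨h1, h2⟩ := Finset.mem_filter.1 hS
    obtain ⟨-, h3, h4, h5⟩ := Finset.mem_filter.1 h1
    have he : e ∉ cl M S := by
      intro he
      apply h2
      rw [← h5]
      refine le_antisymm (cl_mono (Finset.subset_insert _ _)) ((flat_cl M S).cl_subset ?_)
      exact Finset.insert_subset he (subset_cl hE S)
    have hrk : frk M B = frk M (cl M S) + 1 := by
      rw [← h5, frk_cl, frk_cl, frk_insert hE he]
    have hAS : A ⊆ cl M S := h3.trans (subset_cl hE S)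
    refine Finset.mem_filter.2 ⟨Finset.mem_filter.2 ⟨mem_between.2 ⟨flat_cl _ _, ?_, ?_⟩, hrk⟩, he⟩
    · exact lt_of_le_of_ne hAS fun h => by rw [← h] at hrk; omega
    · refine lt_of_le_of_ne ?_ h2
      rw [← h5]; exact cl_mono (Finset.subset_insert _ _)
  rw [← Finset.sum_fiberwise_of_maps_to hmaps]
  refine Finset.sum_congr rfl fun G hG => ?_
  obtain ⟨h1, heG⟩ := Finset.mem_filter.1 hG
  obtain ⟨h2, hrk⟩ := Finset.mem_filter.1 h1
  obtain ⟨hGf, hAG, hGB⟩ := mem_between.1 h2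
  rw [intervalTutte]
  refine Finset.sum_congr ?_ fun S _ => ?_
  · ext S
    simp only [Finset.mem_filter, mem_spanningSets, hU, Finset.mem_univ, true_and]
    constructor
    · rintro ⟨h3, h4⟩
      have he : e ∉ cl M S := h4 ▸ heG
      have hSG : S ⊆ G := h4 ▸ subset_cl hE S
      refine ⟨⟨⟨h3, fun h => heG (hSG h), ?_⟩, ?_⟩, h4⟩
      · rw [cl_eq_cl (Finset.insert_subset heB (hSG.trans hGB.subset)), hB.cl_eq]
        rw [frk_insert hE he, ← frk_cl M S, h4, hrk]
      · rw [h4]; exact hGB.ne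
    · rintro ⟨⟨⟨h3, -, -⟩, -⟩, h4⟩
      exact ⟨h3, h4⟩
  · congr 1; omega

/-- The coatoms contribute, for each `e ∈ B \ A`, the sets that do not span but become spanning when
`e` is added. -/
theorem sum_coatoms (hE : M.E = Set.univ) (hB : Flat M B) (hAB : A ⊆ B)
    (hr : frk M A + 1 < frk M B) :
    ∑ G ∈ coatoms M A B, C ((B.card : ℝ) - G.card) * intervalTutte M A G =
      X * weightedTutte M A B -
        C ((B.card : ℝ) - A.card) * ((X - 1) * intervalTutte M A B) := by
  classical
  have h1 : ∀ G ∈ coatoms M A B, C ((B.card : ℝ) - G.card) * intervalTutte M A G =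
      ∑ e ∈ B \ A, if e ∉ G then intervalTutte M A G else 0 := by
    intro G hG
    obtain ⟨-, hAG, hGB⟩ := mem_between.1 (Finset.mem_filter.1 hG).1
    rw [← Finset.sum_filter, Finset.sum_const, nsmul_eq_mul]
    congr 1
    have h2 : (B \ A).filter (fun e => e ∉ G) = B \ G := by
      have := hAG.subset
      grind
    rw [h2, Finset.card_sdiff_of_subset hGB.subset,
      ← Nat.cast_sub (Finset.card_le_card hGB.subset), map_natCast]
  have h2 : ∀ e, ∑ S ∈ (spanningSets M A B).filter (fun S => e ∉ S),
        ((X : ℝ[X]) - 1) ^ (S.card - A.card - (frk M B - frk M A)) = intervalTutte M A B -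
      ∑ S ∈ (spanningSets M A B).filter (fun S => e ∈ S),
        ((X : ℝ[X]) - 1) ^ (S.card - A.card - (frk M B - frk M A)) := by
    intro e
    rw [intervalTutte, ← Finset.sum_filter_add_sum_filter_not (spanningSets M A B)
      (fun S => e ∈ S), add_sub_cancel_left]
  rw [Finset.sum_congr rfl h1, Finset.sum_comm]
  have h3 : ∀ e ∈ B \ A, ∑ G ∈ coatoms M A B, (if e ∉ G then intervalTutte M A G else 0) =
      X * ∑ S ∈ (spanningSets M A B).filter (fun S => e ∈ S),
        ((X : ℝ[X]) - 1) ^ (S.card - A.card - (frk M B - frk M A)) -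
          (X - 1) * intervalTutte M A B := by
    intro e he
    rw [Finset.mem_sdiff] at he
    rw [← Finset.sum_filter, sum_coatoms_notMem hE hB hr he.1 he.2, h2]
    ring
  rw [Finset.sum_congr rfl h3, Finset.sum_sub_distrib, ← Finset.mul_sum,
    sum_mem_eq_weightedTutte hE, Finset.sum_const, nsmul_eq_mul,
    Finset.card_sdiff_of_subset hAB, ← Nat.cast_sub (Finset.card_le_card hAB), map_natCast]

theorem natDegree_intervalTutte_le (hE : M.E = Set.univ) :
    (intervalTutte M A B).natDegree ≤ B.card - A.card - (frk M B - frk M A) := by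
  refine natDegree_sum_le_of_forall_le _ _ fun S hS => ?_
  have h1 := Finset.card_le_card (subset_of_mem_spanningSets hE hS)
  have h2 : ((X : ℝ[X]) - 1).natDegree = 1 := by
    rw [show (X : ℝ[X]) - 1 = X - C 1 by simp]; exact natDegree_X_sub_C 1
  refine natDegree_pow_le.trans ?_
  rw [h2]; omega

/-- For an interval of rank one, that is, a matroid of rank one without loops on `N` elements, the
polynomial is `1 + X + ⋯ + X^{N-1}`. -/
theorem intervalTutte_rank_one (hE : M.E = Set.univ) (hA : Flat M A) (hB : Flat M B)
    (hAB : A ⊆ B) (hr : frk M B = frk M A + 1) :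
    intervalTutte M A B = ∑ i ∈ Finset.range (B.card - A.card), X ^ i := by
  have hX : (X : ℝ[X]) - 1 ≠ 0 := by
    rw [show (X : ℝ[X]) - 1 = X - C 1 by simp]; exact X_sub_C_ne_zero 1
  refine mul_right_cancel₀ hX ?_
  rw [geom_sum_mul, eq_sub_iff_add_eq]
  have h1 := Finset.sum_pow_mul_eq_add_pow ((X : ℝ[X]) - 1) 1 (B \ A)
  simp only [one_pow, mul_one, sub_add_cancel] at h1
  rw [← Finset.card_sdiff_of_subset hAB, ← h1,
    ← Finset.sum_erase_add _ _ (Finset.empty_mem_powerset (B \ A)), Finset.card_empty, pow_zero]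
  congr 1
  rw [intervalTutte, Finset.sum_mul]
  refine Finset.sum_bij' (fun S _ => S \ A) (fun T _ => T ∪ A) ?_ ?_ ?_ ?_ ?_
  · intro S hS
    obtain ⟨h2, h3⟩ := mem_spanningSets.1 hS
    refine Finset.mem_erase.2 ⟨fun h => ?_, Finset.mem_powerset.2
      (Finset.sdiff_subset_sdiff (subset_of_mem_spanningSets hE hS) subset_rfl)⟩
    have h4 : S = A := le_antisymm (Finset.sdiff_eq_empty_iff_subset.1 h) h2
    rw [h4, hA.cl_eq] at h3
    rw [h3] at hr; omega
  · intro T hT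
    obtain ⟨h2, h3⟩ := Finset.mem_erase.1 hT
    have h4 := Finset.mem_powerset.1 h3
    have h5 : T ∪ A ⊆ B := Finset.union_subset (h4.trans Finset.sdiff_subset) hAB
    refine mem_spanningSets.2 ⟨Finset.subset_union_right, ?_⟩
    rw [cl_eq_cl h5, hB.cl_eq]
    have h6 : A ⊂ T ∪ A := by
      obtain ⟨i, hi⟩ := Finset.nonempty_iff_ne_empty.2 h2
      exact Finset.ssubset_iff_subset_ne.2 ⟨Finset.subset_union_right, fun h =>
        (Finset.mem_sdiff.1 (h4 hi)).2 (h ▸ Finset.mem_union_left _ hi)⟩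
    have := hA.frk_lt hE h6
    omega
  · intro S hS
    exact Finset.sdiff_union_of_subset (mem_spanningSets.1 hS).1
  · intro T hT
    have h4 := Finset.mem_powerset.1 (Finset.mem_erase.1 hT).2
    exact Finset.union_sdiff_cancel_right
      (Finset.disjoint_left.2 fun i hi => (Finset.mem_sdiff.1 (h4 hi)).2)
  · intro S hS
    have h2 := (mem_spanningSets.1 hS).1
    have h3 := rank_le_of_mem_spanningSets hS
    rw [← pow_succ, Finset.card_sdiff_of_subset h2]
    congr 1; omega

end Tutte

end

section

variable {n : ℕ}

open Polynomial

/-! ### The degrees of windows and the Tutte polynomial -/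

section Tutte

variable {M : Matroid (Fin (n + 1))} {A B : Finset (Fin (n + 1))}

/-- The degrees of windows of hypersimplex classes are multiples of the coefficients of the Tutte
polynomial at `x = 1`.  Both sides satisfy the same recursion over the atoms and coatoms of the
interval. -/
theorem windowDeg_eq (hE : M.E = Set.univ) (hA : Flat M A) (hB : Flat M B) (hAB : A ⊂ B)
    (l j : ℕ) (hr : frk M B = frk M A + l + 1) (hj : j + l + 1 ≤ B.card - A.card) :
    windowDeg M A B (A.card + 1 + j) l = l.factorial * (intervalTutte M A B).coeff j := by
  induction l generalizing A B j with
  | zero =>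
    rw [intervalTutte_rank_one hE hA hB hAB.subset (by omega), finsetSum_coeff]
    simp only [coeff_X_pow, Finset.sum_ite_eq, Finset.mem_range]
    rw [if_pos (by omega), windowDeg, window, volPoly_of_le (by omega)]
    simp [pair_one]
  | succ l ih =>
    have hcard := Finset.card_lt_card hAB
    have hN0 : (B.card : ℝ) - A.card ≠ 0 := by
      have : (A.card : ℝ) < B.card := by exact_mod_cast hcard
      linarith
    refine mul_left_cancel₀ hN0 ?_
    rw [windowDeg_recursion hE hA hB hAB j l (by omega), Finset.sum_add_distrib]
    set N : ℝ := (B.card : ℝ) - A.card with hN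
    have hat : ∀ G ∈ between M A B,
        (if frk M G = frk M A + 1 ∧ G.card ≤ A.card + j then
          (N - (j + l + 1)) * ((G.card : ℝ) - A.card) * windowDeg M G B (A.card + 1 + j) l else 0) =
        if frk M G = frk M A + 1 then (N - (j + l + 1)) * l.factorial *
          (C ((G.card : ℝ) - A.card) * (X ^ (G.card - A.card) * intervalTutte M G B)).coeff j
        else 0 := by
      intro G hG
      obtain ⟨hGf, hAG, hGB⟩ := mem_between.1 hG
      have h1 := Finset.card_lt_card hAG
      have h2 := Finset.card_lt_card hGB
      by_cases hGr : frk M G = frk M A + 1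
      · rw [if_pos hGr, coeff_C_mul, coeff_X_pow_mul']
        by_cases hGj : G.card ≤ A.card + j
        · rw [if_pos ⟨hGr, hGj⟩, if_pos (by omega)]
          have h3 := ih hGf hB hGB (j - (G.card - A.card)) (by omega) (by omega)
          have e : (G.card : ℤ) + 1 + (j - (G.card - A.card) : ℕ) = A.card + 1 + j := by omega
          rw [e] at h3
          rw [h3]; ring
        · rw [if_neg fun h => hGj h.2, if_neg (by omega)]; ring
      · rw [if_neg fun h => hGr h.1, if_neg hGr]
    have hco : ∀ G ∈ between M A B,
        (if frk M B = frk M G + 1 ∧ A.card + (j + l + 1) ≤ G.card then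
          ((j : ℝ) + l + 1) * ((B.card : ℝ) - G.card) * windowDeg M A G (A.card + 1 + j) l else 0) =
        if frk M B = frk M G + 1 then ((j : ℝ) + l + 1) * l.factorial *
          (C ((B.card : ℝ) - G.card) * intervalTutte M A G).coeff j else 0 := by
      intro G hG
      obtain ⟨hGf, hAG, hGB⟩ := mem_between.1 hG
      have h1 := Finset.card_lt_card hAG
      by_cases hGr : frk M B = frk M G + 1
      · rw [if_pos hGr, coeff_C_mul]
        by_cases hGj : A.card + (j + l + 1) ≤ G.card
        · rw [if_pos ⟨hGr, hGj⟩, ih hA hGf hAG j (by omega) (by omega)]; ring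
        · have h3 := natDegree_intervalTutte_le (M := M) (A := A) (B := G) hE
          rw [if_neg fun h => hGj h.2, coeff_eq_zero_of_natDegree_lt (lt_of_le_of_lt h3 ?_)]
          · ring
          · -- the degree of the polynomial is the nullity, which is less than `j`
            have h4 := frk_le_add_card (M := M) hAG.subset
            omega
      · rw [if_neg fun h => hGr h.1, if_neg hGr]
    have h1 := congrArg (fun p => coeff p j) (sum_atoms hE hA hB hAB.subset (by omega))
    have h2 := congrArg (fun p => coeff p j) (sum_coatoms (M := M) hE hB hAB.subset (by omega))
    simp only [finsetSum_coeff] at h1 h2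
    rw [Finset.sum_congr rfl hat, Finset.sum_congr rfl hco, ← Finset.sum_filter,
      ← Finset.sum_filter, ← Finset.mul_sum, ← Finset.mul_sum]
    rw [show ∑ G ∈ (between M A B).filter fun G => frk M G = frk M A + 1, _ = _ from h1,
      show ∑ G ∈ (between M A B).filter fun G => frk M B = frk M G + 1, _ = _ from h2,
      weightedTutte_eq, show frk M B - frk M A = l + 2 by omega, ← hN, Nat.factorial_succ]
    cases j with
    | zero =>
      simp only [coeff_sub, coeff_C_mul, coeff_X_mul_zero, sub_mul, one_mul]
      push_cast; ring
    | succ j =>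
      simp only [coeff_sub, coeff_add, coeff_C_mul, coeff_X_mul, sub_mul, one_mul, coeff_derivative]
      cases j with
      | zero =>
        simp only [coeff_X_mul_zero]
        push_cast; ring
      | succ j =>
        simp only [coeff_X_mul, coeff_derivative]
        push_cast; ring

theorem tutteOne_eq (hE : M.E = Set.univ) :
    (tutteOne M).map (Int.castRingHom ℝ) = intervalTutte M ∅ Finset.univ := by
  classical
  rw [tutteOne, tutte, map_sum, Polynomial.map_sum, intervalTutte, spanningSets,
    Finset.sum_filter]
  refine Finset.sum_congr rfl fun S _ => ?_
  have h1 : rk M M.E = frk M Finset.univ := by rw [frk, Finset.coe_univ, hE]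
  have h2 : rk M S = frk M S := rfl
  have h3 : frk M S ≤ frk M Finset.univ := frk_mono (Finset.subset_univ S)
  have h4 : cl M S = Finset.univ ↔ frk M S = frk M Finset.univ := by
    constructor
    · intro h; rw [← frk_cl M S, h]
    · intro h; rw [cl_eq_cl (Finset.subset_univ S) h.ge, (flat_univ hE).cl_eq]
  rw [h1, h2, map_mul, map_pow, map_pow, map_sub, map_sub, MvPolynomial.aeval_X,
    MvPolynomial.aeval_X, map_one]
  simp only [Matrix.cons_val_zero, Matrix.cons_val_one, sub_self]
  by_cases h : frk M S = frk M Finset.univ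
  · rw [if_pos ⟨Finset.empty_subset S, h4.2 h⟩, h, frk_empty]
    simp
  · rw [if_neg fun h' => h (h4.1 h'.2), zero_pow (by omega)]
    simp

theorem rank_le_card {r : ℕ} (hE : M.E = Set.univ) (hr : M.eRank = ((r + 1 : ℕ) : ℕ∞)) :
    r ≤ n := by
  have h1 := frk_le_add_card (M := M) (Finset.empty_subset Finset.univ)
  rw [frk_univ hE hr, frk_empty] at h1
  simp at h1
  omega

/-- The degrees of the windows of hypersimplex classes of a matroid. -/
theorem pairQ_window {r : ℕ} (hE : M.E = Set.univ) (hloop : M.Loopless)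
    (hr : M.eRank = ((r + 1 : ℕ) : ℕ∞)) (j : ℕ) (hj : j + r ≤ n) :
    pairQ (matroidVol M) (window (hsClass M) (1 + j) r) =
      r.factorial * ((tutteOne M).map (Int.castRingHom ℝ)).coeff j := by
  have h1 := windowDeg_eq hE (flat_empty hloop) (flat_univ hE)
    (Finset.empty_ssubset.2 Finset.univ_nonempty) r j
    (by rw [frk_univ hE hr, frk_empty]; omega) (by simp; omega)
  rw [tutteOne_eq hE, ← h1, windowDeg]
  have h2 : window (hsClass M) (1 + j) r =
      Ideal.Quotient.mk (ann (matroidVol M)) (window (hsLin n) (1 + j) r) := by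
    rw [window, window, map_prod]; rfl
  rw [h2, pairQ_mk, matroidVol]
  simp

theorem natDegree_tutteOne_le {r : ℕ} (hE : M.E = Set.univ)
    (hr : M.eRank = ((r + 1 : ℕ) : ℕ∞)) :
    ((tutteOne M).map (Int.castRingHom ℝ)).natDegree ≤ n - r := by
  rw [tutteOne_eq hE]
  refine (natDegree_intervalTutte_le hE).trans ?_
  rw [frk_univ hE hr, frk_empty]
  simp

end Tutte

end

section

open MvPolynomial

/-! ### Klyachko functionals -/

/-- A linear functional on polynomials in variables `X_k`, `k ∈ ℤ`, that vanishes on the ideal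
generated by Klyachko's relations and by the variables with index outside `1, …, N`. -/
structure IsKlyachko (N : ℕ) (L : MvPolynomial ℤ ℝ →ₗ[ℝ] ℝ) : Prop where
  out : ∀ k : ℤ, k ≤ 0 ∨ (N : ℤ) + 1 ≤ k → ∀ p, L (X k * p) = 0
  rel : ∀ (j : ℤ) p, L (X j * (2 * X j - X (j - 1) - X (j + 1)) * p) = 0

section Quotient

variable {N : ℕ} {L : MvPolynomial ℤ ℝ →ₗ[ℝ] ℝ}

theorem IsKlyachko.klyachkoSeq (h : IsKlyachko N L) :
    KlyachkoSeq fun k => Ideal.Quotient.mk (nullIdeal L) (X k) := by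
  intro j
  have : X j * (2 * X j - X (j - 1) - X (j + 1)) ∈ nullIdeal L := h.rel j
  simpa only [map_mul, map_sub, map_ofNat] using Ideal.Quotient.eq_zero_iff_mem.2 this

theorem IsKlyachko.mk_X_eq_zero (h : IsKlyachko N L) (k : ℤ) (hk : k ≤ 0 ∨ (N : ℤ) + 1 ≤ k) :
    Ideal.Quotient.mk (nullIdeal L) (X k) = 0 :=
  Ideal.Quotient.eq_zero_iff_mem.2 (h.out k hk)

end Quotient

/-! ### Divided differences -/

/-- The map which identifies `i` with `i - 1` and closes the gap. -/
def collapse (i k : ℤ) : ℤ := if k < i then k else k - 1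

/-- The substitution `X_k ↦ X_{collapse i k}`. -/
def collapseHom (i : ℤ) : MvPolynomial ℤ ℝ →ₐ[ℝ] MvPolynomial ℤ ℝ := rename (collapse i)

theorem collapseHom_X_of_lt {i k : ℤ} (h : k < i) : collapseHom i (X k) = X k := by
  rw [collapseHom, rename_X, collapse, if_pos h]

theorem collapseHom_X_of_ge {i k : ℤ} (h : i ≤ k) : collapseHom i (X k) = X (k - 1) := by
  rw [collapseHom, rename_X, collapse, if_neg (not_lt.2 h)]

theorem collapseHom_X_of_ne {i k : ℤ} (h : k ≠ i) :
    collapseHom (i + 1) (X k) = collapseHom i (X k) := by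
  rcases lt_or_gt_of_ne h with h | h
  · rw [collapseHom_X_of_lt h, collapseHom_X_of_lt (by omega)]
  · rw [collapseHom_X_of_ge h.le, collapseHom_X_of_ge (by omega)]

theorem dvd_collapseHom_sub (i : ℤ) (f : MvPolynomial ℤ ℝ) :
    X (i - 1) - X i ∣ collapseHom i f - collapseHom (i + 1) f := by
  induction f using MvPolynomial.induction_on with
  | C a => simp [collapseHom]
  | add p q hp hq =>
    rw [map_add, map_add, add_sub_add_comm]; exact dvd_add hp hq
  | mul_X p k hp =>
    rw [map_mul, map_mul]
    have e : collapseHom i p * collapseHom i (X k) - collapseHom (i + 1) p *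
        collapseHom (i + 1) (X k) = (collapseHom i p - collapseHom (i + 1) p) *
        collapseHom i (X k) + collapseHom (i + 1) p *
        (collapseHom i (X k) - collapseHom (i + 1) (X k)) := by ring
    rw [e]
    refine dvd_add (dvd_mul_of_dvd_left hp _) (dvd_mul_of_dvd_right ?_ _)
    rcases eq_or_ne k i with rfl | hne
    · rw [collapseHom_X_of_ge le_rfl, collapseHom_X_of_lt (by omega)]
    · rw [collapseHom_X_of_ne hne, sub_self]; exact dvd_zero _

theorem X_sub_X_ne_zero (i : ℤ) : (X (i - 1) - X i : MvPolynomial ℤ ℝ) ≠ 0 := by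
  rw [sub_ne_zero]
  intro h
  have := X_injective (R := ℝ) h
  omega

/-- The divided difference
`(f(…, X_{i-1}, X_{i-1}, X_i, …) - f(…, X_{i-1}, X_i, X_i, …)) / (X_{i-1} - X_i)`, where the `i`-th
argument is the one that differs. -/
def divDiff (i : ℤ) : MvPolynomial ℤ ℝ →ₗ[ℝ] MvPolynomial ℤ ℝ where
  toFun f := (dvd_collapseHom_sub i f).choose
  map_add' f g := by
    refine mul_left_cancel₀ (X_sub_X_ne_zero i) ?_
    rw [mul_add, ← (dvd_collapseHom_sub i (f + g)).choose_spec,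
      ← (dvd_collapseHom_sub i f).choose_spec, ← (dvd_collapseHom_sub i g).choose_spec, map_add,
      map_add]
    ring
  map_smul' a f := by
    refine mul_left_cancel₀ (X_sub_X_ne_zero i) ?_
    rw [RingHom.id_apply, mul_smul_comm, ← (dvd_collapseHom_sub i (a • f)).choose_spec,
      ← (dvd_collapseHom_sub i f).choose_spec, map_smul, map_smul, smul_sub]

theorem mul_divDiff (i : ℤ) (f : MvPolynomial ℤ ℝ) :
    (X (i - 1) - X i) * divDiff i f = collapseHom i f - collapseHom (i + 1) f :=
  (dvd_collapseHom_sub i f).choose_spec.symm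

theorem divDiff_eq {i : ℤ} {f g : MvPolynomial ℤ ℝ}
    (h : collapseHom i f - collapseHom (i + 1) f = (X (i - 1) - X i) * g) : divDiff i f = g :=
  mul_left_cancel₀ (X_sub_X_ne_zero i) ((mul_divDiff i f).trans h)

/-- A factor on which the two substitutions agree can be taken out. -/
theorem divDiff_mul_of_eq {i : ℤ} {f : MvPolynomial ℤ ℝ} (g : MvPolynomial ℤ ℝ)
    (h : collapseHom (i + 1) f = collapseHom i f) :
    divDiff i (f * g) = collapseHom i f * divDiff i g := by
  refine divDiff_eq ?_
  rw [map_mul, map_mul, h, ← mul_sub, ← mul_divDiff]; ring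

theorem divDiff_X_mul_of_ne {i k : ℤ} (h : k ≠ i) (g : MvPolynomial ℤ ℝ) :
    divDiff i (X k * g) = collapseHom i (X k) * divDiff i g :=
  divDiff_mul_of_eq g (collapseHom_X_of_ne h)

/-- The left-hand side of a relation of Klyachko. -/
def klyRel (j : ℤ) : MvPolynomial ℤ ℝ := X j * (2 * X j - X (j - 1) - X (j + 1))

theorem divDiff_klyRel_far_right {i j : ℤ} (h : j + 2 ≤ i) (g : MvPolynomial ℤ ℝ) :
    divDiff i (klyRel j * g) = klyRel j * divDiff i g := by
  have e : ∀ i', j + 2 ≤ i' → collapseHom i' (klyRel j) = klyRel j := by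
    intro i' h'
    rw [klyRel]
    simp only [map_mul, map_sub, map_ofNat]
    rw [collapseHom_X_of_lt (by omega), collapseHom_X_of_lt (by omega),
      collapseHom_X_of_lt (by omega)]
  rw [divDiff_mul_of_eq g (by rw [e _ h, e _ (by omega)]), e _ h]

theorem divDiff_klyRel_far_left {i j : ℤ} (h : i + 2 ≤ j) (g : MvPolynomial ℤ ℝ) :
    divDiff i (klyRel j * g) = klyRel (j - 1) * divDiff i g := by
  have e : ∀ i', i' + 1 ≤ j → collapseHom i' (klyRel j) = klyRel (j - 1) := by
    intro i' h'
    rw [klyRel, klyRel]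
    simp only [map_mul, map_sub, map_ofNat]
    rw [collapseHom_X_of_ge (by omega), collapseHom_X_of_ge (by omega),
      collapseHom_X_of_ge (by omega), show j - 1 + 1 = j + 1 - 1 by ring]
  rw [divDiff_mul_of_eq g (by rw [e _ (by omega), e _ (by omega)]), e _ (by omega)]

theorem divDiff_klyRel_right (j : ℤ) (g : MvPolynomial ℤ ℝ) :
    divDiff (j + 1) (klyRel j * g) =
      klyRel j * divDiff (j + 1) g - X j * collapseHom (j + 1) g := by
  refine divDiff_eq ?_
  have h := mul_divDiff (j + 1) g
  rw [add_sub_cancel_right] at h ⊢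
  simp only [klyRel, map_mul, map_sub, map_ofNat]
  rw [collapseHom_X_of_lt (i := j + 1) (k := j) (by omega),
    collapseHom_X_of_lt (i := j + 1) (k := j - 1) (by omega),
    collapseHom_X_of_ge (i := j + 1) (k := j + 1) (by omega),
    collapseHom_X_of_lt (i := j + 1 + 1) (k := j) (by omega),
    collapseHom_X_of_lt (i := j + 1 + 1) (k := j - 1) (by omega),
    collapseHom_X_of_lt (i := j + 1 + 1) (k := j + 1) (by omega), add_sub_cancel_right]
  linear_combination (-X j * (2 * X j - X (j - 1) - X (j + 1))) * h

theorem divDiff_klyRel_left (j : ℤ) (g : MvPolynomial ℤ ℝ) :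
    divDiff (j - 1) (klyRel j * g) =
      klyRel (j - 1) * divDiff (j - 1) g - X (j - 1) * collapseHom j g := by
  refine divDiff_eq ?_
  have h := mul_divDiff (j - 1) g
  rw [sub_add_cancel] at h ⊢
  simp only [klyRel, map_mul, map_sub, map_ofNat]
  rw [collapseHom_X_of_ge (i := j - 1) (k := j) (by omega),
    collapseHom_X_of_ge (i := j - 1) (k := j - 1) (by omega),
    collapseHom_X_of_ge (i := j - 1) (k := j + 1) (by omega),
    collapseHom_X_of_ge (i := j) (k := j) (by omega),
    collapseHom_X_of_lt (i := j) (k := j - 1) (by omega),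
    collapseHom_X_of_ge (i := j) (k := j + 1) (by omega), add_sub_cancel_right, sub_add_cancel]
  linear_combination (-X (j - 1) * (2 * X (j - 1) - X (j - 1 - 1) - X j)) * h

theorem divDiff_klyRel_self (j : ℤ) (g : MvPolynomial ℤ ℝ) :
    divDiff j (klyRel j * g) = X (j - 1) * collapseHom j g + X j * collapseHom (j + 1) g := by
  refine divDiff_eq ?_
  simp only [klyRel, map_mul, map_sub, map_ofNat]
  rw [collapseHom_X_of_ge (i := j) (k := j) (by omega),
    collapseHom_X_of_lt (i := j) (k := j - 1) (by omega),
    collapseHom_X_of_ge (i := j) (k := j + 1) (by omega),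
    collapseHom_X_of_lt (i := j + 1) (k := j) (by omega),
    collapseHom_X_of_lt (i := j + 1) (k := j - 1) (by omega),
    collapseHom_X_of_ge (i := j + 1) (k := j + 1) (by omega), add_sub_cancel_right]
  ring

/-! ### The mixed Eulerian functional -/

/-- The functional whose value on the monomial `X_1^{c_1} ⋯ X_d^{c_d}`, where `c_1 + ⋯ + c_d = d`,
is the mixed Eulerian number `A_{c_1, …, c_d}`.  The recursion mirrors the integration of the
volume of a permutohedron over its slices. -/
def eulerFun : ℕ → MvPolynomial ℤ ℝ →ₗ[ℝ] ℝ
  | 0 => lcoeff ℝ 0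
  | d + 1 => ∑ i ∈ Finset.range (d + 1), (eulerFun d).comp (divDiff (i + 1))

theorem eulerFun_zero (f : MvPolynomial ℤ ℝ) : eulerFun 0 f = coeff 0 f := rfl

theorem eulerFun_succ (d : ℕ) (f : MvPolynomial ℤ ℝ) :
    eulerFun (d + 1) f = ∑ i ∈ Finset.range (d + 1), eulerFun d (divDiff (i + 1) f) := by
  rw [eulerFun, LinearMap.sum_apply]; rfl

theorem eulerFun_out (d : ℕ) (k : ℤ) (hk : k ≤ 0 ∨ (d : ℤ) + 1 ≤ k) (p : MvPolynomial ℤ ℝ) :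
    eulerFun d (X k * p) = 0 := by
  induction d generalizing k p with
  | zero => rw [eulerFun_zero]; simp [coeff_X_mul']
  | succ d ih =>
    rw [eulerFun_succ]
    refine Finset.sum_eq_zero fun i hi => ?_
    have hi' : i < d + 1 := Finset.mem_range.1 hi
    rw [divDiff_X_mul_of_ne (by omega)]
    rcases hk with hk | hk
    · rw [collapseHom_X_of_lt (by omega), ih k (Or.inl hk)]
    · rw [collapseHom_X_of_ge (by omega), ih (k - 1) (Or.inr (by omega))]

/-- In the sum that defines the functional, the terms with `i = j - 1`, `j`, `j + 1` are the only
ones to which the induction hypothesis does not apply directly; their remainders cancel. -/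
theorem eulerFun_rel (d : ℕ) (j : ℤ) (g : MvPolynomial ℤ ℝ) : eulerFun d (klyRel j * g) = 0 := by
  induction d generalizing j g with
  | zero => rw [klyRel, mul_assoc, eulerFun_out 0 j (by omega)]
  | succ d ih =>
    by_cases hj : j ≤ 0 ∨ ((d + 1 : ℕ) : ℤ) + 1 ≤ j
    · rw [klyRel, mul_assoc, eulerFun_out _ j hj]
    obtain ⟨l, rfl⟩ : ∃ l : ℕ, j = l + 1 := ⟨(j - 1).toNat, by omega⟩
    have hl : l < d + 1 := by omega
    set u := eulerFun d (X ((l : ℤ) + 1 - 1) * collapseHom (l + 1) g) with hu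
    set v := eulerFun d (X ((l : ℤ) + 1) * collapseHom (l + 1 + 1) g) with hv
    have hterm : ∀ i ∈ Finset.range (d + 1), eulerFun d (divDiff (i + 1) (klyRel (l + 1) * g)) =
        (if i = l then u + v else 0) - (if i = l + 1 then v else 0) -
          (if i + 1 = l then u else 0) := by
      intro i _
      rcases lt_trichotomy i l with h | rfl | h
      · rw [if_neg (by omega), if_neg (by omega)]
        rcases (show i + 1 ≤ l by omega).eq_or_lt with h' | h'
        · have e : (i : ℤ) + 1 = (l : ℤ) + 1 - 1 := by omega
          rw [if_pos h', e, divDiff_klyRel_left, map_sub, ih]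
          simp [hu]
        · rw [if_neg (by omega), divDiff_klyRel_far_left (by omega), ih]; simp
      · rw [if_pos rfl, if_neg (by omega), if_neg (by omega), divDiff_klyRel_self, map_add]
        simp [hu, hv]
      · rw [if_neg (by omega), if_neg (c := i + 1 = l) (by omega)]
        rcases (show l + 1 ≤ i by omega).eq_or_lt with h' | h'
        · have e : (i : ℤ) + 1 = (l : ℤ) + 1 + 1 := by omega
          rw [if_pos h'.symm, e, divDiff_klyRel_right, map_sub, ih]
          simp [hv]
        · rw [if_neg (by omega), divDiff_klyRel_far_right (by omega), ih]; simp
    rw [eulerFun_succ, Finset.sum_congr rfl hterm, Finset.sum_sub_distrib, Finset.sum_sub_distrib,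
      Finset.sum_ite_eq', Finset.sum_ite_eq', if_pos (Finset.mem_range.2 hl)]
    have h1 : (if l + 1 ∈ Finset.range (d + 1) then v else 0) = v := by
      split_ifs with h
      · rfl
      · rw [Finset.mem_range] at h
        rw [hv, eulerFun_out d _ (Or.inr (by omega))]
    have h2 : ∑ i ∈ Finset.range (d + 1), (if i + 1 = l then u else 0) = u := by
      cases l with
      | zero =>
        rw [Finset.sum_eq_zero fun i _ => if_neg (by omega), hu,
          eulerFun_out d _ (Or.inl (by simp))]
      | succ l =>
        simp only [Nat.add_right_cancel_iff]
        rw [Finset.sum_ite_eq', if_pos (Finset.mem_range.2 (by omega))]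
    rw [h1, h2]; ring

theorem isKlyachko_eulerFun (d : ℕ) : IsKlyachko d (eulerFun d) :=
  ⟨eulerFun_out d, eulerFun_rel d⟩

theorem divDiff_window {d i : ℕ} (hi : i < d + 1) :
    divDiff (i + 1) (window X 1 (d + 1)) = window X 1 d := by
  have hS : ∀ c : ℤ, collapseHom c (window X 1 (d + 1)) =
      collapseHom c (X (i + 1)) * ∏ t : Fin d,
        collapseHom c (X (1 + (((⟨i, hi⟩ : Fin (d + 1)).succAbove t : ℕ) : ℤ))) := by
    intro c
    rw [window, Finset.prod_range, Fin.prod_univ_succAbove _ ⟨i, hi⟩, map_mul, map_prod, add_comm]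
  have hR : ∀ t : Fin d, collapseHom (i + 1)
      (X (1 + (((⟨i, hi⟩ : Fin (d + 1)).succAbove t : ℕ) : ℤ))) = X (1 + ((t : ℕ) : ℤ)) := by
    intro t
    rcases lt_or_ge (t : ℕ) i with h | h
    · rw [Fin.succAbove_of_castSucc_lt _ _ (by rw [Fin.lt_def]; exact h),
        collapseHom_X_of_lt (by simp; omega)]; rfl
    · rw [Fin.succAbove_of_le_castSucc _ _ (by rw [Fin.le_def]; exact h),
        collapseHom_X_of_ge (by simp; omega)]
      congr 1; simp only [Fin.val_succ]; push_cast; ring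
  have hR' : ∀ t : Fin d, collapseHom (i + 1 + 1)
      (X (1 + (((⟨i, hi⟩ : Fin (d + 1)).succAbove t : ℕ) : ℤ))) = X (1 + ((t : ℕ) : ℤ)) := by
    intro t
    rw [collapseHom_X_of_ne, hR]
    have : ((⟨i, hi⟩ : Fin (d + 1)).succAbove t : ℕ) ≠ i := fun h =>
      Fin.succAbove_ne ⟨i, hi⟩ t (Fin.ext h)
    omega
  refine divDiff_eq ?_
  rw [hS, hS, Finset.prod_congr rfl fun t _ => hR t, Finset.prod_congr rfl fun t _ => hR' t,
    collapseHom_X_of_ge le_rfl, collapseHom_X_of_lt (by omega), window,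
    Finset.prod_range fun t => (X (1 + (t : ℤ)) : MvPolynomial ℤ ℝ)]
  ring

theorem eulerFun_window (d : ℕ) : eulerFun d (window X 1 d) = d.factorial := by
  induction d with
  | zero => rw [eulerFun_zero]; simp [window]
  | succ d ih =>
    rw [eulerFun_succ, Finset.sum_congr rfl fun i hi => by
      rw [divDiff_window (Finset.mem_range.1 hi), ih], Finset.sum_const, Finset.card_range,
      nsmul_eq_mul, Nat.factorial_succ]
    push_cast; ring

end

section

open MvPolynomial MeasureTheory

/-! ### Volumes of permutohedra -/

/-- The polytope `{t | ∀ A, z_{d+1} - z_{d+1-|A|} ≤ ∑_{i ∈ A} t_i ≤ z_{|A|}}` in `ℝ^d`, where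
`z_j = x_0 + ⋯ + x_{j-1}`.  For `x` antitone this is the image under deletion of the last coordinate
of the convex hull of all permutations of `(x_0, …, x_d)`. -/
def permBody (d : ℕ) (x : ℕ → ℝ) : Set (Fin d → ℝ) :=
  {t | ∀ A : Finset (Fin d),
    ∑ k ∈ Finset.range (d + 1), x k - ∑ k ∈ Finset.range (d + 1 - A.card), x k ≤ ∑ i ∈ A, t i ∧
      ∑ i ∈ A, t i ≤ ∑ k ∈ Finset.range A.card, x k}

/-- The sequence `x` with the entries `x_i`, `x_{i+1}` replaced by the single entry `c`. -/
def merge (x : ℕ → ℝ) (i : ℕ) (c : ℝ) (j : ℕ) : ℝ :=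
  if j < i then x j else if j = i then c else x (j + 1)

/-- The linear form attached to the polytope `permBody d x`; modulo `X_0` and `X_{d+1}` it is
`∑_{1 ≤ k ≤ d} (x_{k-1} - x_k) X_k`. -/
def bodyForm (d : ℕ) (x : ℕ → ℝ) : MvPolynomial ℤ ℝ :=
  ∑ k ∈ Finset.range (d + 1), C (x k) * (X ((k : ℤ) + 1) - X (k : ℤ))

theorem antitone_merge {x : ℕ → ℝ} (hx : Antitone x) {i : ℕ} {c : ℝ} (h1 : x (i + 1) ≤ c)
    (h2 : c ≤ x i) : Antitone (merge x i c) := by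
  refine antitone_nat_of_succ_le fun j => ?_
  unfold merge
  split_ifs with a b c d e f
  any_goals omega
  · exact hx (by omega)
  · exact h2.trans (hx (by omega))
  · exact (hx (by omega : i + 1 ≤ j + 1 + 1)).trans h1
  · exact hx (by omega)

theorem sum_range_merge_of_le (x : ℕ → ℝ) {i b : ℕ} (c : ℝ) (hb : b ≤ i) :
    ∑ k ∈ Finset.range b, merge x i c k = ∑ k ∈ Finset.range b, x k :=
  Finset.sum_congr rfl fun k hk => if_pos (by have := Finset.mem_range.1 hk; omega)

theorem sum_range_merge_of_gt (x : ℕ → ℝ) {i b : ℕ} (s : ℝ) (hb : i < b) :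
    ∑ k ∈ Finset.range b, merge x i (x i + x (i + 1) - s) k =
      ∑ k ∈ Finset.range (b + 1), x k - s := by
  induction b, hb using Nat.le_induction with
  | base =>
    rw [Finset.sum_range_succ, sum_range_merge_of_le x _ le_rfl, Finset.sum_range_succ,
      Finset.sum_range_succ, merge, if_neg (lt_irrefl _), if_pos rfl]
    ring
  | succ b hb ih =>
    rw [Finset.sum_range_succ, ih, Finset.sum_range_succ x (b + 1), merge, if_neg (by omega),
      if_neg (by omega)]
    ring

/-- The partial sums of the merged sequence are the minima of `z_b` and `z_{b+1} - s`, where `z`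
denotes the partial sums of `x`. -/
theorem le_sum_range_merge_iff {x : ℕ → ℝ} (hx : Antitone x) {i : ℕ} {s : ℝ} (h1 : x (i + 1) ≤ s)
    (h2 : s ≤ x i) (b : ℕ) (u : ℝ) :
    u ≤ ∑ k ∈ Finset.range b, merge x i (x i + x (i + 1) - s) k ↔
      u ≤ ∑ k ∈ Finset.range b, x k ∧ s + u ≤ ∑ k ∈ Finset.range (b + 1), x k := by
  rcases le_or_gt b i with hb | hb
  · rw [sum_range_merge_of_le x _ hb, Finset.sum_range_succ]
    have := hx hb
    exact ⟨fun h => ⟨h, by linarith⟩, fun h => h.1⟩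
  · rw [sum_range_merge_of_gt x s hb, Finset.sum_range_succ]
    have := hx (show i + 1 ≤ b from hb)
    exact ⟨fun h => ⟨by linarith, by linarith⟩, fun h => by linarith⟩

theorem forall_finset_fin_succ {d : ℕ} {p : Finset (Fin (d + 1)) → Prop} :
    (∀ A, p A) ↔ ∀ B : Finset (Fin d), p (B.map (Fin.succEmb d)) ∧
      p (insert 0 (B.map (Fin.succEmb d))) := by
  refine ⟨fun h B => ⟨h _, h _⟩, fun h A => ?_⟩
  have key : ∀ A : Finset (Fin (d + 1)), 0 ∉ A →
      (Finset.univ.filter fun j : Fin d => j.succ ∈ A).map (Fin.succEmb d) = A := by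
    intro A h0
    ext j
    refine Fin.cases ?_ (fun j => ?_) j
    · simp [h0, Fin.succ_ne_zero]
    · simp
  by_cases h0 : (0 : Fin (d + 1)) ∈ A
  · have := (h (Finset.univ.filter fun j : Fin d => j.succ ∈ A.erase 0)).2
    rwa [key _ (Finset.notMem_erase 0 A), Finset.insert_erase h0] at this
  · have := (h (Finset.univ.filter fun j : Fin d => j.succ ∈ A)).1
    rwa [key _ h0] at this

/-- The slice at a first coordinate between `x_{i+1}` and `x_i` is the polytope of the merged
sequence. -/
theorem cons_mem_permBody {d : ℕ} {x : ℕ → ℝ} (hx : Antitone x) {i : ℕ} (hi : i < d + 1) {s : ℝ}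
    (h1 : x (i + 1) ≤ s) (h2 : s ≤ x i) (t : Fin d → ℝ) :
    (Fin.cons s t : Fin (d + 1) → ℝ) ∈ permBody (d + 1) x ↔
      t ∈ permBody d (merge x i (x i + x (i + 1) - s)) := by
  simp only [permBody, Set.mem_ofPred_eq]
  rw [forall_finset_fin_succ]
  refine forall_congr' fun B => ?_
  have hB : B.card ≤ d := by simpa using Finset.card_le_univ B
  have h0 : (0 : Fin (d + 1)) ∉ B.map (Fin.succEmb d) := by simp [Fin.succ_ne_zero]
  rw [Finset.sum_insert h0, Finset.card_insert_of_notMem h0, Finset.card_map, Finset.sum_map]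
  simp only [Fin.coe_succEmb, Fin.cons_succ, Fin.cons_zero]
  rw [le_sum_range_merge_iff hx h1 h2, sum_range_merge_of_gt x s hi,
    sub_le_comm (a := ∑ k ∈ Finset.range (d + 1 + 1), x k - s),
    le_sum_range_merge_iff hx h1 h2, show d + 1 + 1 - (B.card + 1) = d + 1 - B.card by omega,
    show d + 1 + 1 - B.card = d + 1 - B.card + 1 by omega]
  constructor
  · rintro ⟨⟨h3, h4⟩, h5, h6⟩
    exact ⟨⟨by linarith, by linarith⟩, by linarith, by linarith⟩
  · rintro ⟨⟨h3, h4⟩, h5, h6⟩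
    exact ⟨⟨by linarith, by linarith⟩, by linarith, by linarith⟩

theorem mem_Icc_of_cons_mem_permBody {d : ℕ} {x : ℕ → ℝ} {s : ℝ} {t : Fin d → ℝ}
    (h : (Fin.cons s t : Fin (d + 1) → ℝ) ∈ permBody (d + 1) x) :
    s ∈ Set.Icc (x (d + 1)) (x 0) := by
  have := h {0}
  simp only [Finset.card_singleton, Finset.sum_singleton, Fin.cons_zero, Finset.sum_range_one,
    Nat.add_sub_cancel, Finset.sum_range_succ x (d + 1), add_sub_cancel_left] at this
  exact this

theorem isClosed_permBody (d : ℕ) (x : ℕ → ℝ) : IsClosed (permBody d x) := by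
  simp only [permBody, Set.ofPred_forall, Set.ofPred_and]
  refine isClosed_iInter fun A => IsClosed.inter ?_ ?_
  · exact isClosed_le continuous_const (continuous_finsetSum _ fun i _ => continuous_apply i)
  · exact isClosed_le (continuous_finsetSum _ fun i _ => continuous_apply i) continuous_const

theorem bodyForm_merge {d i : ℕ} (hi : i < d + 1) (x : ℕ → ℝ) (c c' : ℝ) :
    bodyForm d (merge x i c') = bodyForm d (merge x i c) +
      C (c - c') * (X (i : ℤ) - X ((i : ℤ) + 1)) := by
  rw [bodyForm, bodyForm, ← sub_eq_iff_eq_add', ← Finset.sum_sub_distrib,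
    Finset.sum_eq_single_of_mem i (Finset.mem_range.2 hi)]
  · simp only [merge, if_neg (lt_irrefl i), if_true, C_sub]; ring
  · intro b _ hb
    simp only [merge, if_neg hb]
    ring

/-- Identifying `X_i` and `X_{i+1}` cancels the term of `x_i`, that is, deletes this entry. -/
theorem collapseHom_bodyForm {d i : ℕ} (hi : i < d + 2) (x : ℕ → ℝ) :
    collapseHom ((i : ℤ) + 1) (bodyForm (d + 1) x) =
      ∑ k ∈ Finset.range (d + 1), C (if k < i then x k else x (k + 1)) *
        (X ((k : ℤ) + 1) - X (k : ℤ)) := by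
  have hC : ∀ c : ℝ, collapseHom ((i : ℤ) + 1) (C c) = C c := fun c => by
    rw [collapseHom, rename_C]
  rw [bodyForm, map_sum, Finset.sum_range, Fin.sum_univ_succAbove _ ⟨i, hi⟩, Finset.sum_range]
  simp only [map_mul, map_sub, hC]
  rw [collapseHom_X_of_ge le_rfl, collapseHom_X_of_lt (by omega : (i : ℤ) < i + 1),
    add_sub_cancel_right, sub_self, mul_zero, zero_add]
  refine Finset.sum_congr rfl fun t _ => ?_
  rcases lt_or_ge (t : ℕ) i with h | h
  · have e : ((⟨i, hi⟩ : Fin (d + 2)).succAbove t : ℕ) = t := by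
      rw [Fin.succAbove_of_castSucc_lt _ _ (by rw [Fin.lt_def]; exact h)]; rfl
    rw [e, if_pos h, collapseHom_X_of_lt (by omega), collapseHom_X_of_lt (by omega)]
  · have e : ((⟨i, hi⟩ : Fin (d + 2)).succAbove t : ℕ) = t + 1 := by
      rw [Fin.succAbove_of_le_castSucc _ _ (by rw [Fin.le_def]; exact h)]; rfl
    rw [e, if_neg (by omega), collapseHom_X_of_ge (by push_cast; omega),
      collapseHom_X_of_ge (by push_cast; omega)]
    push_cast
    rw [add_sub_cancel_right, add_sub_cancel_right]

theorem collapseHom_bodyForm_right {d i : ℕ} (hi : i < d + 1) (x : ℕ → ℝ) :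
    collapseHom ((i : ℤ) + 1 + 1) (bodyForm (d + 1) x) = bodyForm d (merge x i (x i)) := by
  have := collapseHom_bodyForm (show i + 1 < d + 2 by omega) x
  push_cast at this
  rw [this, bodyForm]
  refine Finset.sum_congr rfl fun k _ => ?_
  unfold merge
  split_ifs <;> first | omega | rfl | (subst_vars; rfl)

theorem collapseHom_bodyForm_left {d i : ℕ} (hi : i < d + 1) (x : ℕ → ℝ) :
    collapseHom ((i : ℤ) + 1) (bodyForm (d + 1) x) = bodyForm d (merge x i (x (i + 1))) := by
  rw [collapseHom_bodyForm (by omega) x, bodyForm]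
  refine Finset.sum_congr rfl fun k _ => ?_
  unfold merge
  split_ifs <;> first | omega | rfl | (subst_vars; rfl)

theorem divDiff_pow {i : ℤ} {f a : MvPolynomial ℤ ℝ} {l : ℝ} (d : ℕ)
    (ha : collapseHom (i + 1) f = a) (hb : collapseHom i f = a + C l * (X (i - 1) - X i)) :
    divDiff i (f ^ (d + 1)) = ∑ k ∈ Finset.range (d + 1),
      ((d + 1).choose (k + 1) * l ^ (k + 1) : ℝ) • ((X (i - 1) - X i) ^ k * a ^ (d - k)) := by
  refine divDiff_eq ?_
  rw [map_pow, map_pow, ha, hb, add_comm a, add_pow, Finset.sum_range_succ', Finset.mul_sum]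
  simp only [pow_zero, one_mul, Nat.sub_zero, Nat.choose_zero_right, Nat.cast_one, mul_one,
    add_sub_cancel_right]
  refine Finset.sum_congr rfl fun k _ => ?_
  rw [smul_eq_C_mul, Nat.add_sub_add_right, mul_pow, ← C_pow, C_mul]
  have : (((d + 1).choose (k + 1) : ℕ) : MvPolynomial ℤ ℝ) = C (((d + 1).choose (k + 1) : ℕ) : ℝ) :=
    (map_natCast C _).symm
  rw [this]
  ring

theorem map_add_C_mul_pow (L : MvPolynomial ℤ ℝ →ₗ[ℝ] ℝ) (a e : MvPolynomial ℤ ℝ) (d : ℕ) (t : ℝ) :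
    L ((a + C t * e) ^ d) =
      ∑ k ∈ Finset.range (d + 1), t ^ k * (d.choose k * L (e ^ k * a ^ (d - k))) := by
  rw [add_comm, add_pow, map_sum]
  refine Finset.sum_congr rfl fun k _ => ?_
  have : (C t * e) ^ k * a ^ (d - k) * ((d.choose k : ℕ) : MvPolynomial ℤ ℝ) =
      (t ^ k * (d.choose k : ℝ)) • (e ^ k * a ^ (d - k)) := by
    rw [smul_eq_C_mul, C_mul, C_pow, map_natCast, mul_pow]; ring
  rw [this, map_smul, smul_eq_mul, mul_assoc]

/-- Applying the divided difference to a power of the linear form integrates over the slices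
between two adjacent values of `x`. -/
theorem integral_bodyForm_merge {d i : ℕ} (hi : i < d + 1) (x : ℕ → ℝ)
    (L : MvPolynomial ℤ ℝ →ₗ[ℝ] ℝ) :
    ∫ s in x (i + 1)..x i, L (bodyForm d (merge x i (x i + x (i + 1) - s)) ^ d) =
      L (divDiff (i + 1) (bodyForm (d + 1) x ^ (d + 1))) / (d + 1) := by
  set a := bodyForm d (merge x i (x i)) with ha
  set e : MvPolynomial ℤ ℝ := X (i : ℤ) - X ((i : ℤ) + 1) with he
  have hint : ∀ s, L (bodyForm d (merge x i (x i + x (i + 1) - s)) ^ d) =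
      (fun t => ∑ k ∈ Finset.range (d + 1), t ^ k * (d.choose k * L (e ^ k * a ^ (d - k))))
        (s - x (i + 1)) := by
    intro s
    rw [bodyForm_merge hi x (x i), map_add_C_mul_pow]
    simp only [← ha, ← he]
    congr! 3
    ring
  simp only [hint]
  rw [intervalIntegral.integral_comp_sub_right fun t => ∑ k ∈ Finset.range (d + 1),
      t ^ k * (d.choose k * L (e ^ k * a ^ (d - k))), sub_self,
    intervalIntegral.integral_finsetSum fun k _ =>
      (Continuous.intervalIntegrable (by fun_prop) _ _)]
  rw [divDiff_pow d (collapseHom_bodyForm_right hi x) (l := x i - x (i + 1))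
    (by rw [collapseHom_bodyForm_left hi, bodyForm_merge hi x (x i), add_sub_cancel_right]),
    map_sum, Finset.sum_div]
  refine Finset.sum_congr rfl fun k _ => ?_
  rw [intervalIntegral.integral_mul_const, integral_pow, map_smul, smul_eq_mul,
    add_sub_cancel_right, ← ha, ← he]
  have h : ((d : ℝ) + 1) * d.choose k = (d + 1).choose (k + 1) * (k + 1) := by
    exact_mod_cast Nat.add_one_mul_choose_eq d k
  have hk : (k : ℝ) + 1 ≠ 0 := by positivity
  have hd : (d : ℝ) + 1 ≠ 0 := by positivity
  rw [zero_pow (by omega), sub_zero]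
  field_simp
  linear_combination L (e ^ k * a ^ (d - k)) * (x i - x (i + 1)) ^ (k + 1) * h

theorem setLIntegral_Ioc_of_antitone {x : ℕ → ℝ} (hx : Antitone x) (f : ℝ → ENNReal) (m : ℕ) :
    ∫⁻ s in Set.Ioc (x m) (x 0), f s =
      ∑ i ∈ Finset.range m, ∫⁻ s in Set.Ioc (x (i + 1)) (x i), f s := by
  induction m with
  | zero => simp
  | succ m ih =>
    rw [Finset.sum_range_succ, ← ih, ← Set.Ioc_union_Ioc_eq_Ioc (hx m.le_succ) (hx m.zero_le),
      lintegral_union measurableSet_Ioc, add_comm]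
    exact Set.Ioc_disjoint_Ioc_of_le le_rfl

theorem continuous_bodyForm_merge {d i : ℕ} (hi : i < d + 1) (x : ℕ → ℝ)
    (L : MvPolynomial ℤ ℝ →ₗ[ℝ] ℝ) :
    Continuous fun s => L (bodyForm d (merge x i (x i + x (i + 1) - s)) ^ d) := by
  have h (s : ℝ) := (congrArg (fun f => L (f ^ d))
    (bodyForm_merge hi x (x i) (x i + x (i + 1) - s))).trans (map_add_C_mul_pow L _ _ d _)
  rw [funext h]
  fun_prop

/-- The volume of a permutohedron is given by the mixed Eulerian functional. -/
theorem volume_permBody (d : ℕ) (x : ℕ → ℝ) (hx : Antitone x) :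
    0 ≤ eulerFun d (bodyForm d x ^ d) / d.factorial ∧
      volume (permBody d x) = ENNReal.ofReal (eulerFun d (bodyForm d x ^ d) / d.factorial) := by
  induction d generalizing x with
  | zero =>
    have : permBody 0 x = Set.univ := by
      ext t
      simp [permBody, Subsingleton.elim _ (∅ : Finset (Fin 0))]
    rw [this, eulerFun_zero, volume_pi, Measure.pi_of_empty _ 0]
    simp
  | succ d ih =>
    -- the slices, by the value of the first coordinate
    have hslice : ∀ i < d + 1, ∀ s ∈ Set.Icc (x (i + 1)) (x i),
        {t : Fin d → ℝ | (Fin.cons s t : Fin (d + 1) → ℝ) ∈ permBody (d + 1) x} =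
          permBody d (merge x i (x i + x (i + 1) - s)) := fun i hi s hs =>
      Set.ext fun t => cons_mem_permBody hx hi hs.1 hs.2 t
    have hanti : ∀ i, ∀ s ∈ Set.Icc (x (i + 1)) (x i),
        Antitone (merge x i (x i + x (i + 1) - s)) := fun i s hs =>
      antitone_merge hx (by linarith [hs.2]) (by linarith [hs.1])
    -- the volumes of the slices between `x_{i+1}` and `x_i`
    set g : ℕ → ℝ → ℝ := fun i s =>
      eulerFun d (bodyForm d (merge x i (x i + x (i + 1) - s)) ^ d) / d.factorial with hg
    have hg0 : ∀ i, ∀ s ∈ Set.Icc (x (i + 1)) (x i), 0 ≤ g i s := fun i s hs =>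
      (ih _ (hanti i s hs)).1
    have hgc : ∀ i < d + 1, Continuous (g i) := fun i hi =>
      (continuous_bodyForm_merge hi x _).div_const _
    have hgi : ∀ i < d + 1, ∫ s in x (i + 1)..x i, g i s =
        eulerFun d (divDiff (i + 1) (bodyForm (d + 1) x ^ (d + 1))) / (d + 1).factorial := by
      intro i hi
      rw [hg, intervalIntegral.integral_div, integral_bodyForm_merge hi, Nat.factorial_succ]
      push_cast
      rw [div_div]
    have hsum : eulerFun (d + 1) (bodyForm (d + 1) x ^ (d + 1)) / (d + 1).factorial =
        ∑ i ∈ Finset.range (d + 1), ∫ s in x (i + 1)..x i, g i s := by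
      rw [eulerFun_succ, Finset.sum_div]
      exact Finset.sum_congr rfl fun i hi => (hgi i (Finset.mem_range.1 hi)).symm
    have hpos : ∀ i ∈ Finset.range (d + 1), 0 ≤ ∫ s in x (i + 1)..x i, g i s := fun i _ =>
      intervalIntegral.integral_nonneg (hx i.le_succ) (hg0 i)
    refine ⟨hsum ▸ Finset.sum_nonneg hpos, ?_⟩
    rw [hsum, ENNReal.ofReal_sum_of_nonneg hpos]
    have hmeas := (isClosed_permBody (d + 1) x).measurableSet
    rw [← (volume_preserving_piFinSuccAbove (fun _ : Fin (d + 1) => ℝ) 0).symm.measure_preimage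
      hmeas.nullMeasurableSet, Measure.volume_eq_prod, Measure.prod_apply
      (((MeasurableEquiv.piFinSuccAbove (fun _ : Fin (d + 1) => ℝ) 0).symm.measurable) hmeas)]
    have hpre : ∀ s : ℝ, Prod.mk s ⁻¹' ((MeasurableEquiv.piFinSuccAbove
        (fun _ : Fin (d + 1) => ℝ) 0).symm ⁻¹' permBody (d + 1) x) =
        {t : Fin d → ℝ | (Fin.cons s t : Fin (d + 1) → ℝ) ∈ permBody (d + 1) x} := by
      intro s; ext t
      simp only [Set.mem_preimage, Set.mem_ofPred_eq, MeasurableEquiv.piFinSuccAbove_symm_apply,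
        Fin.insertNthEquiv_zero]
      rfl
    simp only [hpre]
    rw [← setLIntegral_eq_of_support_subset (s := Set.Icc (x (d + 1)) (x 0)),
      setLIntegral_congr Ioc_ae_eq_Icc.symm, setLIntegral_Ioc_of_antitone hx]
    · refine Finset.sum_congr rfl fun i hi => ?_
      rw [intervalIntegral.integral_of_le (hx i.le_succ), ofReal_integral_eq_lintegral_ofReal]
      · refine setLIntegral_congr_fun measurableSet_Ioc fun s hs => ?_
        have hs' := Set.Ioc_subset_Icc_self hs
        rw [hslice i (Finset.mem_range.1 hi) s hs', (ih _ (hanti i s hs')).2]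
      · exact ((hgc i (Finset.mem_range.1 hi)).integrableOn_Icc).mono_set Set.Ioc_subset_Icc_self
      · exact (ae_restrict_iff' measurableSet_Ioc).2
          (ae_of_all _ fun s hs => hg0 i s (Set.Ioc_subset_Icc_self hs))
    · intro s hs
      by_contra h
      refine hs ?_
      have : {t : Fin d → ℝ | (Fin.cons s t : Fin (d + 1) → ℝ) ∈ permBody (d + 1) x} = ∅ :=
        Set.eq_empty_of_forall_notMem fun t ht => h (mem_Icc_of_cons_mem_permBody ht)
      simp [this]

end

section

open MvPolynomial MeasureTheory
open scoped Pointwise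

/-! ### Polarization -/

/-- The signed count of the sets containing the image of a function detects surjectivity. -/
theorem sum_neg_one_pow_filter_range_subset {ι κ : Type*} [Fintype ι] [DecidableEq ι] [Fintype κ]
    {R : Type*} [CommRing R] (f : κ → ι) :
    ∑ S : Finset ι, (if ∀ j, f j ∈ S then (-1 : R) ^ (Fintype.card ι - S.card) else 0) =
      if Function.Surjective f then 1 else 0 := by
  have h1 : ∑ S : Finset ι, (if ∀ j, f j ∈ S then (-1 : R) ^ (Fintype.card ι - S.card) else 0) =
      ∑ S ∈ (Finset.univ \ Finset.univ.image f).powerset, (-1 : R) ^ S.card := by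
    rw [← Finset.sum_filter]
    refine Finset.sum_bij' (fun S _ => Sᶜ) (fun S _ => Sᶜ) ?_ ?_ ?_ ?_ ?_
    · intro S hS
      simp only [Finset.mem_filter, Finset.mem_univ, true_and] at hS
      rw [Finset.mem_powerset]
      intro i hi
      simp only [Finset.mem_sdiff, Finset.mem_univ, Finset.mem_image, true_and, not_exists]
      rintro j rfl
      exact Finset.mem_compl.1 hi (hS j)
    · intro S hS
      simp only [Finset.mem_filter, Finset.mem_univ, true_and]
      intro j
      refine Finset.mem_compl.2 fun h => ?_
      simpa using Finset.mem_powerset.1 hS h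
    · intro S _; exact compl_compl S
    · intro S _; exact compl_compl S
    · intro S _; rw [Finset.card_compl]
  rw [h1]
  have h2 := congrArg (Int.cast (R := R))
    (Finset.sum_powerset_neg_one_pow_card (x := Finset.univ \ Finset.univ.image f))
  push_cast at h2
  rw [h2]
  refine if_congr ?_ rfl rfl
  rw [Finset.sdiff_eq_empty_iff_subset, Finset.univ_subset_iff, Finset.eq_univ_iff_forall]
  simp [Function.Surjective]

/-- The polarization of the `d`-th power. -/
theorem sum_neg_one_pow_mul_sum_pow {ι : Type*} [Fintype ι] [DecidableEq ι] {R : Type*} [CommRing R]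
    (y : ι → R) :
    ∑ S : Finset ι, (-1 : R) ^ (Fintype.card ι - S.card) * (∑ i ∈ S, y i) ^ Fintype.card ι =
      (Fintype.card ι).factorial * ∏ i, y i := by
  have h : ∀ S : Finset ι, (∑ i ∈ S, y i) ^ Fintype.card ι =
      ∑ f : ι → ι, if ∀ j, f j ∈ S then ∏ j, y (f j) else 0 := by
    intro S
    rw [← Finset.sum_filter, ← Finset.card_univ, ← Finset.prod_const, Finset.prod_univ_sum]
    refine Finset.sum_congr ?_ fun _ _ => rfl
    ext f; simp
  simp only [h, Finset.mul_sum]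
  rw [Finset.sum_comm]
  have h' : ∀ f : ι → ι, ∑ S : Finset ι, (-1 : R) ^ (Fintype.card ι - S.card) *
      (if ∀ j, f j ∈ S then ∏ j, y (f j) else 0) =
        if Function.Bijective f then ∏ j, y j else 0 := by
    intro f
    have := sum_neg_one_pow_filter_range_subset (R := R) f
    rw [Finset.sum_congr rfl fun S _ => (by split_ifs <;> ring :
      (-1 : R) ^ (Fintype.card ι - S.card) * (if ∀ j, f j ∈ S then ∏ j, y (f j) else 0) =
        (if ∀ j, f j ∈ S then (-1 : R) ^ (Fintype.card ι - S.card) else 0) * ∏ j, y (f j)),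
      ← Finset.sum_mul, this]
    by_cases hf : Function.Surjective f
    · have hb : Function.Bijective f := Finite.surjective_iff_bijective.1 hf
      rw [if_pos hf, if_pos hb, one_mul]
      exact hb.prod_comp y
    · rw [if_neg hf, if_neg fun hb => hf hb.2, zero_mul]
  simp only [h']
  rw [← Finset.sum_filter, Finset.sum_const, nsmul_eq_mul]
  congr 2
  rw [← Fintype.card_perm, ← Fintype.card_subtype]
  exact Fintype.card_congr Equiv.bijectiveEquiv

/-! ### Minkowski sums of hypersimplices -/

/-- The convex hull of the permutations of `(x_0, …, x_{m-1})`, in terms of inequalities.  This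
description is meant for antitone `x`. -/
def permHull (m : ℕ) (x : ℕ → ℝ) : Set (Fin m → ℝ) :=
  {t | (∀ A : Finset (Fin m), ∑ i ∈ A, t i ≤ ∑ k ∈ Finset.range A.card, x k) ∧
    ∑ i, t i = ∑ k ∈ Finset.range m, x k}

theorem convex_permHull (m : ℕ) (x : ℕ → ℝ) : Convex ℝ (permHull m x) := by
  intro s hs t ht a b ha hb hab
  have key : ∀ A : Finset (Fin m),
      ∑ i ∈ A, (a • s + b • t) i = a * ∑ i ∈ A, s i + b * ∑ i ∈ A, t i := by
    intro A
    simp [Finset.sum_add_distrib, Finset.mul_sum]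
  have hx : ∀ c : ℝ, c = a * c + b * c := fun c => by rw [← add_mul, hab, one_mul]
  refine ⟨fun A => ?_, ?_⟩
  · rw [key, hx (∑ k ∈ Finset.range A.card, x k)]
    exact add_le_add (mul_le_mul_of_nonneg_left (hs.1 A) ha) (mul_le_mul_of_nonneg_left (ht.1 A) hb)
  · rw [key, hs.2, ht.2, ← hx]

/-- The first `k` entries are `1`, the others are `0`. -/
def stepSeq (k : ℕ) (j : ℕ) : ℝ := if j < k then 1 else 0

theorem sum_range_stepSeq (k m : ℕ) : ∑ j ∈ Finset.range m, stepSeq k j = (min m k : ℕ) := by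
  simp only [stepSeq]
  rw [← Finset.sum_filter, Finset.sum_const, nsmul_eq_mul, mul_one]
  congr 1
  rw [show (Finset.range m).filter (· < k) = Finset.range (min m k) by ext; simp, Finset.card_range]

theorem hypersimplex_subset_permHull (m k : ℕ) : hypersimplex m k ⊆ permHull m (stepSeq k) := by
  refine convexHull_min ?_ (convex_permHull _ _)
  rintro _ ⟨σ, rfl⟩
  have hsum : ∀ A : Finset (Fin m),
      ∑ i ∈ A, ((fun j : Fin m => if (j : ℕ) < k then (1 : ℝ) else 0) ∘ σ) i =
        ((A.filter fun i => (σ i : ℕ) < k).card : ℝ) := by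
    intro A
    simp [Finset.sum_boole]
  refine ⟨fun A => ?_, ?_⟩
  · rw [hsum, sum_range_stepSeq]
    refine Nat.cast_le.2 (le_min (Finset.card_filter_le _ _) ?_)
    calc (A.filter fun i => (σ i : ℕ) < k).card
        = ((A.filter fun i => (σ i : ℕ) < k).image fun i => (σ i : ℕ)).card :=
          (Finset.card_image_of_injective _ (Fin.val_injective.comp σ.injective)).symm
      _ ≤ (Finset.range k).card := Finset.card_le_card fun j hj => by
          obtain ⟨i, hi, rfl⟩ := Finset.mem_image.1 hj
          exact Finset.mem_range.2 (Finset.mem_filter.1 hi).2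
      _ = k := Finset.card_range k
  · rw [Finset.sum_range, ← Equiv.sum_comp σ fun i => stepSeq k i]
    rfl

theorem add_mem_permHull {m : ℕ} {x y : ℕ → ℝ} {s t : Fin m → ℝ} (hs : s ∈ permHull m x)
    (ht : t ∈ permHull m y) : s + t ∈ permHull m (x + y) := by
  refine ⟨fun A => ?_, ?_⟩
  · simp only [Pi.add_apply, Finset.sum_add_distrib]
    exact add_le_add (hs.1 A) (ht.1 A)
  · simp only [Pi.add_apply, Finset.sum_add_distrib]
    rw [hs.2, ht.2]

theorem zero_mem_permHull (m : ℕ) : (0 : Fin m → ℝ) ∈ permHull m 0 := by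
  constructor <;> simp

theorem sum_hypersimplex_subset {ι : Type*} (m : ℕ) (S : Finset ι) (k : ι → ℕ) :
    ∑ p ∈ S, hypersimplex m (k p) ⊆ permHull m (∑ p ∈ S, stepSeq (k p)) := by
  classical
  induction S using Finset.induction_on with
  | empty =>
    rw [Finset.sum_empty, Finset.sum_empty]
    rintro _ rfl
    exact zero_mem_permHull m
  | insert p S hp ih =>
    rw [Finset.sum_insert hp, Finset.sum_insert hp]
    rintro _ ⟨s, hs, t, ht, rfl⟩
    exact add_mem_permHull (hypersimplex_subset_permHull _ _ hs) (ih ht)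

/-- Summation by parts. -/
theorem sum_mul_le_of_partial_sums_nonpos {w u : ℕ → ℝ} {m : ℕ}
    (hw : ∀ j < m, w (j + 1) ≤ w j)
    (hu : ∀ j < m, ∑ k ∈ Finset.range (j + 1), u k ≤ 0) :
    ∑ j ∈ Finset.range (m + 1), w j * u j ≤ w m * ∑ j ∈ Finset.range (m + 1), u j := by
  induction m with
  | zero => simp
  | succ m ih =>
    rw [Finset.sum_range_succ, Finset.sum_range_succ u (m + 1)]
    have h1 := ih (fun j hj => hw j (by omega)) fun j hj => hu j (by omega)
    have h2 := mul_nonpos_of_nonneg_of_nonpos (sub_nonneg.2 (hw m (by omega))) (hu m (by omega))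
    linarith

/-- A linear function `w` attains its maximum over each hypersimplex at the vertex with ones at the
largest coordinates of `w`; on `permHull` it is at most the sum of these maxima. -/
theorem exists_vertex_ge {ι : Type*} {m : ℕ} (S : Finset ι) (k : ι → ℕ) (w : Fin (m + 1) → ℝ)
    {t : Fin (m + 1) → ℝ} (ht : t ∈ permHull (m + 1) (∑ p ∈ S, stepSeq (k p))) :
    ∃ v ∈ ∑ p ∈ S, hypersimplex (m + 1) (k p), ∑ i, w i * t i ≤ ∑ i, w i * v i := by
  set x := ∑ p ∈ S, stepSeq (k p) with hx
  set σ := Tuple.sort (fun i => - w i) with hσ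
  have hmono : Monotone ((fun i => - w i) ∘ σ) := Tuple.monotone_sort _
  refine ⟨∑ p ∈ S, (fun i => stepSeq (k p) (σ.symm i : ℕ)), Set.finsetSum_mem_finsetSum _ _ _
    fun p _ => subset_convexHull _ _ ⟨σ.symm, rfl⟩, ?_⟩
  have hv : ∀ i, (∑ p ∈ S, (fun i : Fin (m + 1) => stepSeq (k p) (σ.symm i : ℕ))) i =
      x (σ.symm i) := by
    intro i
    rw [hx, Finset.sum_apply, Finset.sum_apply]
  simp only [hv]
  rw [← sub_nonpos, ← Finset.sum_sub_distrib]
  simp only [← mul_sub]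
  rw [← Equiv.sum_comp σ]
  simp only [Equiv.symm_apply_apply]
  -- Extension of the sorted sequences to all natural numbers, for summation by parts.
  set W : ℕ → ℝ := fun j => if h : j < m + 1 then w (σ ⟨j, h⟩) else 0 with hW
  set U : ℕ → ℝ := fun j => if h : j < m + 1 then t (σ ⟨j, h⟩) - x j else 0 with hU
  have hWj : ∀ j : Fin (m + 1), W j = w (σ j) := fun j => dif_pos j.2
  have hUj : ∀ j : Fin (m + 1), U j = t (σ j) - x j := fun j => dif_pos j.2
  have hpart : ∀ l ≤ m + 1, ∑ j ∈ Finset.range l, U j =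
      ∑ i ∈ (Finset.univ.filter fun j : Fin (m + 1) => (j : ℕ) < l).map σ.toEmbedding, t i -
        ∑ j ∈ Finset.range l, x j := by
    intro l hl
    have e : Finset.range l =
        (Finset.univ.filter fun j : Fin (m + 1) => (j : ℕ) < l).map Fin.valEmbedding := by
      ext j
      simp only [Finset.mem_range, Finset.mem_map, Finset.mem_filter, Finset.mem_univ, true_and,
        Fin.valEmbedding_apply]
      exact ⟨fun h => ⟨⟨j, by omega⟩, h, rfl⟩, by rintro ⟨i, h, rfl⟩; exact h⟩
    rw [e, Finset.sum_map, Finset.sum_map, Finset.sum_map, ← Finset.sum_sub_distrib]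
    exact Finset.sum_congr rfl fun j _ => hUj j
  have hcard : ∀ l ≤ m + 1, ((Finset.univ.filter fun j : Fin (m + 1) => (j : ℕ) < l).map
      σ.toEmbedding).card = l := by
    intro l hl
    rw [Finset.card_map, Fin.card_filter_val_lt, min_eq_right hl]
  have hle : ∀ l ≤ m + 1, ∑ j ∈ Finset.range l, U j ≤ 0 := by
    intro l hl
    rw [hpart l hl, sub_nonpos]
    have := ht.1 ((Finset.univ.filter fun j : Fin (m + 1) => (j : ℕ) < l).map σ.toEmbedding)
    rwa [hcard l hl] at this
  have htot : ∑ j ∈ Finset.range (m + 1), U j = 0 := by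
    rw [hpart _ le_rfl, Finset.filter_true_of_mem fun j _ => j.2,
      Finset.univ_map_equiv_to_embedding,
      ht.2, sub_self]
  have := sum_mul_le_of_partial_sums_nonpos (w := W) (u := U) (m := m)
    (fun j hj => by
      have := hmono (show (⟨j, by omega⟩ : Fin (m + 1)) ≤ ⟨j + 1, by omega⟩ by simp [Fin.le_def])
      simp only [Function.comp, neg_le_neg_iff] at this
      rw [hW]; simp only
      rwa [dif_pos (by omega), dif_pos (by omega)])
    (fun j hj => hle _ (by omega))
  rw [htot, mul_zero, Finset.sum_range] at this
  simpa only [hWj, hUj] using this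

/-- A Minkowski sum of hypersimplices is the permutohedron of the sum of their vectors.  Otherwise a
point of the permutohedron could be separated from the sum by a linear function. -/
theorem sum_hypersimplex {ι : Type*} (m : ℕ) (S : Finset ι) (k : ι → ℕ) :
    ∑ p ∈ S, hypersimplex (m + 1) (k p) = permHull (m + 1) (∑ p ∈ S, stepSeq (k p)) := by
  refine (sum_hypersimplex_subset _ _ _).antisymm fun t ht => ?_
  by_contra hnot
  have hconv : Convex ℝ (∑ p ∈ S, hypersimplex (m + 1) (k p)) := by
    simp only [hypersimplex, permutohedron]
    rw [← convexHull_sum]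
    exact convex_convexHull _ _
  have hcl : IsClosed (∑ p ∈ S, hypersimplex (m + 1) (k p)) := by
    simp only [hypersimplex, permutohedron]
    rw [← convexHull_sum]
    refine Set.Finite.isClosed_convexHull ℝ ?_
    refine Finset.sum_induction _ Set.Finite (fun _ _ => Set.Finite.add) Set.finite_zero
      fun p _ => Set.finite_range _
  obtain ⟨f, u, hfu, hut⟩ := geometric_hahn_banach_closed_point hconv hcl hnot
  have hf : ∀ v, f v = ∑ i, f (Pi.single i 1) * v i := by
    intro v
    conv_lhs => rw [← Finset.univ_sum_single v]
    rw [map_sum]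
    refine Finset.sum_congr rfl fun i _ => ?_
    rw [mul_comm, ← smul_eq_mul, ← map_smul]
    congr 1
    rw [← Pi.single_smul, smul_eq_mul, mul_one]
  obtain ⟨v, hv, hle⟩ := exists_vertex_ge S k (fun i => f (Pi.single i 1)) ht
  rw [← hf, ← hf] at hle
  linarith [hfu v hv]

theorem dropLast_add {d : ℕ} (P Q : Set (Fin (d + 1) → ℝ)) :
    dropLast (P + Q) = dropLast P + dropLast Q :=
  Set.image_add (LinearMap.funLeft ℝ ℝ (Fin.castSucc : Fin d → Fin (d + 1)))

theorem dropLast_sum {d : ℕ} {ι : Type*} (S : Finset ι) (P : ι → Set (Fin (d + 1) → ℝ)) :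
    dropLast (∑ p ∈ S, P p) = ∑ p ∈ S, dropLast (P p) := by
  classical
  induction S using Finset.induction_on with
  | empty =>
    rw [Finset.sum_empty, Finset.sum_empty]
    exact Set.image_zero.trans rfl
  | insert p S hp ih => rw [Finset.sum_insert hp, Finset.sum_insert hp, dropLast_add, ih]

theorem dropLast_permHull (d : ℕ) (x : ℕ → ℝ) : dropLast (permHull (d + 1) x) = permBody d x := by
  ext t
  constructor
  · rintro ⟨s, hs, rfl⟩ A
    have h1 := hs.1 (A.map Fin.castSuccEmb)
    have h2 := hs.1 (A.map Fin.castSuccEmb)ᶜ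
    have h3 := Finset.sum_add_sum_compl (A.map Fin.castSuccEmb) s
    rw [Finset.card_compl, Fintype.card_fin] at h2
    rw [Finset.card_map, Finset.sum_map] at h1
    rw [Finset.card_map] at h2
    rw [Finset.sum_map, hs.2] at h3
    refine ⟨?_, h1⟩
    simp only [Function.comp, Fin.coe_castSuccEmb] at h3 ⊢
    linarith
  · intro ht
    refine ⟨Fin.snoc t (∑ k ∈ Finset.range (d + 1), x k - ∑ i, t i), ⟨fun A => ?_, ?_⟩, ?_⟩
    · have key : ∀ A : Finset (Fin (d + 1)), Fin.last d ∉ A →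
          (Finset.univ.filter fun j : Fin d => j.castSucc ∈ A).map Fin.castSuccEmb = A := by
        intro A h0
        ext j
        refine Fin.lastCases ?_ (fun j => ?_) j
        · simp [h0, Fin.castSucc_ne_last]
        · simp
      by_cases h0 : Fin.last d ∈ A
      · set B := Finset.univ.filter fun j : Fin d => j.castSucc ∈ A.erase (Fin.last d)
        have hA : insert (Fin.last d) (B.map Fin.castSuccEmb) = A := by
          rw [key _ (Finset.notMem_erase _ A), Finset.insert_erase h0]
        have hn : Fin.last d ∉ B.map Fin.castSuccEmb := by simp [Fin.castSucc_ne_last]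
        have hB : B.card ≤ d := by simpa using Finset.card_le_univ B
        rw [← hA, Finset.sum_insert hn, Finset.card_insert_of_notMem hn, Finset.card_map,
          Finset.sum_map]
        have h1 := (ht Bᶜ).1
        rw [Finset.card_compl, Fintype.card_fin, show d + 1 - (d - B.card) = B.card + 1 by omega]
          at h1
        have h2 := Finset.sum_add_sum_compl B t
        simp only [Fin.coe_castSuccEmb, Fin.snoc_castSucc, Fin.snoc_last]
        linarith
      · rw [← key A h0, Finset.card_map, Finset.sum_map]
        simpa only [Fin.coe_castSuccEmb, Fin.snoc_castSucc] using (ht _).2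
    · rw [Fin.sum_univ_castSucc]; simp
    · ext i; simp

end

section

open MvPolynomial MeasureTheory
open scoped Pointwise

/-! ### Mixed Eulerian numbers -/

theorem antitone_stepSeq (k : ℕ) : Antitone (stepSeq k) := by
  intro a b hab
  unfold stepSeq
  split_ifs <;> first | omega | norm_num

theorem bodyForm_stepSeq {d k : ℕ} (hk : k ≤ d + 1) :
    bodyForm d (stepSeq k) = X (k : ℤ) - X 0 := by
  have h : ∀ j ∈ Finset.range (d + 1),
      C (stepSeq k j) * (X ((j : ℤ) + 1) - X (j : ℤ) : MvPolynomial ℤ ℝ) =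
        if j < k then X ((j + 1 : ℕ) : ℤ) - X ((j : ℕ) : ℤ) else 0 := by
    intro j _
    unfold stepSeq
    split_ifs <;> simp
  rw [bodyForm, Finset.sum_congr rfl h, ← Finset.sum_filter,
    show (Finset.range (d + 1)).filter (· < k) = Finset.range k by ext; simp; omega,
    Finset.sum_range_sub fun j : ℕ => (X (j : ℤ) : MvPolynomial ℤ ℝ), Nat.cast_zero]

theorem bodyForm_sum {ι : Type*} (d : ℕ) (S : Finset ι) (x : ι → ℕ → ℝ) :
    bodyForm d (∑ p ∈ S, x p) = ∑ p ∈ S, bodyForm d (x p) := by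
  simp only [bodyForm, Finset.sum_apply, map_sum, Finset.sum_mul]
  exact Finset.sum_comm

theorem volume_sum_hypersimplex {ι : Type*} {d : ℕ} (S : Finset ι) {k : ι → ℕ}
    (hk : ∀ p, k p ≤ d + 1) :
    (volume (∑ p ∈ S, dropLast (hypersimplex (d + 1) (k p)))).toReal =
      eulerFun d ((∑ p ∈ S, (X (k p : ℤ) - X 0)) ^ d) / d.factorial := by
  have hanti : Antitone (∑ p ∈ S, stepSeq (k p)) := by
    intro i j hij
    simp only [Finset.sum_apply]
    exact Finset.sum_le_sum fun p _ => antitone_stepSeq (k p) hij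
  obtain ⟨h0, h1⟩ := volume_permBody d _ hanti
  rw [← dropLast_sum, sum_hypersimplex, dropLast_permHull, h1, ENNReal.toReal_ofReal h0,
    bodyForm_sum, Finset.sum_congr rfl fun p _ => bodyForm_stepSeq (hk p)]

/-- The mixed Eulerian numbers are the values of the functional on monomials of degree `d`. -/
theorem mixedEulerian_eq {d : ℕ} (c : Fin d → ℕ) (hc : ∑ j, c j = d) :
    mixedEulerian c = eulerFun d (∏ j : Fin d, X ((j : ℤ) + 1) ^ c j) := by
  have hcard : Fintype.card (Σ j : Fin d, Fin (c j)) = d := by simp [hc]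
  have hk : ∀ p : (Σ j : Fin d, Fin (c j)), (p.1 : ℕ) + 1 ≤ d + 1 := fun p => by omega
  have hpol := sum_neg_one_pow_mul_sum_pow fun p : (Σ j : Fin d, Fin (c j)) =>
    (X (((p.1 : ℕ) + 1 : ℕ) : ℤ) - X 0 : MvPolynomial ℤ ℝ)
  rw [hcard] at hpol
  have hterm : ∀ S : Finset (Σ j : Fin d, Fin (c j)), (-1 : ℝ) ^ (d - S.card) *
      (volume (∑ p ∈ S, dropLast (hypersimplex (d + 1) ((p.1 : ℕ) + 1)))).toReal =
      eulerFun d ((-1) ^ (d - S.card) *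
        (∑ p ∈ S, (X (((p.1 : ℕ) + 1 : ℕ) : ℤ) - X 0)) ^ d) / d.factorial := by
    intro S
    rw [volume_sum_hypersimplex S hk,
      show (-1 : MvPolynomial ℤ ℝ) ^ (d - S.card) = C ((-1 : ℝ) ^ (d - S.card)) by simp,
      ← smul_eq_C_mul, map_smul, smul_eq_mul, mul_div_assoc]
  have hf : (d.factorial : ℝ) ≠ 0 := by positivity
  rw [mixedEulerian, normalizedMixedVolume, hcard, Finset.sum_congr rfl fun S _ => hterm S,
    ← Finset.sum_div, ← map_sum, hpol,
    show (d.factorial : MvPolynomial ℤ ℝ) = C (d.factorial : ℝ) from (map_natCast C _).symm,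
    ← smul_eq_C_mul, map_smul, smul_eq_mul, mul_div_cancel_left₀ _ hf, ← quotFunctional_mk,
    ← quotFunctional_mk]
  congr 1
  rw [map_prod, map_prod]
  simp only [map_sub, map_pow]
  rw [(isKlyachko_eulerFun d).mk_X_eq_zero 0 (Or.inl le_rfl)]
  simp only [sub_zero]
  rw [Fintype.prod_sigma]
  refine Finset.prod_congr rfl fun j _ => ?_
  simp only [Finset.prod_const, Finset.card_univ, Fintype.card_fin]
  push_cast; rfl

@[to_additive]
theorem prod_padded {R : Type*} [CommMonoid R] {r k i : ℕ} (hi : i + k ≤ r) (a : Fin k → ℕ)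
    (f : ℕ → ℕ → R) (hf : ∀ j, f j 0 = 1) :
    ∏ j : Fin r, f j (padded r a i j) = ∏ j : Fin k, f (i + j) (a j) := by
  symm
  refine Fintype.prod_of_injective (fun j : Fin k => (⟨i + j, by omega⟩ : Fin r)) ?_ _ _ ?_ ?_
  · intro j j' h
    ext
    simpa using h
  · intro j hj
    rw [padded, dif_neg, hf]
    rintro ⟨h1, h2⟩
    exact hj ⟨⟨(j : ℕ) - i, h2⟩, by ext; simp; omega⟩
  · intro j
    rw [padded, dif_pos ⟨by simp, by simp⟩]
    simp

/-- The mixed Eulerian numbers of the shifts of `a`, through the expansion of the corresponding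
monomial into windows. -/
theorem mixedEulerian_padded {k r : ℕ} {a : Fin k → ℕ} (hkr : k ≤ r) (har : ∑ j, a j = r)
    {p : Polynomial ℝ} (hp : p.natDegree ≤ r - k)
    (hexp : ∀ (Q : Type) [CommRing Q] [Algebra ℝ Q] (y : ℤ → Q), KlyachkoSeq y → ∀ s : ℤ,
      ∏ j : Fin k, y (s + (j : ℕ)) ^ a j =
        ∑ m ∈ Finset.range (r - k + 1), p.coeff m • window y (s - m) r)
    {i : ℕ} (hi : i + k ≤ r) : mixedEulerian (padded r a i) = r.factorial * p.coeff i := by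
  have hK := isKlyachko_eulerFun r
  rw [mixedEulerian_eq _ ((sum_padded hi a (fun _ e => e) fun _ => rfl).trans har),
    prod_padded hi a (fun j e => (X ((j : ℤ) + 1) : MvPolynomial ℤ ℝ) ^ e) fun _ => pow_zero _,
    ← quotFunctional_mk, ← mul_one p]
  refine functional_monomial hkr le_rfl hp (by simp) hK.mk_X_eq_zero _ _ ?_ _ i hi ?_
  · intro j hj
    obtain rfl : j = 0 := by omega
    have : window (fun k => Ideal.Quotient.mk (nullIdeal (eulerFun r)) (X k)) (1 + (0 : ℕ)) r =
        Ideal.Quotient.mk (nullIdeal (eulerFun r)) (window X 1 r) := by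
      rw [window, window, map_prod]; simp
    rw [this, quotFunctional_mk, eulerFun_window]
    simp
  · rw [← hexp _ _ hK.klyachkoSeq, map_prod]
    refine Finset.prod_congr rfl fun j _ => ?_
    rw [map_pow]
    congr 3
    push_cast; ring

/-! ### The Tutte polynomial as a quotient of generating functions -/

theorem le_sum_of_one_le {k : ℕ} {a : Fin k → ℕ} (ha : ∀ j, 1 ≤ a j) : k ≤ ∑ j, a j := by
  simpa using Finset.sum_le_sum fun j (_ : j ∈ Finset.univ) => ha j

theorem sum_range_C_mul_X_pow {q : Polynomial ℝ} {m : ℕ} (hq : q.natDegree ≤ m) {f : ℕ → ℝ}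
    (hf : ∀ i ≤ m, f i = q.coeff i) :
    ∑ i ∈ Finset.range (m + 1), Polynomial.C (f i) * Polynomial.X ^ i = q := by
  rw [Polynomial.as_sum_range_C_mul_X_pow' (p := q) (n := m + 1) (by omega)]
  exact Finset.sum_congr rfl fun i hi => by
    rw [hf i (Nat.lt_succ_iff.1 (Finset.mem_range.1 hi))]

theorem alphaMonomial_eq_gammaMonomial {n k r : ℕ} (M : Matroid (Fin (n + 1))) (a : Fin k → ℕ)
    (ha : ∑ j, a j = r) {i : ℕ} : alphaMonomial M a ha i = gammaMonomial M a ha i := by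
  refine Subtype.ext ?_
  simp only [alphaMonomial, gammaMonomial]
  refine Finset.prod_congr rfl fun j _ => ?_
  rw [gamma, show n + 1 - ((j : ℕ) + 1 + i) = n - i - j by omega]

/-- Both sides of the identity are `r! p T_M(1, y)`, where `p` is the generating function of the
coefficients in the expansion of the monomial with exponents `a` into windows. -/
theorem exists_expansion_polynomial {n r : ℕ} {M : Matroid (Fin (n + 1))} (hE : M.E = Set.univ)
    (hloop : M.Loopless) (hr : M.eRank = ((r + 1 : ℕ) : ℕ∞)) {k : ℕ} {a : Fin k → ℕ}
    (ha : ∀ j, 1 ≤ a j) (har : ∑ j, a j = r) :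
    mixedEulerianPoly a ≠ 0 ∧
      ∑ i ∈ Finset.range (n - k + 1),
          Polynomial.C ((degree M r (gammaMonomial M a har i) : ℤ) : ℝ) * Polynomial.X ^ i =
        (tutteOne M).map (Int.castRingHom ℝ) * mixedEulerianPoly a := by
  subst har
  obtain ⟨p, hp, hp1, hexp⟩ := exists_monomial_expansion a ha rfl
  have hkr := le_sum_of_one_le ha
  have hrn := rank_le_card hE hr
  have hT := natDegree_tutteOne_le hE hr
  have hmix : mixedEulerianPoly a = Polynomial.C ((∑ j, a j).factorial : ℝ) * p := by
    rw [mixedEulerianPoly]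
    refine sum_range_C_mul_X_pow ((Polynomial.natDegree_C_mul_le _ _).trans hp) fun i hi => ?_
    rw [mixedEulerian_padded hkr rfl hp hexp (by omega), Polynomial.coeff_C_mul]
  constructor
  · rw [hmix]
    refine mul_ne_zero (Polynomial.C_ne_zero.2 (by positivity)) ?_
    rintro rfl
    simp at hp1
  · rw [hmix]
    refine sum_range_C_mul_X_pow ?_ fun i hi => ?_
    · refine Polynomial.natDegree_mul_le.trans ?_
      have := (Polynomial.natDegree_C_mul_le ((∑ j, a j).factorial : ℝ) p).trans hp
      omega
    · rw [degree_gammaMonomial hE hloop hr a rfl i (by omega),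
        functional_monomial hkr hrn hp hT (fun _ => hsClass_eq_zero hE hloop) _ _
          (pairQ_window hE hloop hr) _ i (by omega)
          (hexp _ _ (klyachkoSeq_hsClass hE hloop) _),
        mul_left_comm, Polynomial.coeff_C_mul, mul_comm p]

end

end

end MatroidChow

theorem mainTheorem2 (n r : ℕ) (M : Matroid (Fin (n + 1))) (hE : M.E = Set.univ)
    (hloop : M.Loopless) (hr : M.eRank = ((r + 1 : ℕ) : ℕ∞)) :
    (∃! φ : MatroidChow.chowPiece M r →+ ℤ, MatroidChow.IsDegreeMap M r φ) ∧
    ∀ (k : ℕ) (a : Fin k → ℕ) (_ : ∀ j, 1 ≤ a j) (ha : ∑ j, a j = r),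
      (∑ i ∈ Finset.range (n - k + 1),
          Polynomial.C ((MatroidChow.degree M r (MatroidChow.gammaMonomial M a ha i) : ℤ) : ℝ) *
            Polynomial.X ^ i
        = (MatroidChow.tutteOne M).map (Int.castRingHom ℝ) * MatroidChow.mixedEulerianPoly a) ∧
      MatroidChow.mixedEulerianPoly a ≠ 0 ∧
      algebraMap (Polynomial ℝ) (RatFunc ℝ) ((MatroidChow.tutteOne M).map (Int.castRingHom ℝ))
        = 1 / algebraMap (Polynomial ℝ) (RatFunc ℝ) (MatroidChow.mixedEulerianPoly a) *
          algebraMap (Polynomial ℝ) (RatFunc ℝ) (∑ i ∈ Finset.range (n - k + 1),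
            Polynomial.C ((MatroidChow.degree M r (MatroidChow.alphaMonomial M a ha i) : ℤ) : ℝ) *
              Polynomial.X ^ i) := by
  refine ⟨MatroidChow.existsUnique_isDegreeMap hE hloop hr, fun k a ha har => ?_⟩
  obtain ⟨hne, heq⟩ := MatroidChow.exists_expansion_polynomial hE hloop hr ha har
  refine ⟨heq, hne, ?_⟩
  simp only [MatroidChow.alphaMonomial_eq_gammaMonomial]
  rw [heq, map_mul, one_div, mul_comm, mul_assoc, mul_inv_cancel₀, mul_one]
  exact (map_ne_zero_iff _ (RatFunc.algebraMap_injective ℝ)).2 hne
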